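/- Let $X$ be an algebraic scheme over $\mathbb{C}$ (a scheme of finite type over $\mathbb{C}$) and let $\iota\colon U\hookrightarrow X$ be an open immersion such that $\operatorname{depth}\mathcal{O}_{X,p}\ge 3$ for every scheme-theoretic point $p\in X\setminus U$. Let $A$ be an Artinian local $\mathbb{C}$-algebra with maximal ideal $\mathfrak{m}_A$ and residue field $\mathbb{C}$, and let $U_A\to\operatorname{Spec}A$ be a deformation of $U$ over $A$, that is, a scheme flat over $\operatorname{Spec}A$ with a closed immersion $i\colon U\hookrightarrow U_A$ inducing an isomorphism $U\simeq U_A\times_{\operatorname{Spec}A}\operatorname{Spec}\mathbb{C}$. Since $i$ is a homeomorphism, sheaves on $U_A$ are regarded as sheaves on the topological space $U$, and $\iota_*$ of such a sheaf is a sheaf on the space $X$. Let $\mathcal{F}_{U_A}$ be an $A$-flat coherent sheaf on $U_A$. Put $\mathcal{F}_A:=\iota_*\mathcal{F}_{U_A}$, a module on the ringed space $(X,\iota_*\mathcal{O}_{U_A})$, and $\mathcal{F}:=\iota_*(\mathcal{F}_{U_A}\otimes_A A/\mathfrak{m}_A)=\iota_*i^*\mathcal{F}_{U_A}$, an $\mathcal{O}_X$-module.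 Assume that for every point $p\in X\setminus U$ the stalk $\mathcal{F}_p$ is a finitely generated $\mathcal{O}_{X,p}$-module with $\operatorname{depth}_{\mathcal{O}_{X,p}}\mathcal{F}_p\ge 3$ (the zero module has depth $\infty$). Then: (i) $R^1\iota_*(\mathcal{F}_{U_A}\otimes_A M)=0$ for every finite $A$-module $M$. (ii) The canonical map $\mathcal{F}_A\otimes_A M\to\iota_*(\mathcal{F}_{U_A}\otimes_A M)$ is an isomorphism for every finite $A$-module $M$. (iii) The ringed space $X_A:=(X,\iota_*\mathcal{O}_{U_A})$ is a scheme of finite type and flat over $A$ (and separated over $A$ if $X$ is separated), and with a closed immersion $X\hookrightarrow X_A$ that is the identity on the underlying spaces it is a deformation of $X$ over $A$, so that $\mathcal{O}_{X_A}\otimes_A\mathbb{C}\simeq\mathcal{O}_X$; this structure is compatible with that of $U_A$ via the canonical morphism $U_A\to X_A$. Moreover $\mathcal{F}_A$ is a coherent $\mathcal{O}_{X_A}$-module, flat over $A$, and the canonical map from its restriction to $X$ (that is, $\mathcal{F}_A\otimes_A\mathbb{C}$) to $\mathcal{F}$ is an isomorphism. -/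

import Mathlib

open CategoryTheory AlgebraicGeometry TopologicalSpace

noncomputable section

namespace S3Flat

section Algebra

/-- The objects of `Art_ℂ`: Artinian local `ℂ`-algebras with residue field `ℂ`. -/
class ArtC (A : Type) [CommRing A] [Algebra ℂ A] : Prop extends
    IsLocalRing A, IsArtinianRing A where
  bijective_residue : Function.Bijective (algebraMap ℂ (IsLocalRing.ResidueField A))

/-- The quotient map `A → A / 𝔪_A ≃ ℂ`. -/
def augmentation (A : Type) [CommRing A] [Algebra ℂ A] [ArtC A] : A →+* ℂ :=
  ((RingEquiv.ofBijective (algebraMap ℂ (IsLocalRing.ResidueField A))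
    ArtC.bijective_residue).symm : IsLocalRing.ResidueField A →+* ℂ).comp
      (IsLocalRing.residue A)

lemma augmentation_surjective (A : Type) [CommRing A] [Algebra ℂ A] [ArtC A] :
    Function.Surjective (augmentation A) :=
  (RingEquiv.ofBijective (algebraMap ℂ (IsLocalRing.ResidueField A))
    ArtC.bijective_residue).symm.surjective.comp IsLocalRing.residue_surjective

/-- The depth of a module over a local ring: the supremum of the lengths of the sequences
`x₁, …, xₙ` in the maximal ideal such that `xᵢ` is a nonzerodivisor on
`M / (x₁, …, xᵢ₋₁) M` for all `i`. For a nonzero finitely generated module the condition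
`M / (x₁, …, xₙ) M ≠ 0` is automatic by Nakayama's lemma; the zero module has depth `⊤`. -/
def depth (R : Type*) [CommRing R] [IsLocalRing R] (M : Type*) [AddCommGroup M] [Module R M] :
    ℕ∞ :=
  ⨆ (rs : List R) (_ : (∀ r ∈ rs, r ∈ IsLocalRing.maximalIdeal R) ∧
    RingTheory.Sequence.IsWeaklyRegular M rs), (rs.length : ℕ∞)

end Algebra

section Deformations

/-- A deformation over `A` of a `ℂ`-scheme `X` with structure morphism `s : X ⟶ Spec ℂ`: a flat
scheme `total` over `Spec A` and a morphism `incl : X ⟶ total` that identifies `X` with the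
fibre of `total` over the closed point of `Spec A`
(`incl` is then automatically a closed immersion). -/
structure Deformation {X : Scheme.{0}} (s : X ⟶ Spec (.of ℂ))
    (A : Type) [CommRing A] [Algebra ℂ A] [ArtC A] where
  /-- the total space -/
  total : Scheme.{0}
  /-- the structure morphism -/
  proj : total ⟶ Spec (.of A)
  /-- the inclusion of the closed fibre -/
  incl : X ⟶ total
  flat : Flat proj
  isPullback : IsPullback incl s proj (Spec.map (CommRingCat.ofHom (augmentation A)))

variable {X : Scheme.{0}} {s : X ⟶ Spec (.of ℂ)}
  {A : Type} [CommRing A] [Algebra ℂ A] [ArtC A] (D : Deformation s A)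

lemma Deformation.isHomeomorph_incl : IsHomeomorph D.incl := by
  have h1 : IsClosedImmersion (Spec.map (CommRingCat.ofHom (augmentation A))) :=
    IsClosedImmersion.spec_of_surjective _ (augmentation_surjective A)
  have h2 : Surjective (Spec.map (CommRingCat.ofHom (augmentation A))) := by
    refine ⟨fun y ↦ ?_⟩
    have hA : Subsingleton (PrimeSpectrum A) := inferInstance
    exact ⟨(⊥ : PrimeSpectrum ℂ), hA.elim _ _⟩
  have h3 : IsClosedImmersion D.incl :=
    MorphismProperty.of_isPullback D.isPullback.flip h1
  have h4 : Surjective D.incl := MorphismProperty.of_isPullback D.isPullback.flip h2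
  exact isHomeomorph_iff_isEmbedding_surjective.2
    ⟨D.incl.isClosedEmbedding.isEmbedding, D.incl.surjective⟩

/-- The homeomorphism from the space of a deformation of `X` to the space of `X`, inverse to
the inclusion of the closed fibre. -/
def Deformation.toFibre : (D.total : TopCat) ⟶ (X : TopCat) :=
  TopCat.ofHom ⟨D.isHomeomorph_incl.homeomorph.symm,
    D.isHomeomorph_incl.homeomorph.symm.continuous⟩

end Deformations

section Modules

/-- Coherent sheaves on a (locally Noetherian) scheme: quasi-coherent and of finite type. -/
def IsCoherent {Y : Scheme.{0}} (F : Y.Modules) : Prop :=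
  SheafOfModules.IsQuasicoherent F ∧ SheafOfModules.IsFiniteType F

/-- The `𝒪_{Y,p}`-module structure on the stalk `F_p` of an `𝒪_Y`-module `F`. -/
instance stalkModule {Y : Scheme.{0}} (F : Y.Modules) (p : Y) :
    Module (Y.presheaf.stalk p) (F.presheaf.stalk p) :=
  PresheafOfModules.instModuleCarrierStalkCommRingCatCarrierAbPresheafOpensCarrier
    (R := Y.presheaf) F.val p

/-- The sheaf of `A`-modules underlying an `𝒪_Y`-module, where `f : Y ⟶ Spec A`; the ring `A`
acts on sections through `A → Γ(Y, ⊤)`. -/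
def toSheafModule {A : Type} [CommRing A] {Y : Scheme.{0}} (f : Y ⟶ Spec (.of A)) (F : Y.Modules) :
    TopCat.Sheaf (ModuleCat.{0} A) Y :=
  (sheafCompose _ (ModuleCat.restrictScalars
    ((Scheme.ΓSpecIso (.of A)).inv ≫ f.appTop).hom)).obj
    ((SheafOfModules.forgetToSheafModuleCat Y.ringCatSheaf (.op ⊤)
      (Limits.initialOpOfTerminal Limits.isTerminalTop)).obj F)

variable {A : Type} [CommRing A] {Y Z : TopCat.{0}}

/-- The tensor product `G ⊗_A M` of a sheaf of `A`-modules with an `A`-module: the sheaf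
associated with the presheaf `V ↦ G(V) ⊗_A M`. -/
def tensor (G : TopCat.Sheaf (ModuleCat.{0} A) Y) (M : ModuleCat.{0} A) :
    TopCat.Sheaf (ModuleCat.{0} A) Y :=
  (presheafToSheaf (Opens.grothendieckTopology Y) (ModuleCat.{0} A)).obj
    (G.obj ⋙ MonoidalCategory.tensorRight M)

/-- The canonical morphism `j_* G ⊗_A M ⟶ j_* (G ⊗_A M)`, given by the maps
`G(j⁻¹ V) ⊗_A M ⟶ (G ⊗_A M)(j⁻¹ V)`. -/
def tensorPushforward (j : Y ⟶ Z) (G : TopCat.Sheaf (ModuleCat.{0} A) Y) (M : ModuleCat.{0} A) :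
    tensor ((TopCat.Sheaf.pushforward _ j).obj G) M ⟶
      (TopCat.Sheaf.pushforward _ j).obj (tensor G M) :=
  ⟨sheafifyLift (Opens.grothendieckTopology Z)
    (Functor.whiskerLeft (Opens.map j).op
      (toSheafify (Opens.grothendieckTopology Y) (G.obj ⋙ MonoidalCategory.tensorRight M)))
    ((TopCat.Sheaf.pushforward _ j).obj (tensor G M)).property⟩

/-- A sheaf of `A`-modules is flat over `A` if all its stalks are flat `A`-modules. -/
def IsFlatSheaf (G : TopCat.Sheaf (ModuleCat.{0} A) Y) : Prop :=
  ∀ y : Y, Module.Flat A (TopCat.Presheaf.stalk (C := ModuleCat.{0} A) G.obj y)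

instance pushforward_additive (j : Y ⟶ Z) :
    (TopCat.Sheaf.pushforward (ModuleCat.{0} A) j).Additive where
  map_add := rfl

/-- The higher direct image `Rⁿ j_* G` of a sheaf of `A`-modules. -/
def higherDirectImage (j : Y ⟶ Z) (n : ℕ) (G : TopCat.Sheaf (ModuleCat.{0} A) Y) :
    TopCat.Sheaf (ModuleCat.{0} A) Z :=
  ((TopCat.Sheaf.pushforward (ModuleCat.{0} A) j).rightDerived n).obj G

/-- The base change morphism `c^* k_* F ⟶ b_* a^* F` of a commutative square `a ≫ k = b ≫ c`,
adjoint to `k_* F ⟶ k_* a_* a^* F = c_* b_* a^* F`. -/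
def baseChange {U V X W : Scheme.{0}} {a : U ⟶ V} {k : V ⟶ W} {b : U ⟶ X} {c : X ⟶ W}
    (h : a ≫ k = b ≫ c) (F : V.Modules) :
    (Scheme.Modules.pullback c).obj ((Scheme.Modules.pushforward k).obj F) ⟶
      (Scheme.Modules.pushforward b).obj ((Scheme.Modules.pullback a).obj F) :=
  ((Scheme.Modules.pullbackPushforwardAdjunction c).homEquiv _ _).symm
    ((Scheme.Modules.pushforward k).map
        ((Scheme.Modules.pullbackPushforwardAdjunction a).unit.app F) ≫
      (Scheme.Modules.pushforwardComp a k).hom.app _ ≫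
      (Scheme.Modules.pushforwardCongr h).hom.app _ ≫
      (Scheme.Modules.pushforwardComp b c).inv.app _)

end Modules

section RingedSpaces

/-- The ringed space `(Z, j_* 𝒪_Y)` for a continuous map `j : Y ⟶ Z` from a scheme. -/
def pushforwardSpace (Y : Scheme.{0}) {Z : TopCat.{0}} (j : (Y : TopCat) ⟶ Z) :
    SheafedSpace CommRingCat.{0} where
  carrier := Z
  presheaf := ((TopCat.Sheaf.pushforward _ j).obj Y.sheaf).obj
  IsSheaf := ((TopCat.Sheaf.pushforward _ j).obj Y.sheaf).property

/-- The canonical morphism of ringed spaces `Y ⟶ (Z, j_* 𝒪_Y)`: it is `j` on the spaces and the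
identity of `j_* 𝒪_Y` on the sheaves. -/
def toPushforwardSpace (Y : Scheme.{0}) {Z : TopCat.{0}} (j : (Y : TopCat) ⟶ Z) :
    Y.toSheafedSpace ⟶ pushforwardSpace Y j :=
  InducedCategory.homMk { base := j, c := 𝟙 _ }

end RingedSpaces

end S3Flat

end

/-!
Write `j` for the map `ι` seen on the space of the deformation `U_A`, let `V` be an affine open
subset of `X`, and let `W = j⁻¹ V`. Everything follows from the vanishing of `H¹(W, F ⊗ A / 𝔪)`.

*Vanishing on the closed fibre.* The sheaf `F ⊗ A / 𝔪` is the restriction `i^* F` of `F` to `U`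
(`IsFibreRestriction.isIso_tensorToFibre`), so that its first cohomology over `W` is computed by Čech
cocycles on `V ∩ U`, with coefficients in localizations of the module `N = Γ(V, ι_* i^* F)`. Given
a cocycle `g`, consider the ideal `I` of all functions `c` on `V` such that `c g` is a coboundary. If
`I` is not the unit ideal, some colon ideal `p = (I : b)` is prime; it is the ideal of a point
outside `U`, because powers of the functions that define the cover lie in `I`. Three members `x`, `y`,
`z` of a regular sequence at `p` multiply `b g` into the coboundaries, and a Koszul computation
(`exists_smul_coboundary`) shows that so does an element outside `p`, a contradiction. This is
`cech_coboundary`, and leads to `h1Vanishes_of_hasRegularTriple` and `IsFibreRestriction.h1Vanishes`.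
Here `H¹(W, G) = 0` is understood as the surjectivity of `I(W) ⟶ Q(W)` for all short exact sequences
`0 ⟶ G ⟶ I ⟶ Q ⟶ 0`, which is a form that passes directly to extensions and to derived functors.

*Dévissage.* As `F` is flat over `A`, the functor `M ↦ F ⊗ M` is exact (`IsTensorBasis.shortExact`).
A finite module over the Artinian ring `A` is an iterated extension of copies of `A / 𝔪`, so that
`H¹(W, F ⊗ M) = 0` for all finite `M` (`IsTensorBasis.H1Vanishes_tensor`); hence `R¹ j_* (F ⊗ M) = 0`
(`isZero_higherDirectImage`). It follows that `M ↦ Γ(W, F ⊗ M)` is exact, so that it agrees with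
`Γ(W, F) ⊗ M` (`IsTensorBasis.toTensor_bijective`) and `Γ(W, F)` is flat over `A`
(`IsTensorBasis.flat_sections`). For `M = A / 𝔪` this says that `Γ(W, F)` reduces to
`Γ(V, ι_* i^* F)` modulo `𝔪` (`IsFibreRestriction.surjective_and_ker`).

*The scheme `X_A`.* The same applies to the structure sheaf, since `ι_* 𝒪_U = 𝒪_X` by the depth
condition on `X` (`isIso_app_of_depth`). Thus `Γ(W, 𝒪)` is flat over `A`, and `Γ(W, 𝒪) ⟶ Γ(V, 𝒪_X)`
is surjective with kernel generated by `𝔪`, hence nilpotent (`surjective_and_ker_structureModule`). So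
the spectra of `Γ(W, 𝒪)` and of `Γ(V, 𝒪_X)` have the same space `V`, and `Spec Γ(W, 𝒪)` is a chart of
the ringed space `(X, j_* 𝒪)`, because on the quasi-compact and quasi-separated scheme `W` functions
localize on basic open sets (`isIso_toSpecΓ_app`, `IsThickeningSpan.exists_scheme`). The scheme so
obtained has closed fibre `X`, as the ideal of `X` is generated by `𝔪` (`IsExtension.isPullback`), and
the remaining properties are checked on affine open sets, modulo the nilpotent ideal `𝔪`.

*Coherence and base change.* The module `Γ(V, ι_* i^* F)` is finitely generated: it is so over `U`
and at the points outside `U`, and it has no sections supported outside `U`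
(`finite_of_finite_at_primes`). By Nakayama's lemma for the nilpotent ideal `𝔪` so is `Γ(W, F)`, which
gives the coherence of `j_* F` (`IsExtension.isCoherent_pushforward`). The base change morphism to the
closed fibre is an isomorphism, as both sides have the sections `Γ(W, F)` modulo `𝔪` over `V`
(`IsExtension.isIso_baseChange`).
-/

noncomputable section

namespace S3Flat

/-! ### Commutative algebra: regular sequences, the Čech complex and finiteness -/

section CommutativeAlgebra

/-- The module `N` has a weakly regular sequence of length two at the prime `p`, in terms of
elements of `N`. -/
def HasRegularPair {R : Type*} [CommRing R] (p : Ideal R) (N : Type*) [AddCommGroup N]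
    [Module R N] : Prop :=
  ∃ x ∈ p, ∃ y ∈ p,
    (∀ n : N, x • n = 0 → ∃ s ∉ p, s • n = 0) ∧
    (∀ n m : N, y • n = x • m → ∃ s ∉ p, ∃ a : N, s • n = x • a)

/-- The module `N` has a weakly regular sequence of length three at the prime `p`, in terms of
elements of `N`. -/
def HasRegularTriple {R : Type*} [CommRing R] (p : Ideal R) (N : Type*) [AddCommGroup N]
    [Module R N] : Prop :=
  ∃ x ∈ p, ∃ y ∈ p, ∃ z ∈ p,
    (∀ n : N, x • n = 0 → ∃ s ∉ p, s • n = 0) ∧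
    (∀ n m : N, y • n = x • m → ∃ s ∉ p, ∃ a : N, s • n = x • a) ∧
    (∀ n m l : N, z • n = x • m + y • l → ∃ s ∉ p, ∃ a b : N, s • n = x • a + y • b)

lemma HasRegularTriple.pair {R : Type*} [CommRing R] {p : Ideal R} {N : Type*} [AddCommGroup N]
    [Module R N] (h : HasRegularTriple p N) : HasRegularPair p N := by
  obtain ⟨x, hx, y, hy, z, hz, h1, h2, -⟩ := h
  exact ⟨x, hx, y, hy, h1, h2⟩

lemma hasRegularTriple_congr {R : Type*} [CommRing R] {p : Ideal R} {N N' : Type*}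
    [AddCommGroup N] [Module R N] [AddCommGroup N'] [Module R N'] (e : N ≃ₗ[R] N')
    (h : HasRegularTriple p N) : HasRegularTriple p N' := by
  obtain ⟨x, hx, y, hy, z, hz, h1, h2, h3⟩ := h
  refine ⟨x, hx, y, hy, z, hz, fun n hn ↦ ?_, fun n m hn ↦ ?_, fun n m l hn ↦ ?_⟩
  · obtain ⟨s, hs, h⟩ := h1 (e.symm n) (by rw [← map_smul, hn, map_zero])
    exact ⟨s, hs, by simpa using congr(e $h)⟩
  · obtain ⟨s, hs, a, h⟩ := h2 (e.symm n) (e.symm m) (by rw [← map_smul, hn, map_smul])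
    exact ⟨s, hs, e a, by simpa using congr(e $h)⟩
  · obtain ⟨s, hs, a, b, h⟩ := h3 (e.symm n) (e.symm m) (e.symm l)
      (by rw [← map_smul, hn, map_add, map_smul, map_smul])
    exact ⟨s, hs, e a, e b, by simpa using congr(e $h)⟩

lemma QuotSMulTop.mk_eq_zero_iff {R M : Type*} [CommRing R] [AddCommGroup M] [Module R M] (x : R)
    (m : M) : (Submodule.Quotient.mk m : QuotSMulTop x M) = 0 ↔ ∃ a, m = x • a := by
  rw [Submodule.Quotient.mk_eq_zero, Submodule.mem_smul_pointwise_iff_exists]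
  simp [eq_comm]

/-- A module of depth at least three has a weakly regular sequence of length three; the conditions
on its successive quotients are spelled out in terms of elements. -/
lemma exists_regular_triple_of_depth {R M : Type*} [CommRing R] [IsLocalRing R] [AddCommGroup M]
    [Module R M] (h : 3 ≤ depth R M) :
    ∃ x ∈ IsLocalRing.maximalIdeal R, ∃ y ∈ IsLocalRing.maximalIdeal R,
      ∃ z ∈ IsLocalRing.maximalIdeal R,
      (∀ n : M, x • n = 0 → n = 0) ∧
      (∀ n m : M, y • n = x • m → ∃ a : M, n = x • a) ∧
      (∀ n m l : M, z • n = x • m + y • l → ∃ a b : M, n = x • a + y • b) := by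
  have h' : (2 : ℕ∞) < depth R M := lt_of_lt_of_le (by norm_num) h
  obtain ⟨rs, ⟨hrs, hreg⟩, hlen⟩ : ∃ rs : List R, ((∀ r ∈ rs, r ∈ IsLocalRing.maximalIdeal R) ∧
      RingTheory.Sequence.IsWeaklyRegular M rs) ∧ 2 < rs.length := by
    simp only [depth, lt_iSup_iff] at h'
    obtain ⟨rs, h1, h2⟩ := h'
    exact ⟨rs, h1, by exact_mod_cast h2⟩
  match rs, hrs, hreg, hlen with
  | x :: y :: z :: t, hrs, hreg, _ =>
    rw [RingTheory.Sequence.isWeaklyRegular_cons_iff, RingTheory.Sequence.isWeaklyRegular_cons_iff,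
      RingTheory.Sequence.isWeaklyRegular_cons_iff] at hreg
    obtain ⟨h1, h2, h3, -⟩ := hreg
    refine ⟨x, hrs x (by simp), y, hrs y (by simp), z, hrs z (by simp), fun n hn ↦ ?_,
      fun n m hn ↦ ?_, fun n m l hn ↦ ?_⟩
    · exact h1.right_eq_zero_of_smul hn
    · rw [← QuotSMulTop.mk_eq_zero_iff]
      refine h2.right_eq_zero_of_smul ?_
      rw [← Submodule.Quotient.mk_smul, QuotSMulTop.mk_eq_zero_iff]
      exact ⟨m, hn⟩
    · have : (Submodule.Quotient.mk (Submodule.Quotient.mk n : QuotSMulTop x M) :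
          QuotSMulTop y (QuotSMulTop x M)) = 0 := by
        refine h3.right_eq_zero_of_smul ?_
        rw [← Submodule.Quotient.mk_smul, QuotSMulTop.mk_eq_zero_iff]
        refine ⟨Submodule.Quotient.mk l, ?_⟩
        rw [← Submodule.Quotient.mk_smul, ← Submodule.Quotient.mk_smul, ← sub_eq_zero,
          ← Submodule.Quotient.mk_sub, QuotSMulTop.mk_eq_zero_iff]
        exact ⟨m, by rw [hn]; abel⟩
      rw [QuotSMulTop.mk_eq_zero_iff] at this
      obtain ⟨b, hb⟩ := this
      obtain ⟨b, rfl⟩ := Submodule.Quotient.mk_surjective _ b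
      rw [← Submodule.Quotient.mk_smul, ← sub_eq_zero, ← Submodule.Quotient.mk_sub,
        QuotSMulTop.mk_eq_zero_iff] at hb
      obtain ⟨a, ha⟩ := hb
      exact ⟨a, b, by rw [← ha]; abel⟩

/-- A module whose localization at `p` has depth at least three has a weakly regular sequence of
length three at `p`: the denominators of a regular sequence on the localization are units. -/
lemma hasRegularTriple_of_depth {R Rp N Np : Type*} [CommRing R] [CommRing Rp] [IsLocalRing Rp]
    [Algebra R Rp] (p : Ideal R) [p.IsPrime] [IsLocalization.AtPrime Rp p] [AddCommGroup N]
    [Module R N] [AddCommGroup Np] [Module R Np] [Module Rp Np] [IsScalarTower R Rp Np]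
    (φ : N →ₗ[R] Np) [IsLocalizedModule p.primeCompl φ] (h : 3 ≤ depth Rp Np) :
    HasRegularTriple p N := by
  -- a member of the regular sequence is an element of `p` up to a unit
  have key : ∀ x' ∈ IsLocalRing.maximalIdeal Rp, ∃ x ∈ p, ∃ u v : Rp,
      u * v = 1 ∧ x' = algebraMap R Rp x * u := by
    intro x' hx'
    obtain ⟨⟨x, s⟩, hxs⟩ := IsLocalization.surj p.primeCompl x'
    have hu := IsLocalization.map_units Rp s
    obtain ⟨v, hv⟩ := hu
    have hxs' : x' = algebraMap R Rp x * ↑v⁻¹ := by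
      rw [Units.eq_mul_inv_iff_mul_eq, hv, hxs]
    refine ⟨x, ?_, ↑v⁻¹, v, by simp, hxs'⟩
    rw [← IsLocalization.AtPrime.to_map_mem_maximal_iff Rp p x, ← hxs]
    exact Ideal.mul_mem_right _ _ hx'
  obtain ⟨x', hx', y', hy', z', hz', h1, h2, h3⟩ := exists_regular_triple_of_depth h
  obtain ⟨x, hx, u, u', hu, rfl⟩ := key x' hx'
  obtain ⟨y, hy, v, v', hv, rfl⟩ := key y' hy'
  obtain ⟨z, hz, w, w', hw, rfl⟩ := key z' hz'
  have hx2 (a : Np) : (algebraMap R Rp x * u) • (u' • a) = x • a := by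
    rw [smul_smul, mul_assoc, hu, mul_one, algebraMap_smul]
  have hy2 (a : Np) : (algebraMap R Rp y * v) • (v' • a) = y • a := by
    rw [smul_smul, mul_assoc, hv, mul_one, algebraMap_smul]
  have hx3 (a : Np) : (algebraMap R Rp x * u) • a = x • (u • a) := by
    rw [mul_smul, algebraMap_smul]
  have hy3 (a : Np) : (algebraMap R Rp y * v) • a = y • (v • a) := by
    rw [mul_smul, algebraMap_smul]
  have hz3 (a : Np) : (algebraMap R Rp z * w) • a = w • (z • a) := by
    rw [mul_comm, mul_smul, algebraMap_smul]
  -- the elements of the localization produced by regularity are cleared of denominators, and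
  -- equations are lifted to `N`, at the cost of factors outside `p`
  have clear (n : N) (a : Np) : ∃ s ∉ p, ∃ a₀ : N, s • a = φ a₀ := by
    obtain ⟨⟨a₀, s⟩, ha⟩ := IsLocalizedModule.surj p.primeCompl φ a
    exact ⟨s, s.2, a₀, ha⟩
  have eqz (n : N) (hn : φ n = 0) : ∃ s ∉ p, s • n = 0 := by
    obtain ⟨s, hs⟩ := (IsLocalizedModule.eq_zero_iff p.primeCompl φ).1 hn
    exact ⟨s, s.2, hs⟩
  have pm {s t : R} (hs : s ∉ p) (ht : t ∉ p) : s * t ∉ p :=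
    fun h ↦ (Ideal.IsPrime.mem_or_mem ‹_› h).elim hs ht
  refine ⟨x, hx, y, hy, z, hz, fun n hn ↦ ?_, fun n m hn ↦ ?_, fun n m l hn ↦ ?_⟩
  · refine eqz n ?_
    have : u' • φ n = 0 := h1 _ (by rw [hx2, ← map_smul, hn, map_zero])
    calc φ n = u • u' • φ n := by rw [smul_smul, hu, one_smul]
      _ = 0 := by rw [this, smul_zero]
  · obtain ⟨a, ha⟩ := h2 (v' • φ n) (u' • φ m) (by rw [hx2, hy2, ← map_smul, hn, map_smul])
    have ha' : φ n = x • ((v * u) • a) := by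
      calc φ n = v • v' • φ n := by rw [smul_smul, hv, one_smul]
        _ = _ := by rw [ha, hx3, smul_comm, mul_smul]
    obtain ⟨s, hs, a₀, h4⟩ := clear n ((v * u) • a)
    obtain ⟨t, ht, h5⟩ := eqz (s • n - x • a₀) (by
      rw [map_sub, map_smul, map_smul, ha', smul_comm, h4, sub_self])
    refine ⟨t * s, pm ht hs, t • a₀, ?_⟩
    rw [smul_sub, sub_eq_zero] at h5
    rw [mul_smul, h5, smul_comm]
  · obtain ⟨a, b, hab⟩ := h3 (w' • φ n) (u' • φ m) (v' • φ l) (by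
      rw [hx2, hy2, hz3, smul_comm z, smul_smul, hw, one_smul, ← map_smul, hn, map_add, map_smul,
        map_smul])
    have ha' : φ n = x • ((w * u) • a) + y • ((w * v) • b) := by
      calc φ n = w • w' • φ n := by rw [smul_smul, hw, one_smul]
        _ = _ := by rw [hab, hx3, hy3, smul_add, smul_comm, smul_comm w y, mul_smul, mul_smul]
    obtain ⟨s, hs, a₀, h4⟩ := clear n ((w * u) • a)
    obtain ⟨s', hs', b₀, h4'⟩ := clear n ((w * v) • b)
    obtain ⟨t, ht, h5⟩ := eqz ((s * s') • n - (x • s' • a₀ + y • s • b₀)) (by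
      rw [map_sub, map_smul, ha', map_add, map_smul, map_smul, map_smul, map_smul, ← h4, ← h4',
        sub_eq_zero, smul_add]
      congr 1
      · rw [smul_comm, mul_comm, mul_smul]
      · rw [smul_comm, mul_smul])
    refine ⟨t * (s * s'), pm ht (pm hs hs'), t • s' • a₀, t • s • b₀, ?_⟩
    rw [smul_sub, sub_eq_zero] at h5
    rw [mul_smul, h5, smul_add, smul_comm t x, smul_comm t y]

/-- An ideal of a Noetherian ring is the unit ideal if no colon ideal `(I : b)` is prime. -/
lemma ideal_eq_top_of_colon {R : Type*} [CommRing R] [IsNoetherianRing R] (I : Ideal R)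
    (h : ∀ (p : Ideal R) (b : R), p.IsPrime → (∀ c, c ∈ p ↔ c * b ∈ I) → False) : I = ⊤ := by
  by_contra hI
  have : Nontrivial (R ⧸ I) := Ideal.Quotient.nontrivial_iff.2 hI
  obtain ⟨p, hp⟩ := associatedPrimes.nonempty R (R ⧸ I)
  rw [AssociatedPrimes.mem_iff, isAssociatedPrime_iff] at hp
  obtain ⟨hp, x, hx⟩ := hp
  obtain ⟨b, rfl⟩ := Ideal.Quotient.mk_surjective x
  refine h p b hp fun c ↦ ?_
  rw [hx, Submodule.mem_colon_singleton, Submodule.mem_bot, ← Ideal.Quotient.eq_zero_iff_mem, map_mul]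
  rfl

section Cech

variable {R : Type*} [CommRing R] {ι : Type*} [Finite ι] (f : ι → R)
  {N : Type*} [AddCommGroup N] [Module R N]
  {N₁ : ι → Type*} [∀ i, AddCommGroup (N₁ i)] [∀ i, Module R (N₁ i)]
  {N₂ : ι → ι → Type*} [∀ i j, AddCommGroup (N₂ i j)] [∀ i j, Module R (N₂ i j)]
  (a : ∀ i, N →ₗ[R] N₁ i) (l : ∀ i j, N₁ i →ₗ[R] N₂ i j) (r : ∀ i j, N₁ j →ₗ[R] N₂ i j)

omit [Finite ι] in
/-- Choosing a common multiplier outside a prime ideal for finitely many indices. -/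
lemma exists_common_notMem [Finite ι] (p : Ideal R) [hp : p.IsPrime] {P : ι → R → Prop}
    (hP : ∀ i s t, P i s → P i (t * s)) (h : ∀ i, ∃ s ∉ p, P i s) : ∃ s ∉ p, ∀ i, P i s := by
  classical
  have := Fintype.ofFinite ι
  choose s hs hs' using h
  refine ⟨∏ i, s i, fun h ↦ ?_, fun i ↦ ?_⟩
  · obtain ⟨i, -, hi⟩ := hp.prod_mem_iff.1 h
    exact hs i hi
  · rw [← Finset.prod_erase_mul _ _ (Finset.mem_univ i)]
    exact hP _ _ _ (hs' i)

omit [Finite ι] in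
lemma exists_common_pow [Finite ι] {P : ι → ℕ → Prop}
    (hP : ∀ i m n, m ≤ n → P i m → P i n) (h : ∀ i, ∃ n, P i n) : ∃ n, ∀ i, P i n := by
  have := Fintype.ofFinite ι
  choose n hn using h
  exact ⟨Finset.univ.sup n, fun i ↦ hP i _ _ (Finset.le_sup (Finset.mem_univ i)) (hn i)⟩

variable (hal : ∀ i j n, l i j (a i n) = r i j (a j n))
  (inj : ∀ n, (∀ i, a i n = 0) → n = 0)
  (hloc : ∀ i, IsLocalizedModule.Away (f i) (a i))

omit [Finite ι] in
include hloc in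
lemma smul_eq_zero_of_localization {p : Ideal R} {x : R}
    (h1 : ∀ n : N, x • n = 0 → ∃ s ∉ p, s • n = 0) (i : ι) (n : N₁ i) (hn : x • n = 0) :
    ∃ s ∉ p, s • n = 0 := by
  have := hloc i
  obtain ⟨⟨n₀, t⟩, h⟩ := IsLocalizedModule.surj (.powers (f i)) (a i) n
  have hx : a i (x • n₀) = 0 := by
    rw [map_smul, ← h, Submonoid.smul_def, smul_comm, hn, smul_zero]
  obtain ⟨u, hu⟩ := (IsLocalizedModule.eq_zero_iff (.powers (f i)) (a i)).1 hx
  rw [Submonoid.smul_def, smul_comm] at hu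
  obtain ⟨s, hs, h'⟩ := h1 _ hu
  refine ⟨s, hs, ?_⟩
  have h2 := congr(a i $h')
  rw [map_zero, map_smul, map_smul, ← h, ← Submonoid.smul_def] at h2
  refine IsLocalizedModule.smul_injective (a i) t (IsLocalizedModule.smul_injective (a i) u ?_)
  simp only [Submonoid.smul_def, smul_zero] at h2 ⊢
  rw [← h2, smul_comm (t : R) s, smul_comm (u : R) s]

omit [Finite ι] in
include hloc in
lemma mem_smul_of_localization {p : Ideal R} {x y : R}
    (h2 : ∀ n m : N, y • n = x • m → ∃ s ∉ p, ∃ a : N, s • n = x • a) (i : ι) (n m : N₁ i)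
    (hn : y • n = x • m) : ∃ s ∉ p, ∃ b, s • n = x • b := by
  have := hloc i
  obtain ⟨⟨n₀, t⟩, h⟩ := IsLocalizedModule.surj (.powers (f i)) (a i) n
  obtain ⟨⟨m₀, t'⟩, h'⟩ := IsLocalizedModule.surj (.powers (f i)) (a i) m
  simp only [Submonoid.smul_def] at h h'
  have hx : a i (y • (t' : R) • n₀ - x • (t : R) • m₀) = 0 := by
    rw [map_sub, map_smul, map_smul, map_smul, map_smul, ← h, ← h', sub_eq_zero,
      smul_comm y, smul_comm y, hn, smul_comm (t' : R), smul_comm (t' : R) x, smul_comm (t : R) x]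
  obtain ⟨u, hu⟩ := (IsLocalizedModule.eq_zero_iff (.powers (f i)) (a i)).1 hx
  rw [Submonoid.smul_def, smul_sub, sub_eq_zero, smul_comm _ y, smul_comm _ x] at hu
  obtain ⟨s, hs, b, hb⟩ := h2 _ _ hu
  obtain ⟨b', hb'⟩ : ∃ b', (u * t' * t) • b' = a i b := by
    have := IsLocalizedModule.map_units (a i) (u * t' * t)
    rw [Module.End.isUnit_iff] at this
    exact this.2 (a i b)
  refine ⟨s, hs, b', ?_⟩
  refine IsLocalizedModule.smul_injective (a i) (u * t' * t) ?_
  have h3 := congr(a i $hb)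
  rw [map_smul, map_smul, map_smul, map_smul, ← h, ← hb'] at h3
  simp only [Submonoid.smul_def, mul_smul] at h3 ⊢
  rw [smul_comm _ s, smul_comm _ s, smul_comm _ s, h3, smul_comm x, smul_comm x, smul_comm x]

include hal inj hloc in
/-- If `x, y, z` is a weakly regular sequence at `p` and the multiples of the Čech `1`-cochain `g`
by `x`, `y`, `z` are coboundaries, then so is a multiple of `g` by an element outside `p`. -/
lemma exists_smul_coboundary
    (glue : ∀ h : ∀ i, N₁ i, (∀ i j, l i j (h i) = r i j (h j)) → ∃ n, ∀ i, a i n = h i)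
    (hloc₂ : ∀ i j, IsLocalizedModule.Away (f i * f j) (l i j ∘ₗ a i))
    (p : Ideal R) [hp : p.IsPrime] (g : ∀ i j, N₂ i j) (x y z : R)
    (h1 : ∀ n : N, x • n = 0 → ∃ s ∉ p, s • n = 0)
    (h2 : ∀ n m : N, y • n = x • m → ∃ s ∉ p, ∃ a : N, s • n = x • a)
    (h3 : ∀ n m l : N, z • n = x • m + y • l → ∃ s ∉ p, ∃ a b : N, s • n = x • a + y • b)
    (hx : ∃ h : ∀ i, N₁ i, ∀ i j, x • g i j = l i j (h i) - r i j (h j))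
    (hy : ∃ h : ∀ i, N₁ i, ∀ i j, y • g i j = l i j (h i) - r i j (h j))
    (hz : ∃ h : ∀ i, N₁ i, ∀ i j, z • g i j = l i j (h i) - r i j (h j)) :
    ∃ s ∉ p, ∃ h : ∀ i, N₁ i, ∀ i j, s • g i j = l i j (h i) - r i j (h j) := by
  have pm {s t : R} (hs : s ∉ p) (ht : t ∉ p) : s * t ∉ p :=
    fun h ↦ (hp.mem_or_mem h).elim hs ht
  obtain ⟨h, hx⟩ := hx
  obtain ⟨k, hy⟩ := hy
  obtain ⟨e, hz⟩ := hz
  -- if `b • g = ∂u` and `c • g = ∂v`, then `c • u - b • v` is a cocycle of degree zero, hence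
  -- global
  have aux {b c : R} {u v : ∀ i, N₁ i} (hb : ∀ i j, b • g i j = l i j (u i) - r i j (u j))
      (hc : ∀ i j, c • g i j = l i j (v i) - r i j (v j)) :
      ∃ n, ∀ i, a i n = c • u i - b • v i := by
    refine glue _ fun i j ↦ ?_
    rw [map_sub, map_smul, map_smul, map_sub, map_smul, map_smul, sub_eq_sub_iff_sub_eq_sub,
      ← smul_sub, ← smul_sub, ← hb, ← hc, smul_comm]
  obtain ⟨n, hn⟩ := aux hx hy
  obtain ⟨n', hn'⟩ := aux hx hz
  obtain ⟨m, hm⟩ := aux hz hy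
  -- for `x • g = ∂h`, `y • g = ∂k` and `z • g = ∂e`, the elements `n = y • h - x • k`,
  -- `n' = z • h - x • e` and `m = y • e - z • k` of `N` satisfy a Koszul relation
  have e1 : z • n = x • m + y • n' := by
    rw [← sub_eq_zero]
    refine inj _ fun i ↦ ?_
    rw [map_sub, map_add, map_smul, map_smul, map_smul, hn, hn', hm]
    module
  obtain ⟨s, hs, α, β, hαβ⟩ := h3 _ _ _ e1
  -- by `s • n = x • α + y • β`, the multiple of `s • h - β` by `y` is divisible by `x`, and by the
  -- regularity of `y` on `N / x N` so is `s • h - β` itself, up to an element outside `p`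
  have e2 (i) : ∃ s' ∉ p, ∃ b, s' • (s • h i - a i β) = x • b := by
    refine mem_smul_of_localization f a hloc h2 i _ (s • k i + a i α) ?_
    have := congr(a i $hαβ)
    rw [map_smul, hn, map_add, map_smul, map_smul] at this
    rw [← sub_eq_zero] at this ⊢
    rw [← this]
    module
  obtain ⟨s', hs', e3⟩ := exists_common_notMem p (P := fun i s' ↦ ∃ b, s' • (s • h i - a i β) = x • b)
    (by
      rintro i s t ⟨b, hb⟩
      exact ⟨t • b, by rw [mul_smul, hb, smul_comm]⟩) e2
  choose γ hγ using e3
  -- `∂(s • h - β) = s • ∂h = x • s • g`, as `β` is global; dividing by the nonzerodivisor `x` shows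
  -- that, up to an element outside `p`, `s' • s • g` is the coboundary of `γ`
  have e4 (q : ι × ι) : ∃ s'' ∉ p,
      s'' • ((s' * s) • g q.1 q.2 - (l q.1 q.2 (γ q.1) - r q.1 q.2 (γ q.2))) = 0 := by
    refine smul_eq_zero_of_localization (fun q : ι × ι ↦ f q.1 * f q.2)
      (fun q : ι × ι ↦ l q.1 q.2 ∘ₗ a q.1) (fun q ↦ hloc₂ q.1 q.2) h1 q _ ?_
    obtain ⟨i, j⟩ := q
    rw [smul_sub, smul_comm x, hx, smul_sub x, ← map_smul (l i j), ← map_smul (r i j), ← hγ, ← hγ]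
    simp only [map_smul, map_sub, hal]
    module
  obtain ⟨s'', hs'', e5⟩ := exists_common_notMem p
    (P := fun (q : ι × ι) s'' ↦
      s'' • ((s' * s) • g q.1 q.2 - (l q.1 q.2 (γ q.1) - r q.1 q.2 (γ q.2))) = 0)
    (by
      rintro i s t h
      rw [mul_smul, h, smul_zero]) e4
  refine ⟨s'' * (s' * s), pm hs'' (pm hs' hs), fun i ↦ s'' • γ i, fun i j ↦ ?_⟩
  have := e5 (i, j)
  rw [smul_sub, sub_eq_zero] at this
  rw [mul_smul, this, smul_sub, map_smul, map_smul]

/-- Vanishing of Čech cohomology: if the localizations of `N` at all primes containing the ideal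
`(fᵢ)` have depth at least three, then Čech `1`-cocycles are coboundaries. A prime `(I : b)`, where
`I` is the ideal of all `c` such that `c • g` is a coboundary, contradicts
`exists_smul_coboundary`. -/
theorem cech_coboundary [IsNoetherianRing R]
    {N₃ : ι → ι → ι → Type*} [∀ i j k, AddCommGroup (N₃ i j k)] [∀ i j k, Module R (N₃ i j k)]
    (u : ∀ i j k, N₂ i j →ₗ[R] N₃ i j k) (v : ∀ i j k, N₂ i k →ₗ[R] N₃ i j k)
    (w : ∀ i j k, N₂ j k →ₗ[R] N₃ i j k)
    (hal : ∀ i j n, l i j (a i n) = r i j (a j n))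
    (huv : ∀ i j k n, v i j k (l i k n) = u i j k (l i j n))
    (huw : ∀ i j k n, w i j k (l j k n) = u i j k (r i j n))
    (inj : ∀ n, (∀ i, a i n = 0) → n = 0)
    (glue : ∀ h : ∀ i, N₁ i, (∀ i j, l i j (h i) = r i j (h j)) → ∃ n, ∀ i, a i n = h i)
    (hloc : ∀ i, IsLocalizedModule.Away (f i) (a i))
    (hloc₂ : ∀ i j, IsLocalizedModule.Away (f i * f j) (l i j ∘ₗ a i))
    (ext₂ : ∀ i j (n : N₂ i j), ∃ (k : ℕ) (t : N₁ i), f j ^ k • n = l i j t)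
    (inj₃ : ∀ i j k n, u i j k n = 0 → ∃ m : ℕ, f k ^ m • n = 0)
    (hreg : ∀ p : Ideal R, p.IsPrime → (∀ i, f i ∈ p) → HasRegularTriple p N)
    (g : ∀ i j, N₂ i j) (hg : ∀ i j k, v i j k (g i k) = u i j k (g i j) + w i j k (g j k)) :
    ∃ h : ∀ i, N₁ i, ∀ i j, g i j = l i j (h i) - r i j (h j) := by
  -- the ideal of all `c` such that `c • g` is a coboundary
  let I : Ideal R :=
    { carrier := {c | ∃ h : ∀ i, N₁ i, ∀ i j, c • g i j = l i j (h i) - r i j (h j)}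
      zero_mem' := ⟨0, by simp⟩
      add_mem' := by
        rintro b c ⟨h, hh⟩ ⟨h', hh'⟩
        exact ⟨h + h', fun i j ↦ by
          rw [add_smul, hh, hh', Pi.add_apply, Pi.add_apply, map_add, map_add]; abel⟩
      smul_mem' := by
        rintro b c ⟨h, hh⟩
        exact ⟨b • h, fun i j ↦ by
          rw [smul_eq_mul, mul_smul, hh, smul_sub, Pi.smul_apply, Pi.smul_apply, map_smul,
            map_smul]⟩ }
  -- after multiplication by a power of `f k`, the elements `g i k` extend to `t i`, and `g` becomes
  -- the coboundary of `t` by the cocycle condition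
  have hf (k) : ∃ n, f k ^ n ∈ I := by
    obtain ⟨n, hn⟩ := exists_common_pow (P := fun i n ↦ ∃ t, f k ^ n • g i k = l i k t)
      (by
        rintro i m n hmn ⟨t, ht⟩
        refine ⟨f k ^ (n - m) • t, ?_⟩
        rw [map_smul, ← ht, smul_smul, ← pow_add, Nat.sub_add_cancel hmn])
      (fun i ↦ ext₂ i k (g i k))
    choose t ht using hn
    have hz (i j) : u i j k (f k ^ n • g i j - (l i j (t i) - r i j (t j))) = 0 := by
      rw [map_sub, map_sub, ← huv, ← huw, ← ht, ← ht, map_smul, map_smul, map_smul, hg]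
      module
    obtain ⟨m, hm⟩ := exists_common_pow (ι := ι × ι)
      (P := fun q m ↦ f k ^ m • (f k ^ n • g q.1 q.2 - (l q.1 q.2 (t q.1) - r q.1 q.2 (t q.2))) = 0)
      (by
        rintro q m n hmn h
        rw [← Nat.sub_add_cancel hmn, pow_add, mul_smul, h, smul_zero])
      (fun q ↦ inj₃ _ _ _ _ (hz q.1 q.2))
    refine ⟨m + n, fun i ↦ f k ^ m • t i, fun i j ↦ ?_⟩
    have := hm (i, j)
    rw [smul_sub, sub_eq_zero, smul_smul, ← pow_add] at this
    rw [this, smul_sub, map_smul, map_smul]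
  -- if `(I : b)` is prime, then `x`, `y` and `z` multiply `b • g` into the coboundaries, so that
  -- `exists_smul_coboundary` provides an element outside `(I : b)` that does the same
  have hI : I = ⊤ := by
    refine ideal_eq_top_of_colon I fun p b hp hpb ↦ ?_
    have hfp (i) : f i ∈ p := by
      obtain ⟨n, hn⟩ := hf i
      exact hp.mem_of_pow_mem n ((hpb _).2 (I.mul_mem_right _ hn))
    obtain ⟨x, hx, y, hy, z, hz, h1, h2, h3⟩ := hreg p hp hfp
    have mem (c) (hc : c ∈ p) :
        ∃ h : ∀ i, N₁ i, ∀ i j, c • (b • g i j) = l i j (h i) - r i j (h j) := by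
      obtain ⟨h, hh⟩ := (hpb c).1 hc
      exact ⟨h, fun i j ↦ by rw [← hh, mul_smul]⟩
    obtain ⟨s, hs, h, hh⟩ := exists_smul_coboundary f a l r hal inj hloc glue hloc₂ p
      (fun i j ↦ b • g i j) x y z h1 h2 h3 (mem x hx) (mem y hy) (mem z hz)
    exact hs ((hpb s).2 ⟨h, fun i j ↦ by rw [mul_smul, hh]⟩)
  obtain ⟨h, hh⟩ : (1 : R) ∈ I := hI ▸ Submodule.mem_top
  exact ⟨h, fun i j ↦ by rw [← hh, one_smul]⟩

omit [Finite ι] in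
/-- If `N` has depth at least one at all primes containing the ideal `(fᵢ)`, then an element of
`N` that vanishes in all localizations `N₁ i` of `N` away from `f i` is zero. -/
theorem eq_zero_of_localizations_of_regular [IsNoetherianRing R]
    (hloc : ∀ i, IsLocalizedModule.Away (f i) (a i))
    (hreg : ∀ p : Ideal R, p.IsPrime → (∀ i, f i ∈ p) → HasRegularPair p N)
    (n : N) (hn : ∀ i, a i n = 0) : n = 0 := by
  let I : Ideal R := LinearMap.ker (LinearMap.toSpanSingleton R N n)
  have memI (c) : c ∈ I ↔ c • n = 0 := by simp [I]
  have hI : I = ⊤ := by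
    refine ideal_eq_top_of_colon I fun p b hp hpb ↦ ?_
    have hfp (i) : f i ∈ p := by
      have := hloc i
      obtain ⟨⟨_, k, rfl⟩, hk⟩ := (IsLocalizedModule.eq_zero_iff (.powers (f i)) (a i)).1 (hn i)
      exact hp.mem_of_pow_mem k ((hpb _).2 (I.mul_mem_right _ ((memI _).2 hk)))
    obtain ⟨x, hx, y, hy, h1, h2⟩ := hreg p hp hfp
    obtain ⟨s, hs, h⟩ := h1 (b • n) (by rw [smul_smul, ← memI, ← hpb]; exact hx)
    exact hs ((hpb s).2 ((memI _).2 (by rw [mul_smul, h])))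
  rw [← one_smul R n, ← memI, hI]
  trivial

/-- If `N` has depth at least two at all primes containing the ideal `(fᵢ)`, then compatible
elements of the localizations `N₁ i` of `N` away from `f i` glue to an element of `N`. -/
theorem exists_glue_of_regular [IsNoetherianRing R]
    (hal : ∀ i j n, l i j (a i n) = r i j (a j n))
    (hloc : ∀ i, IsLocalizedModule.Away (f i) (a i))
    (inj₂ : ∀ i j (n : N₁ i), l i j n = 0 → ∃ m : ℕ, f j ^ m • n = 0)
    (hreg : ∀ p : Ideal R, p.IsPrime → (∀ i, f i ∈ p) → HasRegularPair p N)
    (h : ∀ i, N₁ i) (hh : ∀ i j, l i j (h i) = r i j (h j)) : ∃ n, ∀ i, a i n = h i := by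
  -- the ideal of all `c` such that `c • h` comes from `N`
  let I : Ideal R :=
    { carrier := {c | ∃ n, ∀ i, a i n = c • h i}
      zero_mem' := ⟨0, by simp⟩
      add_mem' := by
        rintro b c ⟨n, hn⟩ ⟨n', hn'⟩
        exact ⟨n + n', fun i ↦ by rw [map_add, hn, hn', add_smul]⟩
      smul_mem' := by
        rintro b c ⟨n, hn⟩
        exact ⟨b • n, fun i ↦ by rw [map_smul, hn, smul_eq_mul, mul_smul]⟩ }
  have hf (k) : ∃ n, f k ^ n ∈ I := by
    have := hloc k
    obtain ⟨⟨t, ⟨_, n, rfl⟩⟩, ht⟩ := IsLocalizedModule.surj (.powers (f k)) (a k) (h k)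
    rw [Submonoid.smul_def] at ht
    obtain ⟨m, hm⟩ := exists_common_pow
      (P := fun i m ↦ f k ^ m • (f k ^ n • h i - a i t) = 0)
      (by
        rintro q m n hmn h
        rw [← Nat.sub_add_cancel hmn, pow_add, mul_smul, h, smul_zero])
      (fun i ↦ inj₂ i k _ (by
        rw [map_sub, map_smul, hh, hal, sub_eq_zero, ← map_smul]; exact congr(r i k $ht)))
    refine ⟨m + n, f k ^ m • t, fun i ↦ ?_⟩
    have := hm i
    rw [smul_sub, sub_eq_zero, smul_smul, ← pow_add] at this
    rw [this, map_smul]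
  have hI : I = ⊤ := by
    refine ideal_eq_top_of_colon I fun p b hp hpb ↦ ?_
    have hfp (i) : f i ∈ p := by
      obtain ⟨n, hn⟩ := hf i
      exact hp.mem_of_pow_mem n ((hpb _).2 (I.mul_mem_right _ hn))
    obtain ⟨x, hx, y, hy, h1, h2⟩ := hreg p hp hfp
    obtain ⟨n, hn⟩ := (hpb x).1 hx
    obtain ⟨n', hn'⟩ := (hpb y).1 hy
    -- if `n` and `n'` represent `x • b • h` and `y • b • h`, then `y • n = x • n'`; the regularity
    -- of `y` on `N / x N` gives `s • n = x • α`, so that `α` represents `s • b • h`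
    have e : y • n = x • n' := by
      rw [← sub_eq_zero]
      refine eq_zero_of_localizations_of_regular f a hloc hreg _ fun i ↦ ?_
      rw [map_sub, map_smul, map_smul, hn, hn']
      module
    obtain ⟨s, hs, α, hα⟩ := h2 _ _ e
    have e2 (i) : ∃ s' ∉ p, s' • ((s * b) • h i - a i α) = 0 := by
      refine smul_eq_zero_of_localization f a hloc h1 i _ ?_
      rw [smul_sub, ← map_smul, ← hα, map_smul, hn]
      module
    obtain ⟨s', hs', e3⟩ := exists_common_notMem p
      (P := fun i s' ↦ s' • ((s * b) • h i - a i α) = 0)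
      (by
        rintro i s t h
        rw [mul_smul, h, smul_zero]) e2
    have hss : s' * s ∈ p := (hpb _).2 ⟨s' • α, fun i ↦ by
      have := e3 i
      rw [smul_sub, sub_eq_zero] at this
      rw [map_smul, ← this, smul_smul, mul_assoc]⟩
    exact (hp.mem_or_mem hss).elim hs' hs
  obtain ⟨n, hn⟩ : (1 : R) ∈ I := hI ▸ Submodule.mem_top
  exact ⟨n, fun i ↦ by rw [hn, one_smul]⟩

end Cech

lemma isAssociatedPrime_of_forall_mem_iff {R M : Type*} [CommRing R] [AddCommGroup M] [Module R M]
    [IsNoetherianRing R] {p : Ideal R} (hp : p.IsPrime) (m : M) (h : ∀ c, c ∈ p ↔ c • m = 0) :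
    p ∈ associatedPrimes R M := by
  rw [AssociatedPrimes.mem_iff, isAssociatedPrime_iff]
  refine ⟨hp, m, ?_⟩
  ext c
  rw [h, Submodule.mem_colon_singleton, Submodule.mem_bot]

/-- Let `U` be the complement of the closed set `V(fᵢ)`. A module `N` without sections supported on
`V(fᵢ)`, whose restriction to `U` is coherent and whose localizations at the points of `V(fᵢ)` are
finite, is finite: if `N'` is a finite submodule with the same restriction to `U`, then the
`(fᵢ)`-torsion of `N / N'` is finite, so `N / N'` has finitely many associated primes, and a power
of the ideal `(fᵢ)` kills `N / N'` because it does so at the associated primes. -/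
theorem finite_of_finite_at_primes {R : Type*} [CommRing R] [IsNoetherianRing R]
    {ι : Type*} [Finite ι] (f : ι → R) {N : Type*} [AddCommGroup N] [Module R N]
    (inj : ∀ n : N, (∀ i, ∃ k : ℕ, f i ^ k • n = 0) → n = 0)
    (hU : ∃ N' : Submodule R N, N'.FG ∧ ∀ i n, ∃ k : ℕ, f i ^ k • n ∈ N')
    (hp : ∀ p : Ideal R, p.IsPrime → (∀ i, f i ∈ p) →
      ∃ N' : Submodule R N, N'.FG ∧ ∀ n, ∃ s ∉ p, s • n ∈ N') :
    Module.Finite R N := by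
  obtain ⟨N', hN', hN'U⟩ := hU
  have : Module.Finite R N' := Module.Finite.iff_fg.2 hN'
  -- a submodule that a power of `(fᵢ)` maps into `N'` is finite
  have key (m : ℕ) (C : Submodule R N) (hC : ∀ c ∈ C, ∀ i, f i ^ m • c ∈ N') :
      Module.Finite R C := by
    let φ : C →ₗ[R] ι → N' := LinearMap.pi fun i ↦
      LinearMap.codRestrict N' ((LinearMap.lsmul R N (f i ^ m)).comp C.subtype)
        (fun c ↦ hC c c.2 i)
    refine Module.Finite.of_injective φ ?_
    rw [← LinearMap.ker_eq_bot, LinearMap.ker_eq_bot']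
    intro c hc
    refine Subtype.ext (inj _ fun i ↦ ⟨m, ?_⟩)
    exact congr(($hc i : N))
  -- `C` is the preimage of the `(fᵢ)`-torsion `C'` of `N / N'`
  let K := N ⧸ N'
  let C : Submodule R N :=
    { carrier := {c | ∀ i, f i ^ 1 • c ∈ N'}
      zero_mem' := by simp
      add_mem' := fun h h' i ↦ by rw [smul_add]; exact N'.add_mem (h i) (h' i)
      smul_mem' := fun c x h i ↦ by rw [smul_comm]; exact N'.smul_mem _ (h i) }
  let C' : Submodule R K := C.map N'.mkQ
  have : Module.Finite R C := key 1 C fun c hc ↦ hc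
  have : Module.Finite R C' := Module.Finite.map C N'.mkQ
  have hfin := associatedPrimes.finite R C'
  have hfp (p : associatedPrimes R C') (i) : f i ∈ p.1 := by
    obtain ⟨p, hp⟩ := p
    rw [AssociatedPrimes.mem_iff, isAssociatedPrime_iff] at hp
    obtain ⟨hp, ⟨_, x, hx, rfl⟩, hx'⟩ := hp
    change f i ∈ p
    rw [hx', Submodule.mem_colon_singleton, Submodule.mem_bot]
    refine Subtype.ext ?_
    simpa using! (Submodule.Quotient.mk_eq_zero _).2 (hx i)
  -- at an associated prime `N` is finitely generated, so that a power of the `fᵢ` suffices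
  have hkill (p : associatedPrimes R C') : ∃ m : ℕ, ∀ i n, ∃ s ∉ p.1, f i ^ m • s • n ∈ N' := by
    obtain ⟨N'', ⟨T, rfl⟩, hN''⟩ := hp p.1 p.2.isPrime (hfp p)
    obtain ⟨m, hm⟩ := exists_common_pow (ι := ι × T) (P := fun q m ↦ f q.1 ^ m • (q.2 : N) ∈ N')
      (by
        rintro q m n hmn h
        rw [← Nat.sub_add_cancel hmn, pow_add, mul_smul]
        exact N'.smul_mem _ h) (fun q ↦ hN'U q.1 q.2)
    refine ⟨m, fun i n ↦ ?_⟩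
    obtain ⟨s, hs, h⟩ := hN'' n
    refine ⟨s, hs, ?_⟩
    have hle : Submodule.span R (T : Set N) ≤
        N'.comap (LinearMap.lsmul R N (f i ^ m)) :=
      Submodule.span_le.2 fun t ht ↦ hm (i, ⟨t, ht⟩)
    exact hle h
  have := hfin.to_subtype
  obtain ⟨m, hm⟩ := exists_common_pow
    (P := fun (p : associatedPrimes R C') m ↦ ∀ i n, ∃ s ∉ p.1, f i ^ m • s • n ∈ N')
    (by
      intro p m n hmn h i x
      obtain ⟨s, hs, h⟩ := h i x
      refine ⟨s, hs, ?_⟩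
      rw [← Nat.sub_add_cancel hmn, pow_add, mul_smul]
      exact N'.smul_mem _ h) hkill
  -- if `(J : b)` is prime, it is the annihilator of the class of `b • f i ^ m • n`; this class lies
  -- in `C'`, so that `(J : b)` is one of the associated primes at which `f i ^ m` suffices
  have hall (i) (n : N) : f i ^ m • n ∈ N' := by
    let J : Ideal R := N'.comap (LinearMap.toSpanSingleton R N (f i ^ m • n))
    have memJ (c) : c ∈ J ↔ c • f i ^ m • n ∈ N' := by simp [J]
    suffices J = ⊤ by
      rw [← one_smul R (f i ^ m • n), ← memJ, this]
      trivial
    refine ideal_eq_top_of_colon J fun p b hp hpb ↦ ?_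
    have hx : b • f i ^ m • n ∈ C := fun j ↦ by
      obtain ⟨k, hk⟩ := hN'U j (f i ^ m • n)
      have : f j ∈ p := hp.mem_of_pow_mem k ((hpb _).2 (J.mul_mem_right _ ((memJ _).2 hk)))
      rw [hpb, memJ, mul_smul] at this
      rwa [pow_one]
    have hpC : p ∈ associatedPrimes R C' := by
      refine isAssociatedPrime_of_forall_mem_iff hp
        ⟨N'.mkQ (b • f i ^ m • n), Submodule.mem_map_of_mem hx⟩ fun c ↦ ?_
      rw [hpb, memJ, mul_smul, Subtype.ext_iff]
      exact (Submodule.Quotient.mk_eq_zero _).symm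
    obtain ⟨s, hs, h⟩ := hm ⟨p, hpC⟩ i n
    refine hs ((hpb s).2 ?_)
    rw [memJ, mul_comm, mul_smul, smul_comm s]
    exact N'.smul_mem _ h
  have := key m ⊤ fun c _ i ↦ hall i c
  exact Module.Finite.equiv (Submodule.topEquiv : (⊤ : Submodule R N) ≃ₗ[R] N)

end CommutativeAlgebra

/-! ### Exactness of sections and higher direct images -/

section SheafExactness

open Opposite

variable {A : Type} [CommRing A] {Y : TopCat.{0}}

/-- The restriction of a section of a sheaf of `A`-modules. -/
abbrev resA (G : TopCat.Sheaf (ModuleCat.{0} A) Y) {V W : Opens Y} (h : W ≤ V) :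
    G.obj.obj (op V) →ₗ[A] G.obj.obj (op W) := (G.obj.map (homOfLE h).op).hom

/-- The map on sections over `V` of a morphism of sheaves of `A`-modules. -/
abbrev appA {G H : TopCat.Sheaf (ModuleCat.{0} A) Y} (φ : G ⟶ H) (V : Opens Y) :
    G.obj.obj (op V) →ₗ[A] H.obj.obj (op V) := (φ.hom.app (op V)).hom

variable {G H I Q : TopCat.Sheaf (ModuleCat.{0} A) Y}

lemma resA_resA {V W W' : Opens Y} (h : W ≤ V) (h' : W' ≤ W) (s : G.obj.obj (op V)) :
    resA G h' (resA G h s) = resA G (h'.trans h) s := by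
  change (G.obj.map (homOfLE h).op ≫ G.obj.map (homOfLE h').op).hom s = _
  rw [← Functor.map_comp]
  rfl

lemma resA_self {V : Opens Y} (s : G.obj.obj (op V)) : resA G le_rfl s = s := by
  change (G.obj.map (𝟙 _)).hom s = _
  rw [G.obj.map_id]
  rfl

lemma appA_resA (φ : G ⟶ H) {V W : Opens Y} (h : W ≤ V) (s : G.obj.obj (op V)) :
    appA φ W (resA G h s) = resA H h (appA φ V s) :=
  congr(($(φ.hom.naturality (homOfLE h).op)).hom s)

lemma appA_comp (φ : G ⟶ H) (ψ : H ⟶ I) {V : Opens Y} (s : G.obj.obj (op V)) :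
    appA (φ ≫ ψ) V s = appA ψ V (appA φ V s) := rfl

lemma eq_of_locally_eqA {V : Opens Y} (s t : G.obj.obj (op V))
    (h : ∀ x ∈ V, ∃ W : Opens Y, ∃ hW : W ≤ V, x ∈ W ∧ resA G hW s = resA G hW t) : s = t := by
  choose! W hW hx h using h
  refine TopCat.Sheaf.eq_of_locally_eq' G (fun x : V ↦ W x) V (fun x ↦ homOfLE (hW x x.2))
    (fun x hx' ↦ Opens.mem_iSup.2 ⟨⟨x, hx'⟩, hx x hx'⟩) s t fun x ↦ h x x.2

lemma exists_glueA {ι : Type*} {V : Opens Y} (W : ι → Opens Y) (hW : ∀ i, W i ≤ V)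
    (hV : V ≤ iSup W) (s : ∀ i, G.obj.obj (op (W i)))
    (hs : ∀ i j, resA G (inf_le_left : W i ⊓ W j ≤ W i) (s i) =
      resA G (inf_le_right : W i ⊓ W j ≤ W j) (s j)) :
    ∃ t : G.obj.obj (op V), ∀ i, resA G (hW i) t = s i := by
  obtain ⟨t, ht, -⟩ := TopCat.Sheaf.existsUnique_gluing' G W V (fun i ↦ homOfLE (hW i)) hV s hs
  exact ⟨t, ht⟩

lemma exists_locally_lift (φ : G ⟶ H) [Epi φ] {V : Opens Y} (s : H.obj.obj (op V)) (x : Y)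
    (hx : x ∈ V) : ∃ W : Opens Y, ∃ hW : W ≤ V, x ∈ W ∧ ∃ t, appA φ W t = resA H hW s := by
  have := (TopCat.Sheaf.isLocallySurjective_iff_epi φ).2 inferInstance
  rw [TopCat.Presheaf.isLocallySurjective_iff] at this
  obtain ⟨W, hW, ⟨t, ht⟩, hxW⟩ := this V s x hx
  exact ⟨W, hW, hxW, t, ht⟩

lemma epi_of_locally_lift (φ : G ⟶ H) (h : ∀ (V : Opens Y) (s : H.obj.obj (op V)), ∀ x ∈ V,
    ∃ W : Opens Y, ∃ hW : W ≤ V, x ∈ W ∧ ∃ t, appA φ W t = resA H hW s) : Epi φ := by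
  rw [← TopCat.Sheaf.isLocallySurjective_iff_epi, TopCat.Presheaf.isLocallySurjective_iff]
  intro V s x hx
  obtain ⟨W, hW, hxW, t, ht⟩ := h V s x hx
  exact ⟨W, hW, ⟨t, ht⟩, hxW⟩

lemma appA_injective (φ : G ⟶ H) [Mono φ] (V : Opens Y) : Function.Injective (appA φ V) := by
  have : Mono φ.hom := inferInstanceAs (Mono ((TopCat.Sheaf.forget _ _).map φ))
  have : Mono (φ.hom.app (op V)) := inferInstance
  exact (ModuleCat.mono_iff_injective _).1 this

lemma mono_of_appA_injective (φ : G ⟶ H) (h : ∀ V, Function.Injective (appA φ V)) : Mono φ := by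
  have : ∀ V, Mono (φ.hom.app V) := fun V ↦ (ModuleCat.mono_iff_injective _).2 (h V.unop)
  have : Mono φ.hom := NatTrans.mono_of_mono_app _
  exact (TopCat.Sheaf.forget _ _).mono_of_mono_map this

lemma exists_lift_of_exact {a : G ⟶ I} {b : I ⟶ Q} (w : a ≫ b = 0)
    (h : (ShortComplex.mk a b w).Exact) [Mono a] {V : Opens Y} (s : I.obj.obj (op V))
    (hs : appA b V s = 0) : ∃ t, appA a V t = s := by
  let E := (evaluation (Opens Y)ᵒᵖ (ModuleCat.{0} A)).obj (op V)
  let F : TopCat.Sheaf (ModuleCat.{0} A) Y ⥤ ModuleCat.{0} A := TopCat.Sheaf.forget _ _ ⋙ E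
  have : Limits.PreservesFiniteLimits (TopCat.Sheaf.forget (ModuleCat.{0} A) Y) := inferInstance
  have : Limits.PreservesFiniteLimits E := inferInstance
  have : Limits.PreservesFiniteLimits F := Limits.comp_preservesFiniteLimits _ _
  have : F.Additive := { map_add := rfl }
  have h' : ((ShortComplex.mk a b w).map F).Exact :=
    h.map_of_mono_of_preservesKernel F ‹_› inferInstance
  rw [ShortComplex.moduleCat_exact_iff] at h'
  exact h' s hs

lemma exact_of_locally_lift {a : G ⟶ I} {b : I ⟶ Q} (w : a ≫ b = 0)
    (h : ∀ (V : Opens Y) (s : I.obj.obj (op V)), appA b V s = 0 → ∀ x ∈ V,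
      ∃ W : Opens Y, ∃ hW : W ≤ V, x ∈ W ∧ ∃ t, appA a W t = resA I hW s) :
    (ShortComplex.mk a b w).Exact := by
  rw [ShortComplex.exact_iff_epi_kernel_lift]
  refine epi_of_locally_lift _ fun V s x hx ↦ ?_
  obtain ⟨W, hW, hxW, t, ht⟩ := h V (appA (Limits.kernel.ι b) V s) (by
    rw [← appA_comp, Limits.kernel.condition]; rfl) x hx
  refine ⟨W, hW, hxW, t, appA_injective (Limits.kernel.ι b) W ?_⟩
  rw [← appA_comp, Limits.kernel.lift_ι, appA_resA]
  exact ht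

/-- The vanishing of the first cohomology group `H¹(W, G)`: for all short exact sequences
`0 ⟶ G ⟶ I ⟶ Q ⟶ 0` of sheaves, the map `I(W) ⟶ Q(W)` is surjective. -/
def H1Vanishes (W : Opens Y) (G : TopCat.Sheaf (ModuleCat.{0} A) Y) : Prop :=
  ∀ (I Q : TopCat.Sheaf (ModuleCat.{0} A) Y) (a : G ⟶ I) (b : I ⟶ Q) (w : a ≫ b = 0),
    (ShortComplex.mk a b w).ShortExact → Function.Surjective (appA b W)

lemma H1Vanishes.of_iso {W : Opens Y} (e : G ≅ H) (h : H1Vanishes W G) : H1Vanishes W H := by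
  intro I Q a b w hS
  refine h I Q (e.hom ≫ a) b (by simp [w]) ?_
  exact ShortComplex.shortExact_of_iso (ShortComplex.isoMk (S₁ := ShortComplex.mk a b w)
    (S₂ := ShortComplex.mk (e.hom ≫ a) b (by simp [w])) e.symm (Iso.refl _) (Iso.refl _)
    (by simp) (by simp)) hS

lemma H1Vanishes.of_isZero {W : Opens Y} (h : Limits.IsZero G) : H1Vanishes W G := by
  intro I Q a b w hS
  have : Mono b := hS.exact.mono_g (h.eq_of_src _ _)
  have := hS.epi_g
  have : IsIso b := isIso_of_mono_of_epi b
  intro s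
  refine ⟨appA (inv b) W s, ?_⟩
  rw [← appA_comp, IsIso.inv_hom_id]
  rfl

/-- Vanishing of `H¹` in an extension: for `0 ⟶ G ⟶ H ⟶ K ⟶ 0` and `H ⊆ I`, a section of `I / H`
lifts to `I / G` by the vanishing for `K = H / G`, and then to `I` by the vanishing for `G`. -/
lemma H1Vanishes.of_shortExact {W : Opens Y} {S : ShortComplex (TopCat.Sheaf (ModuleCat.{0} A) Y)}
    (hS : S.ShortExact) (h₁ : H1Vanishes W S.X₁) (h₃ : H1Vanishes W S.X₃) :
    H1Vanishes W S.X₂ := by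
  intro I Q a b w hT
  have := hS.mono_f
  have := hS.epi_g
  have : Mono a := hT.mono_f
  have : Epi b := hT.epi_g
  let c : S.X₁ ⟶ I := S.f ≫ a
  have : Mono c := mono_comp _ _
  let π := Limits.cokernel.π c
  let a' : S.X₃ ⟶ Limits.cokernel c :=
    hS.exact.desc (a ≫ π) (by rw [← Category.assoc]; exact Limits.cokernel.condition c)
  have ha' : S.g ≫ a' = a ≫ π := hS.exact.g_desc _ _
  let b' : Limits.cokernel c ⟶ Q := Limits.cokernel.desc c b (by simp [c, w])
  have hb' : π ≫ b' = b := Limits.cokernel.π_desc _ _ _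
  have hU : (ShortComplex.mk c π (Limits.cokernel.condition c)).ShortExact :=
    { exact := ShortComplex.exact_cokernel c, mono_f := ‹_›, epi_g := inferInstance }
  have w' : a' ≫ b' = 0 := by
    rw [← cancel_epi S.g, ← Category.assoc, ha', Category.assoc, hb', w, Limits.comp_zero]
  -- exactness of `0 ⟶ K ⟶ I / G ⟶ Q ⟶ 0`
  have hV : (ShortComplex.mk a' b' w').ShortExact := by
    refine ShortComplex.ShortExact.mk' (exact_of_locally_lift w' ?_) ?_ ?_
    · intro V s hs x hx
      obtain ⟨V', hV', hxV', t, ht⟩ := exists_locally_lift π s x hx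
      obtain ⟨u, hu⟩ := exists_lift_of_exact w hT.exact t (by
        rw [← hb', appA_comp, ht, appA_resA, hs, map_zero])
      refine ⟨V', hV', hxV', appA S.g V' u, ?_⟩
      rw [← appA_comp, ha', appA_comp, hu, ht]
    · refine mono_of_appA_injective _ fun V ↦ ?_
      rw [← LinearMap.ker_eq_bot, LinearMap.ker_eq_bot']
      intro s hs
      refine eq_of_locally_eqA _ _ fun x hx ↦ ?_
      obtain ⟨V', hV', hxV', t, ht⟩ := exists_locally_lift S.g s x hx
      obtain ⟨u, hu⟩ := exists_lift_of_exact _ hU.exact (appA a V' t) (by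
        rw [← appA_comp, ← ha', appA_comp, ht, appA_resA, hs, map_zero])
      have : appA S.f V' u = t := appA_injective a V' hu
      refine ⟨V', hV', hxV', ?_⟩
      rw [← ht, ← this, ← appA_comp, S.zero, map_zero]
      rfl
    · have : Epi (π ≫ b') := hb' ▸ inferInstance
      exact epi_of_epi π b'
  intro s
  obtain ⟨t, ht⟩ := h₃ _ _ a' b' w' hV s
  obtain ⟨u, hu⟩ := h₁ _ _ c π _ hU t
  exact ⟨u, by rw [← hb', appA_comp, hu, ht]⟩

/-- If `H¹(j⁻¹ V, G) = 0` for all `V` in a basis, then `j_*` preserves the exactness of the start of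
a resolution `0 ⟶ G ⟶ I ⟶ Q ⟶ R`. -/
lemma exact_pushforward_of_H1Vanishes {Z : TopCat.{0}} (j : Y ⟶ Z)
    {B : Set (Opens Z)} (hB : Opens.IsBasis B)
    (h : ∀ V ∈ B, H1Vanishes ((Opens.map j).obj V) G)
    {R : TopCat.Sheaf (ModuleCat.{0} A) Y} (ε : G ⟶ I) (d₀ : I ⟶ Q) (d₁ : Q ⟶ R) [Mono ε]
    (wε : ε ≫ d₀ = 0) (w₀ : d₀ ≫ d₁ = 0) (hε : (ShortComplex.mk ε d₀ wε).Exact)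
    (hd : (ShortComplex.mk d₀ d₁ w₀).Exact) :
    ((ShortComplex.mk d₀ d₁ w₀).map (TopCat.Sheaf.pushforward (ModuleCat.{0} A) j)).Exact := by
  refine exact_of_locally_lift _ fun V s hs x hx ↦ ?_
  obtain ⟨V', hV'B, hxV', hV'⟩ := Opens.isBasis_iff_nbhd.1 hB hx
  refine ⟨V', hV', hxV', ?_⟩
  -- the vanishing of `H¹` applies to `0 ⟶ G ⟶ I ⟶ ker d₁ ⟶ 0`
  let e : I ⟶ Limits.kernel d₁ := Limits.kernel.lift d₁ d₀ w₀
  have he : Epi e := (ShortComplex.exact_iff_epi_kernel_lift _).1 hd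
  have wε' : ε ≫ e = 0 := by
    rw [← cancel_mono (Limits.kernel.ι d₁)]
    simp [e, wε]
  have hS : (ShortComplex.mk ε e wε').ShortExact := by
    refine ShortComplex.ShortExact.mk' (exact_of_locally_lift _ fun W t ht y hy ↦ ?_) ‹_› he
    obtain ⟨u, hu⟩ := exists_lift_of_exact wε hε t (by
      rw [← Limits.kernel.lift_ι d₁ d₀ w₀, appA_comp, ht, map_zero])
    exact ⟨W, le_rfl, hy, u, by rw [hu, resA_self]⟩
  obtain ⟨t, ht⟩ := exists_lift_of_exact (Limits.kernel.condition d₁)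
    (ShortComplex.exact_kernel d₁) (V := (Opens.map j).obj V) s hs
  obtain ⟨u, hu⟩ := h V' hV'B _ _ ε e wε' hS
    (resA _ ((Opens.map j).monotone hV') t)
  refine ⟨u, ?_⟩
  change appA d₀ ((Opens.map j).obj V') u = resA Q ((Opens.map j).monotone hV') s
  rw [← Limits.kernel.lift_ι d₁ d₀ w₀, appA_comp, hu, appA_resA, ht]

/-- The first higher direct image of `G` vanishes if `H¹` vanishes on the preimages of a basis. -/
lemma isZero_higherDirectImage {Z : TopCat.{0}} (j : Y ⟶ Z)
    (G : TopCat.Sheaf (ModuleCat.{0} A) Y) {B : Set (Opens Z)} (hB : Opens.IsBasis B)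
    (h : ∀ V ∈ B, H1Vanishes ((Opens.map j).obj V) G) :
    Limits.IsZero (higherDirectImage j 1 G) := by
  let P := injectiveResolution G
  refine Limits.IsZero.of_iso ?_
    (P.isoRightDerivedObj (TopCat.Sheaf.pushforward (ModuleCat.{0} A) j) 1)
  change Limits.IsZero (HomologicalComplex.homology _ 1)
  rw [← HomologicalComplex.exactAt_iff_isZero_homology,
    HomologicalComplex.exactAt_iff' _ 0 1 2 (by simp) (by simp)]
  have : Mono (P.ι.f 0) := inferInstance
  exact @exact_pushforward_of_H1Vanishes A _ Y G _ _ Z j B hB h _ (P.ι.f 0) (P.cocomplex.d 0 1)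
    (P.cocomplex.d 1 2) this P.ι_f_zero_comp_complex_d (P.cocomplex.d_comp_d 0 1 2) P.exact₀
    (P.exact_succ 0)

end SheafExactness

/-! ### Tensor products of sheaves of modules -/

section TensorSheaf

open Opposite TensorProduct

variable {A : Type} [CommRing A] {Y : TopCat.{0}}

/-- The map `G(V) ⊗ M ⟶ (G ⊗ M)(V)` to the sheafification. -/
def toTensor (G : TopCat.Sheaf (ModuleCat.{0} A) Y) (M : Type) [AddCommGroup M] [Module A M]
    (V : Opens Y) : G.obj.obj (op V) ⊗[A] M →ₗ[A] (tensor G (ModuleCat.of A M)).obj.obj (op V) :=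
  ((toSheafify (Opens.grothendieckTopology Y)
    (G.obj ⋙ MonoidalCategory.tensorRight (ModuleCat.of A M))).app (op V)).hom

/-- The morphism `G ⊗ M ⟶ G ⊗ M'` induced by a linear map `M → M'`. -/
def tensorMap (G : TopCat.Sheaf (ModuleCat.{0} A) Y) {M M' : Type} [AddCommGroup M] [Module A M]
    [AddCommGroup M'] [Module A M'] (f : M →ₗ[A] M') :
    tensor G (ModuleCat.of A M) ⟶ tensor G (ModuleCat.of A M') :=
  (presheafToSheaf (Opens.grothendieckTopology Y) (ModuleCat.{0} A)).map
    (Functor.whiskerLeft G.obj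
      ((MonoidalCategory.tensoringRight (ModuleCat.{0} A)).map (ModuleCat.ofHom f)))

variable (G : TopCat.Sheaf (ModuleCat.{0} A) Y)
  {M M' M'' : Type} [AddCommGroup M] [Module A M] [AddCommGroup M'] [Module A M']
  [AddCommGroup M''] [Module A M'']

lemma tensorMap_toTensor (f : M →ₗ[A] M') (V : Opens Y) (t : G.obj.obj (op V) ⊗[A] M) :
    appA (tensorMap G f) V (toTensor G M V t) =
      toTensor G M' V (f.lTensor (G.obj.obj (op V)) t) := by
  have := toSheafify_naturality (Opens.grothendieckTopology Y) (Functor.whiskerLeft G.obj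
      ((MonoidalCategory.tensoringRight (ModuleCat.{0} A)).map (ModuleCat.ofHom f)))
  exact congr(((($this).app (op V)).hom t)).symm

lemma resA_toTensor {V W : Opens Y} (h : W ≤ V) (t : G.obj.obj (op V) ⊗[A] M) :
    resA (tensor G (ModuleCat.of A M)) h (toTensor G M V t) =
      toTensor G M W ((resA G h).rTensor M t) := by
  have := (toSheafify (Opens.grothendieckTopology Y)
    (G.obj ⋙ MonoidalCategory.tensorRight (ModuleCat.of A M))).naturality (homOfLE h).op
  exact congr(($this).hom t).symm

lemma tensorMap_comp (f : M →ₗ[A] M') (g : M' →ₗ[A] M'') :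
    tensorMap G f ≫ tensorMap G g = tensorMap G (g ∘ₗ f) := by
  refine ((presheafToSheaf (Opens.grothendieckTopology Y) (ModuleCat.{0} A)).map_comp
    _ _).symm.trans (congrArg _ ?_)
  exact (Functor.whiskerLeft_comp _ _ _).symm.trans (congrArg _
    (((MonoidalCategory.tensoringRight (ModuleCat.{0} A)).map_comp _ _).symm))

lemma exists_locally_toTensor {V : Opens Y} (s : (tensor G (ModuleCat.of A M)).obj.obj (op V))
    (x : Y) (hx : x ∈ V) : ∃ W : Opens Y, ∃ hW : W ≤ V, x ∈ W ∧
      ∃ t, toTensor G M W t = resA _ hW s := by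
  have : TopCat.Presheaf.IsLocallySurjective (toSheafify (Opens.grothendieckTopology Y)
    (G.obj ⋙ MonoidalCategory.tensorRight (ModuleCat.of A M))) := by
      dsimp [TopCat.Presheaf.IsLocallySurjective]
      infer_instance
  rw [TopCat.Presheaf.isLocallySurjective_iff] at this
  obtain ⟨W, hW, ⟨t, ht⟩, hxW⟩ := this V s x hx
  exact ⟨W, hW, hxW, t, ht⟩

lemma locally_eq_zero_of_toTensor {V : Opens Y} (t : G.obj.obj (op V) ⊗[A] M)
    (ht : toTensor G M V t = 0) (x : Y) (hx : x ∈ V) :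
    ∃ W : Opens Y, ∃ hW : W ≤ V, x ∈ W ∧ (resA G hW).rTensor M t = 0 := by
  have := Presheaf.equalizerSieve_mem (Opens.grothendieckTopology Y)
    (toSheafify (Opens.grothendieckTopology Y)
    (G.obj ⋙ MonoidalCategory.tensorRight (ModuleCat.of A M))) (X := op V) t 0
    (by exact ht.trans (map_zero (toTensor G M V)).symm)
  obtain ⟨W, i, hi, hxW⟩ := this x hx
  refine ⟨W, leOfHom i, hxW, ?_⟩
  rw [Presheaf.equalizerSieve_apply] at hi
  exact hi.trans (map_zero ((resA G (leOfHom i)).rTensor M))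

/-- No sheafification is needed for `G ⊗ A = G`. -/
lemma toTensor_self_bijective (V : Opens Y) : Function.Bijective (toTensor G A V) := by
  let P := G.obj ⋙ MonoidalCategory.tensorRight (ModuleCat.of A A)
  let e : P ≅ G.obj := NatIso.ofComponents (fun V ↦ MonoidalCategory.rightUnitor _)
    (fun f ↦ MonoidalCategory.rightUnitor_naturality _)
  have hP : Presheaf.IsSheaf (Opens.grothendieckTopology Y) P :=
    Presheaf.isSheaf_of_iso_iff e |>.2 G.property
  have := isIso_toSheafify _ hP
  have : IsIso ((toSheafify (Opens.grothendieckTopology Y) P).app (op V)) := inferInstance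
  exact ConcreteCategory.bijective_of_isIso _

/-- A basis of open sets `D` such that `G(D)` is flat over `A` and, for all finite `A`-modules `M`,
no sheafification is needed for the sections of `G ⊗ M` over `D`. -/
structure IsTensorBasis (B : Set (Opens Y)) : Prop where
  isBasis : Opens.IsBasis B
  bijective (D : Opens Y) (hD : D ∈ B) (M : Type) [AddCommGroup M] [Module A M]
    [Module.Finite A M] : Function.Bijective (toTensor G M D)
  flat (D : Opens Y) (hD : D ∈ B) : Module.Flat A (G.obj.obj (op D))

variable {G} {B : Set (Opens Y)} (hB : IsTensorBasis G B)
include hB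

variable [Module.Finite A M] [Module.Finite A M'] [Module.Finite A M'']

/-- Tensoring with a flat sheaf is exact: on the members of the basis, sections of `G ⊗ M` are `G(D)
⊗ M`, with `G(D)` flat. -/
lemma IsTensorBasis.shortExact {f : M →ₗ[A] M'} {g : M' →ₗ[A] M''} (hf : Function.Injective f)
    (hfg : Function.Exact f g) (hg : Function.Surjective g) :
    ∃ w : tensorMap G f ≫ tensorMap G g = 0,
      (ShortComplex.mk (tensorMap G f) (tensorMap G g) w).ShortExact := by
  have nbhd {V : Opens Y} {x : Y} (hx : x ∈ V) : ∃ D ∈ B, x ∈ D ∧ D ≤ V := by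
    obtain ⟨D, hD, h, h'⟩ := Opens.isBasis_iff_nbhd.1 hB.isBasis hx
    exact ⟨D, hD, h, h'⟩
  have w : tensorMap G f ≫ tensorMap G g = 0 := by
    rw [tensorMap_comp, hfg.linearMap_comp_eq_zero]
    dsimp [tensorMap]
    have h0 : (Functor.whiskerLeft G.obj ((MonoidalCategory.tensoringRight (ModuleCat.{0} A)).map
        (ModuleCat.ofHom (0 : M →ₗ[A] M'')))) = 0 := by
      ext V t
      exact congr($(LinearMap.lTensor_zero (G.obj.obj V)) t)
    refine ObjectProperty.hom_ext _ ?_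
    refine (sheafify_hom_ext _ _ _ (tensor G (ModuleCat.of A M'')).property ?_)
    ext V t
    have := tensorMap_toTensor G (0 : M →ₗ[A] M'') V.unop t
    rw [LinearMap.lTensor_zero, LinearMap.zero_apply, map_zero] at this
    exact this
  refine ⟨w, ShortComplex.ShortExact.mk' (exact_of_locally_lift w fun V s hs x hx ↦ ?_) ?_ ?_⟩
  · obtain ⟨D, hD, hxD, hDV⟩ := nbhd hx
    obtain ⟨t, ht⟩ := (hB.bijective D hD M').2 (resA _ hDV s)
    have : g.lTensor (G.obj.obj (op D)) t = 0 := by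
      refine (hB.bijective D hD M'').1 ?_
      rw [← tensorMap_toTensor, ht, appA_resA, hs, map_zero, map_zero]
    obtain ⟨u, rfl⟩ := (lTensor_exact (G.obj.obj (op D)) hfg hg t).1 this
    exact ⟨D, hDV, hxD, toTensor G M D u, by rw [tensorMap_toTensor, ht]⟩
  · refine mono_of_appA_injective _ fun V ↦ ?_
    rw [← LinearMap.ker_eq_bot, LinearMap.ker_eq_bot']
    intro s hs
    refine eq_of_locally_eqA _ _ fun x hx ↦ ?_
    obtain ⟨D, hD, hxD, hDV⟩ := nbhd hx
    refine ⟨D, hDV, hxD, ?_⟩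
    obtain ⟨t, ht⟩ := (hB.bijective D hD M).2 (resA _ hDV s)
    have : Module.Flat A (G.obj.obj (op D)) := hB.flat D hD
    have : t = 0 := by
      refine Module.Flat.lTensor_preserves_injective_linearMap (M := G.obj.obj (op D)) f hf ?_
      refine (hB.bijective D hD M').1 ?_
      rw [← tensorMap_toTensor, ht, appA_resA, hs, map_zero, map_zero, map_zero]
    rw [← ht, this, map_zero, map_zero]
  · refine epi_of_locally_lift _ fun V s x hx ↦ ?_
    obtain ⟨D, hD, hxD, hDV⟩ := nbhd hx
    obtain ⟨t, ht⟩ := (hB.bijective D hD M'').2 (resA _ hDV s)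
    obtain ⟨u, rfl⟩ := LinearMap.lTensor_surjective (G.obj.obj (op D)) hg t
    exact ⟨D, hDV, hxD, toTensor G M' D u, by rw [tensorMap_toTensor, ht]⟩

variable [IsLocalRing A] [IsArtinianRing A] {W : Opens Y}
  (hW : H1Vanishes W (tensor G (ModuleCat.of A (A ⧸ IsLocalRing.maximalIdeal A))))
include hW

omit hB hW in
/-- Dévissage: over an Artinian local ring, a property of finite modules that is stable under
extensions holds for all of them if it holds for the residue field. -/
lemma induction_on_residueField {motive : ∀ (M : Type) [AddCommGroup M] [Module A M]
      [Module.Finite A M], Prop}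
    (h0 : ∀ (M : Type) [AddCommGroup M] [Module A M] [Module.Finite A M], Subsingleton M → motive M)
    (hk : ∀ (M : Type) [AddCommGroup M] [Module A M] [Module.Finite A M]
      (_ : M ≃ₗ[A] A ⧸ IsLocalRing.maximalIdeal A), motive M)
    (hex : ∀ (M M' M'' : Type) [AddCommGroup M] [Module A M] [Module.Finite A M]
      [AddCommGroup M'] [Module A M'] [Module.Finite A M']
      [AddCommGroup M''] [Module A M''] [Module.Finite A M'']
      (f : M →ₗ[A] M') (g : M' →ₗ[A] M''), Function.Injective f → Function.Surjective g →
      Function.Exact f g → motive M → motive M'' → motive M')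
    (M : Type) [AddCommGroup M] [Module A M] [Module.Finite A M] : motive M := by
  induction ‹Module.Finite A M› using
    IsNoetherianRing.induction_on_isQuotientEquivQuotientPrime A with
  | subsingleton N => exact h0 N inferInstance
  | quotient N p e =>
    have : p.asIdeal.IsMaximal := inferInstance
    have : p.asIdeal = IsLocalRing.maximalIdeal A := IsLocalRing.eq_maximalIdeal this
    exact hk N (e.trans (Submodule.quotEquivOfEq _ _ this))
  | exact N₁ N₂ N₃ f g hf hg hfg h₁ h₃ => exact hex N₁ N₂ N₃ f g hf hg hfg h₁ h₃

/-- If `H¹(W, G ⊗ A / 𝔪) = 0`, then `H¹(W, G ⊗ M) = 0` for all finite modules `M`, by dévissage. -/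
lemma IsTensorBasis.H1Vanishes_tensor : H1Vanishes W (tensor G (ModuleCat.of A M)) := by
  refine induction_on_residueField (A := A)
    (motive := fun M _ _ _ ↦ H1Vanishes W (tensor G (ModuleCat.of A M))) ?_ ?_ ?_ M
  · intro M _ _ _ hM
    refine H1Vanishes.of_isZero ?_
    rw [Limits.IsZero.iff_id_eq_zero]
    refine ObjectProperty.hom_ext _ ?_
    refine (sheafify_hom_ext _ _ _ (tensor G (ModuleCat.of A M)).property ?_)
    ext V t
    have : Subsingleton (G.obj.obj V ⊗[A] M) := TensorProduct.uniqueRight.instSubsingleton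
    have ht : t = 0 := Subsingleton.elim (α := G.obj.obj V ⊗[A] M) _ _
    rw [ht, map_zero, map_zero]
  · intro M _ _ _ e
    refine H1Vanishes.of_iso ((presheafToSheaf _ _).mapIso
      (Functor.isoWhiskerLeft G.obj ((MonoidalCategory.tensoringRight (ModuleCat.{0} A)).mapIso
        e.symm.toModuleIso))) hW
  · intro M M' M'' _ _ _ _ _ _ _ _ _ f g hf hg hfg h₁ h₃
    obtain ⟨w, hS⟩ := hB.shortExact hf hfg hg
    exact H1Vanishes.of_shortExact hS h₁ h₃

/-- By the vanishing of `H¹`, sections of `G ⊗ M` over `W` are generated by those of `G`: this holds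
for the quotient `A / 𝔪` of `A`, and passes to extensions. -/
lemma IsTensorBasis.toTensor_surjective : Function.Surjective (toTensor G M W) := by
  refine induction_on_residueField (A := A)
    (motive := fun M _ _ _ ↦ Function.Surjective (toTensor G M W)) ?_ ?_ ?_ M
  · intro M _ _ _ hM s
    refine ⟨0, ?_⟩
    rw [map_zero]
    refine (eq_of_locally_eqA _ _ fun x hx ↦ ?_)
    obtain ⟨D, hDW, hxD, t, ht⟩ := exists_locally_toTensor G s x hx
    have : Subsingleton (G.obj.obj (op D) ⊗[A] M) := TensorProduct.uniqueRight.instSubsingleton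
    refine ⟨D, hDW, hxD, ?_⟩
    rw [← ht, Subsingleton.elim t 0, map_zero, map_zero]
  · intro M _ _ _ e
    let g : A →ₗ[A] M := e.symm.toLinearMap ∘ₗ (IsLocalRing.maximalIdeal A).mkQ
    have hg : Function.Surjective g := e.symm.surjective.comp (Submodule.mkQ_surjective _)
    have hfg : Function.Exact (LinearMap.ker g).subtype g := LinearMap.exact_subtype_ker_map g
    obtain ⟨w, hS⟩ := hB.shortExact (Submodule.subtype_injective _) hfg hg
    intro s
    obtain ⟨t, ht⟩ := hB.H1Vanishes_tensor hW _ _ _ _ w hS s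
    obtain ⟨u, rfl⟩ := (toTensor_self_bijective G W).2 t
    exact ⟨_, (tensorMap_toTensor G g W u).symm.trans ht⟩
  · intro M M' M'' _ _ _ _ _ _ _ _ _ f g hf hg hfg h₁ h₃ s
    obtain ⟨w, hS⟩ := hB.shortExact hf hfg hg
    obtain ⟨t, ht⟩ := h₃ (appA (tensorMap G g) W s)
    obtain ⟨t, rfl⟩ := LinearMap.lTensor_surjective (G.obj.obj (op W)) hg t
    have := hS.mono_f
    obtain ⟨u, hu⟩ := exists_lift_of_exact w hS.exact (s - toTensor G M' W t) (by
      rw [map_sub, tensorMap_toTensor, ht, sub_self])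
    obtain ⟨v, rfl⟩ := h₁ u
    refine ⟨f.lTensor _ v + t, ?_⟩
    rw [map_add, ← tensorMap_toTensor, hu, sub_add_cancel]

/-- Over `W` the sections of `G ⊗ M` are `G(W) ⊗ M`. Both sides are right exact in `M`, by the
vanishing of `H¹`, and agree for `M = A`. -/
theorem IsTensorBasis.toTensor_bijective : Function.Bijective (toTensor G M W) := by
  refine ⟨?_, hB.toTensor_surjective hW⟩
  obtain ⟨n, g, hg⟩ := Module.Finite.exists_fin' A M
  have hfg : Function.Exact (LinearMap.ker g).subtype g := LinearMap.exact_subtype_ker_map g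
  obtain ⟨w, hS⟩ := hB.shortExact (Submodule.subtype_injective _) hfg hg
  -- for a free module the components of a tensor are elements of `G(W) ⊗ A = (G ⊗ A)(W)`
  have hfree : Function.Injective (toTensor G (Fin n → A) W) := by
    rw [← LinearMap.ker_eq_bot, LinearMap.ker_eq_bot']
    intro t ht
    refine (TensorProduct.piRight A A (G.obj.obj (op W)) (fun _ : Fin n ↦ A)).injective ?_
    rw [map_zero]
    ext i
    have h1 : (LinearMap.proj i : (Fin n → A) →ₗ[A] A).lTensor (G.obj.obj (op W)) t = 0 := by
      refine (toTensor_self_bijective G W).1 ?_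
      rw [← tensorMap_toTensor, ht, map_zero, map_zero]
    rw [Pi.zero_apply, ← h1]
    clear ht h1
    induction t with
    | zero => simp
    | add x y hx hy => simp only [map_add, Pi.add_apply, hx, hy]
    | tmul x y => simp
  rw [← LinearMap.ker_eq_bot, LinearMap.ker_eq_bot']
  intro t ht
  obtain ⟨t, rfl⟩ := LinearMap.lTensor_surjective (G.obj.obj (op W)) hg t
  -- a diagram chase in the map of right exact sequences given by `0 ⟶ ker g ⟶ Aⁿ ⟶ M ⟶ 0`:
  -- surjective for `ker g` and injective for `Aⁿ` imply injective for `M`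
  rw [← tensorMap_toTensor] at ht
  have := hS.mono_f
  obtain ⟨u, hu⟩ := exists_lift_of_exact w hS.exact _ ht
  obtain ⟨v, rfl⟩ := hB.toTensor_surjective hW u
  rw [tensorMap_toTensor] at hu
  rw [← hfree hu]
  exact (lTensor_exact (G.obj.obj (op W)) hfg hg _).2 ⟨v, rfl⟩

/-- The sections `G(W)` are flat over `A`: `G(W) ⊗ I ⟶ G(W)` is the map on sections of the
monomorphism `G ⊗ I ⟶ G`. -/
theorem IsTensorBasis.flat_sections : Module.Flat A (G.obj.obj (op W)) := by
  rw [Module.Flat.iff_lTensor_injective']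
  intro I
  obtain ⟨w, hS⟩ := hB.shortExact (Submodule.subtype_injective I)
    (LinearMap.exact_subtype_mkQ I) (Submodule.mkQ_surjective I)
  have := hS.mono_f
  have h := (appA_injective (tensorMap G I.subtype) W).comp (hB.toTensor_bijective hW (M := I)).1
  have h' : (appA (tensorMap G I.subtype) W) ∘ (toTensor G I W) =
      toTensor G A W ∘ I.subtype.lTensor (G.obj.obj (op W)) :=
    funext fun t ↦ tensorMap_toTensor G _ W t
  rw [h'] at h
  exact h.of_comp

omit hB hW [Module.Finite A M] [IsLocalRing A] [IsArtinianRing A] in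
/-- The canonical map `j_* G ⊗ M ⟶ j_* (G ⊗ M)` is an isomorphism if `(G ⊗ M)(W) = G(W) ⊗ M` for
the preimages `W` of the members of a basis. -/
theorem isIso_tensorPushforward {Z : TopCat.{0}} (j : Y ⟶ Z) {B' : Set (Opens Z)}
    (hB' : Opens.IsBasis B')
    (h : ∀ V ∈ B', Function.Bijective (toTensor G M ((Opens.map j).obj V))) :
    IsIso (tensorPushforward j G (ModuleCat.of A M)) := by
  let G' := (TopCat.Sheaf.pushforward _ j).obj G
  have key (V : Opens Z) (t : G'.obj.obj (op V) ⊗[A] M) :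
      appA (tensorPushforward j G (ModuleCat.of A M)) V (toTensor G' M V t) =
        toTensor G M ((Opens.map j).obj V) t := by
    have := toSheafify_sheafifyLift (Opens.grothendieckTopology Z)
      (Functor.whiskerLeft (Opens.map j).op
        (toSheafify (Opens.grothendieckTopology Y)
          (G.obj ⋙ MonoidalCategory.tensorRight (ModuleCat.of A M))))
      ((TopCat.Sheaf.pushforward _ j).obj (tensor G (ModuleCat.of A M))).property
    exact congr((($this).app (op V)).hom t)
  have h1 : Mono (tensorPushforward j G (ModuleCat.of A M)) := by
    refine mono_of_appA_injective _ fun V ↦ ?_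
    rw [← LinearMap.ker_eq_bot, LinearMap.ker_eq_bot']
    intro s hs
    refine eq_of_locally_eqA _ _ fun x hx ↦ ?_
    obtain ⟨V₁, hV₁, hxV₁, t, ht⟩ := exists_locally_toTensor G' s x hx
    obtain ⟨V₂, hV₂B, hxV₂, hV₂⟩ := Opens.isBasis_iff_nbhd.1 hB' hxV₁
    refine ⟨V₂, hV₂.trans hV₁, hxV₂, ?_⟩
    have ht2 := congr(resA _ hV₂ $ht)
    rw [resA_toTensor, resA_resA] at ht2
    have h0 : (resA G' hV₂).rTensor M t = 0 := by
      refine (h V₂ hV₂B).1 (Eq.trans ?_ (map_zero (toTensor G M _)).symm)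
      refine (key V₂ _).symm.trans ?_
      rw [ht2, appA_resA, hs, map_zero]
      rfl
    rw [← ht2, h0, map_zero, map_zero]
  have h2 : Epi (tensorPushforward j G (ModuleCat.of A M)) := by
    refine epi_of_locally_lift _ fun V s x hx ↦ ?_
    obtain ⟨V₂, hV₂B, hxV₂, hV₂⟩ := Opens.isBasis_iff_nbhd.1 hB' hx
    obtain ⟨t, ht⟩ := (h V₂ hV₂B).2 (resA _ hV₂ s)
    exact ⟨V₂, hV₂, hxV₂, toTensor G' M V₂ t, (key V₂ t).trans ht⟩
  exact isIso_of_mono_of_epi _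

end TensorSheaf

/-! ### Sections of modules over basic open sets -/

section Sections

open Opposite

variable {X : Scheme.{0}} (M : X.Modules)

/-- Restriction of functions, for an inclusion of open sets. -/
def resO (X : Scheme.{0}) {V W : X.Opens} (h : W ≤ V) : Γ(X, V) →+* Γ(X, W) :=
  (X.presheaf.map (homOfLE h).op).hom

/-- Restriction of sections of a module, for an inclusion of open sets. -/
def resM {V W : X.Opens} (h : W ≤ V) : Γ(M, V) →+ Γ(M, W) :=
  (M.presheaf.map (homOfLE h).op).hom

/-- The additive map on sections of a morphism of modules. -/
def appM {M N : X.Modules} (φ : M ⟶ N) (V : X.Opens) : Γ(M, V) →+ Γ(N, V) := (φ.app V).hom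

variable {V W W' : X.Opens}

@[simp] lemma resO_resO (h : W ≤ V) (h' : W' ≤ W) (a : Γ(X, V)) :
    resO X h' (resO X h a) = resO X (h'.trans h) a := by
  simp only [resO, ← CommRingCat.comp_apply, ← Functor.map_comp, ← op_comp, homOfLE_comp]

@[simp] lemma resO_self (a : Γ(X, V)) : resO X le_rfl a = a := by
  simp [resO]

@[simp] lemma resM_resM (h : W ≤ V) (h' : W' ≤ W) (m : Γ(M, V)) :
    resM M h' (resM M h m) = resM M (h'.trans h) m :=
  congr(($(M.presheaf.map_comp (homOfLE h).op (homOfLE h').op)).hom m).symm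

@[simp] lemma resM_self (m : Γ(M, V)) : resM M le_rfl m = m :=
  congr(($(M.presheaf.map_id (op V))).hom m)

@[simp] lemma resM_smul (h : W ≤ V) (a : Γ(X, V)) (m : Γ(M, V)) :
    resM M h (a • m) = resO X h a • resM M h m :=
  M.map_smul (homOfLE h) a m

@[simp] lemma appM_smul {M N : X.Modules} (φ : M ⟶ N) (a : Γ(X, V)) (m : Γ(M, V)) :
    appM φ V (a • m) = a • appM φ V m :=
  φ.app_smul a m

lemma appM_resM {M N : X.Modules} (φ : M ⟶ N) (h : W ≤ V) (m : Γ(M, V)) :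
    appM φ W (resM M h m) = resM N h (appM φ V m) :=
  congr(($(φ.mapPresheaf.naturality (homOfLE h).op)).hom m)

variable {M}

lemma eq_of_locally_eqM {s t : Γ(M, V)}
    (h : ∀ x ∈ V, ∃ (W : X.Opens) (hW : W ≤ V), x ∈ W ∧ resM M hW s = resM M hW t) : s = t := by
  choose W hW hx he using fun x : V ↦ h x.1 x.2
  exact TopCat.Sheaf.eq_of_locally_eq' ⟨_, M.isSheaf⟩ W V (fun x ↦ homOfLE (hW x))
    (fun x hx' ↦ Opens.mem_iSup.2 ⟨⟨x, hx'⟩, hx ⟨x, hx'⟩⟩) s t he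

lemma exists_glueM {ι : Type*} {V : X.Opens} (W : ι → X.Opens) (hW : ∀ i, W i ≤ V)
    (hc : V ≤ ⨆ i, W i) (s : ∀ i, Γ(M, W i))
    (h : ∀ i j, resM M (inf_le_left : W i ⊓ W j ≤ W i) (s i) = resM M inf_le_right (s j)) :
    ∃ t : Γ(M, V), ∀ i, resM M (hW i) t = s i := by
  obtain ⟨t, ht, -⟩ := TopCat.Sheaf.existsUnique_gluing' ⟨_, M.isSheaf⟩ W V
    (fun i ↦ homOfLE (hW i)) hc s h
  exact ⟨t, ht⟩

lemma eq_of_coverM {ι : Type*} {V : X.Opens} (W : ι → X.Opens) (hW : ∀ i, W i ≤ V)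
    (hc : V ≤ ⨆ i, W i) {s t : Γ(M, V)} (h : ∀ i, resM M (hW i) s = resM M (hW i) t) : s = t :=
  eq_of_locally_eqM fun x hx ↦ by
    obtain ⟨i, hi⟩ := Opens.mem_iSup.1 (hc hx)
    exact ⟨W i, hW i, hi, h i⟩

/-- Sections of `M` over the basic open subsets of `V` are fractions of sections over `V`. -/
structure LocalizesOn (M : X.Modules) (V : X.Opens) : Prop where
  ext (f : Γ(X, V)) (s : Γ(M, X.basicOpen f)) : ∃ (k : ℕ) (n : Γ(M, V)),
    resM M (X.basicOpen_le f) n = resO X (X.basicOpen_le f) f ^ k • s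
  inj (f : Γ(X, V)) (n : Γ(M, V)) (h : resM M (X.basicOpen_le f) n = 0) : ∃ k : ℕ, f ^ k • n = 0

lemma isUnit_resO (f : Γ(X, V)) (h : W ≤ X.basicOpen f) :
    IsUnit (resO X (h.trans (X.basicOpen_le f)) f) := by
  have := (X.toRingedSpace.isUnit_res_basicOpen f).map (resO X h)
  convert! this using 1
  exact (resO_resO (X.basicOpen_le f) h f).symm

lemma basicOpen_resO (h : W ≤ V) (f : Γ(X, V)) : X.basicOpen (resO X h f) = W ⊓ X.basicOpen f :=
  X.basicOpen_res f (homOfLE h).op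

/-- On a Noetherian open set, it suffices to check that a module localizes on a basis. -/
lemma LocalizesOn.of_isBasis {B : Set X.Opens} (hB : Opens.IsBasis B)
    (h : ∀ D ∈ B, LocalizesOn M D) (hV : ∀ W : X.Opens, W ≤ V → IsCompact (W : Set X)) :
    LocalizesOn M V := by
  have cover (W : X.Opens) (hW : W ≤ V) : ∃ (n : ℕ) (D : Fin n → X.Opens), (∀ i, D i ∈ B) ∧
      (∀ i, D i ≤ W) ∧ W ≤ ⨆ i, D i := by
    have nb : ∀ x : W, ∃ D ∈ B, x.1 ∈ D ∧ D ≤ W := fun x ↦ by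
      obtain ⟨D, hD, h, h'⟩ := Opens.isBasis_iff_nbhd.1 hB x.2
      exact ⟨D, hD, h, h'⟩
    choose D hD hx hDW using nb
    obtain ⟨t, ht⟩ := (hV W hW).elim_finite_subcover (fun x : W ↦ (D x : Set X))
      (fun x ↦ (D x).isOpen) (fun x hx' ↦ Set.mem_iUnion.2 ⟨⟨x, hx'⟩, hx ⟨x, hx'⟩⟩)
    refine ⟨t.card, fun i ↦ D (t.equivFin.symm i).1, fun i ↦ hD _, fun i ↦ hDW _, fun x hx' ↦ ?_⟩
    obtain ⟨y, hy, hxy⟩ := Set.mem_iUnion₂.1 (ht hx')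
    exact Opens.mem_iSup.2 ⟨t.equivFin ⟨y, hy⟩, by simpa using hxy⟩
  -- the injectivity is needed for the intersections of the members of a cover as well
  have hinj (W : X.Opens) (hW : W ≤ V) (f : Γ(X, W)) (n : Γ(M, W))
      (hn : resM M (X.basicOpen_le f) n = 0) : ∃ k : ℕ, f ^ k • n = 0 := by
    obtain ⟨m, D, hD, hDW, hc⟩ := cover W hW
    have (i : Fin m) : ∃ k : ℕ, resM M (hDW i) (f ^ k • n) = 0 := by
      obtain ⟨k, hk⟩ := (h _ (hD i)).inj (resO X (hDW i) f) (resM M (hDW i) n) (by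
        have hle : X.basicOpen (resO X (hDW i) f) ≤ X.basicOpen f := by
          rw [basicOpen_resO]; exact inf_le_right
        have := congr(resM M hle $hn)
        rw [resM_resM, map_zero] at this
        rw [resM_resM, this])
      exact ⟨k, by rw [resM_smul, map_pow, hk]⟩
    choose k hk using this
    refine ⟨∑ i, k i, eq_of_coverM D hDW hc fun i ↦ ?_⟩
    rw [← Finset.sum_erase_add _ _ (Finset.mem_univ i), pow_add, mul_smul, resM_smul, hk i,
      smul_zero, map_zero]
  refine ⟨fun f s ↦ ?_, hinj V le_rfl⟩
  obtain ⟨m, D, hD, hDV, hc⟩ := cover V le_rfl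
  have hle (i : Fin m) : X.basicOpen (resO X (hDV i) f) ≤ X.basicOpen f := by
    rw [basicOpen_resO]; exact inf_le_right
  have (i : Fin m) := (h _ (hD i)).ext (resO X (hDV i) f) (resM M (hle i) s)
  -- `f ^ K • s` extends to sections `n i` over the members of a finite cover, with `K` independent
  -- of `i`
  choose k n hn using this
  let K := ∑ i, k i
  have (i : Fin m) : ∃ n : Γ(M, D i), resM M (X.basicOpen_le (resO X (hDV i) f)) n =
      resM M (hle i) (resO X (X.basicOpen_le f) f ^ K • s) := by
    refine ⟨resO X (hDV i) f ^ (∑ j ∈ Finset.univ.erase i, k j) • n i, ?_⟩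
    rw [resM_smul, hn, resM_smul, smul_smul, map_pow, map_pow, resO_resO, resO_resO, ← pow_add,
      Finset.sum_erase_add _ _ (Finset.mem_univ i)]
  choose n hn using this
  -- these extensions agree on intersections after multiplication by a further power of `f`
  have (i j : Fin m) : ∃ l : ℕ, resO X (inf_le_left.trans (hDV i) : D i ⊓ D j ≤ V) f ^ l •
      (resM M (inf_le_left : D i ⊓ D j ≤ D i) (n i) - resM M inf_le_right (n j)) = 0 := by
    refine hinj _ (inf_le_left.trans (hDV i)) _ _ ?_
    have hi : X.basicOpen (resO X (inf_le_left.trans (hDV i) : D i ⊓ D j ≤ V) f) ≤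
        X.basicOpen (resO X (hDV i) f) := by
      simp only [basicOpen_resO]; exact inf_le_inf_right _ inf_le_left
    have hj : X.basicOpen (resO X (inf_le_left.trans (hDV i) : D i ⊓ D j ≤ V) f) ≤
        X.basicOpen (resO X (hDV j) f) := by
      simp only [basicOpen_resO]; exact inf_le_inf_right _ inf_le_right
    have ei := congr(resM M hi $(hn i))
    have ej := congr(resM M hj $(hn j))
    rw [resM_resM, resM_resM] at ei ej
    rw [map_sub, resM_resM, resM_resM, sub_eq_zero, ei, ej]
  choose l hl using this
  let L := ∑ i, ∑ j, l i j
  obtain ⟨t, ht⟩ := exists_glueM D hDV hc (fun i ↦ resO X (hDV i) f ^ L • n i) (fun i j ↦ by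
    rw [resM_smul, resM_smul, map_pow, map_pow, resO_resO, resO_resO, ← sub_eq_zero, ← smul_sub]
    have : L = (L - l i j) + l i j := by
      have h1 : l i j ≤ ∑ j, l i j := Finset.single_le_sum (fun _ _ ↦ Nat.zero_le _)
        (Finset.mem_univ j)
      have h2 : ∑ j, l i j ≤ L := Finset.single_le_sum (f := fun i ↦ ∑ j, l i j)
        (fun _ _ ↦ Nat.zero_le _) (Finset.mem_univ i)
      omega
    rw [this, pow_add, mul_smul, hl, smul_zero])
  refine ⟨L + K, t, eq_of_coverM (fun i ↦ X.basicOpen (resO X (hDV i) f)) hle ?_ fun i ↦ ?_⟩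
  · intro x hx
    obtain ⟨i, hi⟩ := Opens.mem_iSup.1 (hc (X.basicOpen_le f hx))
    refine Opens.mem_iSup.2 ⟨i, ?_⟩
    rw [basicOpen_resO]
    exact ⟨hi, hx⟩
  · have := congr(resM M (X.basicOpen_le (resO X (hDV i) f)) $(ht i))
    rw [resM_resM, resM_smul, hn i, ← resM_resM M (X.basicOpen_le f) (hle i)] at this
    rw [this, pow_add, mul_smul, resM_smul _ _ (_ ^ L), map_pow, map_pow, resO_resO, resO_resO]

end Sections

/-! ### Coherence from sections over affine open sets -/

section Affine

open Opposite Scheme.Modules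

variable {X : Scheme.{0}} {M : X.Modules} {V : X.Opens}

lemma image_fromSpec_le (hV : IsAffineOpen V) (W : (Spec Γ(X, V)).Opens) :
    hV.fromSpec ''ᵁ W ≤ V :=
  (hV.fromSpec.image_le_opensRange W).trans hV.opensRange_fromSpec.le

/-- The action of `Γ(X, V)` on the sections of `M` over an open subset of `Spec Γ(X, V)` is the one
through the restriction of functions on `X`. -/
lemma smul_restrict_fromSpec (hV : IsAffineOpen V) (W : (Spec Γ(X, V)).Opens) (b : Γ(X, V))
    (x : Γ(M.restrict hV.fromSpec, W)) :
    b • x = (show Γ(M.restrict hV.fromSpec, W) from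
      (resO X (image_fromSpec_le hV W) b • (show Γ(M, hV.fromSpec ''ᵁ W) from x) :)) := by
  rw [smul_Spec_def]
  have h : (Scheme.ΓSpecIso Γ(X, V)).inv ≫ (Spec Γ(X, V)).presheaf.map W.leTop.op ≫
      (hV.fromSpec.appIso W).inv = X.presheaf.map (homOfLE (image_fromSpec_le hV W)).op := by
    have h1 := hV.fromSpec.appLE_appIso_inv (U := V) (V := W)
      (by rw [hV.fromSpec_preimage_self]; exact le_top)
    rw [← h1, Scheme.Hom.appLE, hV.fromSpec_app_self]
    simp only [Category.assoc, ← Functor.map_comp_assoc]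
    rfl
  have := congr(($h).hom b)
  exact congr($this • (show Γ(M, hV.fromSpec ''ᵁ W) from x))

/-- The basic open set `D(f)`, as an open set of the scheme `Spec R`. -/
def specD {R : CommRingCat.{0}} (f : R) : (Spec R).Opens := PrimeSpectrum.basicOpen f

/-- The localization of sections over basic open sets of `Spec R`, in terms of elements. -/
lemma isLocalizing_iff {R : CommRingCat.{0}} (N : (Spec R).Modules) :
    IsLocalizing (modulesSpecToSheaf.obj N) ↔
      (∀ (f : R) (s : Γ(N, specD f)), ∃ (k : ℕ) (n : Γ(N, ⊤)),
        resM N le_top n = f ^ k • s) ∧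
      ∀ (f : R) (n : Γ(N, ⊤)), resM N (le_top : specD f ≤ ⊤) n = 0 →
        ∃ k : ℕ, f ^ k • n = 0 := by
  constructor
  · intro h
    refine ⟨fun f s ↦ ?_, fun f n hn ↦ ?_⟩
    · have : IsLocalizedModule (.powers f) (((modulesSpecToSheaf.obj N).obj.map
          (specD f).leTop.op).hom) := h f
      obtain ⟨⟨n, ⟨_, k, rfl⟩⟩, hn⟩ := IsLocalizedModule.surj (.powers f)
        (((modulesSpecToSheaf.obj N).obj.map
          (specD f).leTop.op).hom) s
      exact ⟨k, n, hn.symm⟩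
    · have := h f
      obtain ⟨⟨_, k, rfl⟩, hk⟩ := (IsLocalizedModule.eq_zero_iff (.powers f)
        (((modulesSpecToSheaf.obj N).obj.map
          (Opens.leTop (PrimeSpectrum.basicOpen (R := R) f)).op).hom)).1 hn
      exact ⟨k, hk⟩
  · intro h f
    refine IsLocalizedModule.Away.mk_of_addCommGroup ?_ ?_ ?_
    · exact N.isUnit_algebraMap_end_of_le_basicOpen f le_rfl
    · intro x
      obtain ⟨k, n, hn⟩ := h.1 f x
      exact ⟨k, n, hn.symm⟩
    · intro x hx
      obtain ⟨k, hk⟩ := h.2 f x hx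
      exact ⟨k, hk⟩

lemma isLocalizing_restrict_iff (hV : IsAffineOpen V) :
    IsLocalizing (modulesSpecToSheaf.obj (M.restrict hV.fromSpec)) ↔
      (∀ (f : Γ(X, V)) (s : Γ(M, hV.fromSpec ''ᵁ specD f)),
        ∃ (k : ℕ) (n : Γ(M, hV.fromSpec ''ᵁ ⊤)),
        resM M (hV.fromSpec.image_mono le_top) n =
          resO X (image_fromSpec_le hV (specD f)) (f ^ k) • s) ∧
      ∀ (f : Γ(X, V)) (n : Γ(M, hV.fromSpec ''ᵁ ⊤)),
        resM M (hV.fromSpec.image_mono (le_top : specD f ≤ ⊤)) n = 0 →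
        ∃ k : ℕ, resO X (image_fromSpec_le hV ⊤) (f ^ k) • n = 0 := by
  refine (isLocalizing_iff _).trans (and_congr (forall_congr' fun f ↦ forall_congr' fun s ↦
    exists_congr fun k ↦ exists_congr fun n ↦ ?_) (forall_congr' fun f ↦ forall_congr' fun n ↦
    imp_congr Iff.rfl (exists_congr fun k ↦ ?_)))
  · exact Eq.congr_right (smul_restrict_fromSpec hV _ _ _)
  · exact Eq.congr_left (smul_restrict_fromSpec hV _ _ _)

/-- On an affine open set `V`, a module localizes iff its restriction to `V` comes from a module
over `Γ(X, V)`. -/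
lemma localizesOn_iff_isIso_fromTildeΓ (hV : IsAffineOpen V) :
    LocalizesOn M V ↔ IsIso (M.restrict hV.fromSpec).fromTildeΓ := by
  rw [isIso_fromTildeΓ_iff_isLocalizing, isLocalizing_restrict_iff]
  have h1 : hV.fromSpec ''ᵁ ⊤ = V := by simp
  have h2 (f : Γ(X, V)) : hV.fromSpec ''ᵁ (specD f) = X.basicOpen f :=
    hV.fromSpec_image_basicOpen f
  constructor
  · intro h
    refine ⟨fun f s ↦ ?_, fun f n hn ↦ ?_⟩
    · obtain ⟨k, n, hn⟩ := h.ext f (resM M (h2 f).ge s)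
      refine ⟨k, resM M h1.le n, ?_⟩
      have := congr(resM M (h2 f).le $hn)
      rw [resM_resM, resM_smul, resM_resM, resM_self, map_pow, resO_resO, ← map_pow] at this
      rwa [resM_resM]
    · obtain ⟨k, hk⟩ := h.inj f (resM M h1.ge n) (by
        have := congr(resM M (h2 f).ge $hn)
        rw [map_zero, resM_resM] at this
        rwa [resM_resM])
      refine ⟨k, ?_⟩
      have := congr(resM M h1.le $hk)
      rw [resM_smul, resM_resM, resM_self, map_zero] at this
      exact this
  · intro h
    refine ⟨fun f s ↦ ?_, fun f n hn ↦ ?_⟩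
    · obtain ⟨k, n, hn⟩ := h.1 f (resM M (h2 f).le s)
      refine ⟨k, resM M h1.ge n, ?_⟩
      have := congr(resM M (h2 f).ge $hn)
      rw [resM_resM, resM_smul, resM_resM, resM_self, map_pow, map_pow, resO_resO, ← map_pow] at this
      rw [← map_pow, resM_resM]
      exact this
    · obtain ⟨k, hk⟩ := h.2 f (resM M h1.le n) (by
        have := congr(resM M (h2 f).le $hn)
        rw [map_zero, resM_resM] at this
        rwa [resM_resM])
      refine ⟨k, ?_⟩
      have := congr(resM M h1.ge $hk)
      rw [resM_smul, resM_resM, resM_self, map_zero, resO_resO, resO_self] at this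
      exact this

lemma LocalizesOn.of_isQuasicoherent (hM : SheafOfModules.IsQuasicoherent M)
    (hV : IsAffineOpen V) : LocalizesOn M V := by
  rw [localizesOn_iff_isIso_fromTildeΓ hV]
  have : M.IsQuasicoherent := hM
  infer_instance

/-- A module with a presentation on `Spec Γ(X, V)` has one on `V`. -/
lemma exists_presentation_over (hV : IsAffineOpen V)
    (p : SheafOfModules.Presentation (M.restrict hV.fromSpec)) :
    ∃ q : SheafOfModules.Presentation (SheafOfModules.over M V),
      q.generators.I = p.generators.I := by
  have : IsAffine V := hV
  -- transport along the equivalence of modules on `V` with modules on the slice site over `V`,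
  -- which preserves colimits and the structure sheaf
  let F : (Spec Γ(X, V)).Modules ⥤ SheafOfModules.{0} (X.ringCatSheaf.over V) :=
    restrictFunctor hV.isoSpec.hom ⋙ (overEquiv V).inverse
  have : Limits.PreservesColimitsOfSize.{0, 0} (restrictFunctor hV.isoSpec.hom) := inferInstance
  have hF : Limits.PreservesColimitsOfSize.{0, 0} F := inferInstance
  let F' : SheafOfModules.{0} (Spec Γ(X, V)).ringCatSheaf ⥤
    SheafOfModules.{0} (X.ringCatSheaf.over V) := F
  have : Limits.PreservesColimitsOfSize.{0, 0} F' := hF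
  let η : SheafOfModules.unit (X.ringCatSheaf.over V) ≅
      F.obj (SheafOfModules.unit (Spec Γ(X, V)).ringCatSheaf) :=
    (overEquiv V).unitIso.app _ ≪≫ (overEquiv V).inverse.mapIso
      (X := SheafOfModules.unit (V : Scheme.{0}).ringCatSheaf)
      (restrictUnitIso hV.isoSpec.hom).symm
  let e : F.obj (M.restrict hV.fromSpec) ≅ SheafOfModules.over M V :=
    (overEquiv V).inverse.mapIso ((restrictFunctorComp hV.isoSpec.hom hV.fromSpec).symm.app M ≪≫
      (restrictFunctorCongr hV.isoSpec_hom_fromSpec).app M ≪≫ (overFunctorEquiv V).symm.app M) ≪≫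
    ((overEquiv V).unitIso.app (SheafOfModules.over M V)).symm
  exact ⟨SheafOfModules.Presentation.ofIsIso e.hom (p.map F' η), rfl⟩

lemma finite_Γ_restrict (hV : IsAffineOpen V) [h : Module.Finite Γ(X, V) Γ(M, V)] :
    Module.Finite Γ(X, V) ((modulesSpecToSheaf.obj (M.restrict hV.fromSpec)).obj.obj (op ⊤)) := by
  have h1 : hV.fromSpec ''ᵁ ⊤ = V := by simp
  let l : Γ(M, V) →ₗ[Γ(X, V)]
      ((modulesSpecToSheaf.obj (M.restrict hV.fromSpec)).obj.obj (op ⊤)) :=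
    { toFun := fun m ↦ (resM M h1.le m :)
      map_add' := map_add (resM M h1.le)
      map_smul' := fun b m ↦ (resM_smul M h1.le b m).trans
        (smul_restrict_fromSpec hV ⊤ b (resM M h1.le m :)).symm }
  refine Module.Finite.of_surjective l fun n ↦ ⟨resM M h1.ge n, ?_⟩
  exact (resM_resM M h1.ge h1.le n).trans (resM_self M n)

lemma exists_presentation_finite (hV : IsAffineOpen V) (hM : LocalizesOn M V)
    (h : Module.Finite Γ(X, V) Γ(M, V)) :
    ∃ q : SheafOfModules.Presentation (SheafOfModules.over M V), q.generators.IsFiniteType := by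
  have hi := (localizesOn_iff_isIso_fromTildeΓ hV).1 hM
  have : @IsIso (SheafOfModules (Spec Γ(X, V)).ringCatSheaf) _ _ _
    (M.restrict hV.fromSpec).fromTildeΓ := hi
  let P := (modulesSpecToSheaf.obj (M.restrict hV.fromSpec)).obj.obj (op ⊤)
  obtain ⟨s, hs⟩ := (finite_Γ_restrict hV (M := M)).fg_top
  obtain ⟨q, hq⟩ := exists_presentation_over hV (M := M) (SheafOfModules.Presentation.ofIsIso
    (M.restrict hV.fromSpec).fromTildeΓ (presentationTilde P s hs _ (Submodule.span_eq _)))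
  refine ⟨q, ⟨?_⟩⟩
  rw [hq]
  exact inferInstanceAs (Finite (s : Set P))

/-- A module that localizes on the members of an affine open cover, with finitely generated
sections, is coherent. -/
lemma isCoherent_of_localizesOn {ι : Type} (V : ι → X.Opens) (hc : ⨆ i, V i = ⊤)
    (hV : ∀ i, IsAffineOpen (V i)) (hM : ∀ i, LocalizesOn M (V i))
    (hfin : ∀ i, Module.Finite Γ(X, V i) Γ(M, V i)) : IsCoherent M := by
  choose q hq using fun i ↦ exists_presentation_finite (hV i) (hM i) (hfin i)
  let D : SheafOfModules.QuasicoherentData M :=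
    { I := ι, X := V, coversTop := (Opens.coversTop_iff _ _).2 hc, presentation := q }
  refine ⟨D.isQuasicoherent, ⟨D.localGeneratorsData.shrink, ⟨fun i ↦ ?_⟩⟩⟩
  exact hq _

end Affine

/-! ### Sections of coherent modules -/

section FiniteType

open Opposite Scheme.Modules

variable {X : Scheme.{0}} {M : X.Modules} {V W : X.Opens}

/-- Sections over a smaller open set, as a module over the functions on a larger one. -/
abbrev moduleRes (M : X.Modules) (h : W ≤ V) : Module Γ(X, V) Γ(M, W) :=
  Module.compHom _ (resO X h)

/-- Restriction of sections as a linear map. -/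
def resL (M : X.Modules) (h : W ≤ V) :
    letI := moduleRes M h
    Γ(M, V) →ₗ[Γ(X, V)] Γ(M, W) :=
  letI := moduleRes M h
  { __ := resM M h
    map_smul' := resM_smul M h }

lemma LocalizesOn.isLocalizedModule (hM : LocalizesOn M V) (f : Γ(X, V)) :
    letI := moduleRes M (X.basicOpen_le f)
    IsLocalizedModule.Away f (resL M (X.basicOpen_le f)) := by
  let := moduleRes M (X.basicOpen_le f)
  refine IsLocalizedModule.Away.mk_of_addCommGroup ?_ ?_ ?_
  · obtain ⟨u, hu⟩ := isUnit_resO f le_rfl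
    rw [Module.End.isUnit_iff]
    refine ⟨fun x y hxy ↦ ?_, fun x ↦ ⟨(u⁻¹ : (Γ(X, X.basicOpen f))ˣ).1 • x, ?_⟩⟩
    · have h : u • x = u • y := by rw [Units.smul_def, Units.smul_def, hu]; exact hxy
      exact smul_left_cancel u h
    · change resO X (X.basicOpen_le f) f • (u⁻¹ : (Γ(X, X.basicOpen f))ˣ).1 • x = x
      rw [← hu, smul_smul, Units.mul_inv, one_smul]
  · intro x
    obtain ⟨k, n, hn⟩ := hM.ext f x
    refine ⟨k, n, ?_⟩
    rw [← map_pow] at hn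
    exact hn.symm
  · exact fun x hx ↦ hM.inj f x hx

/-- A quotient of `P^~` has finitely generated sections if `P` is finitely generated, since `P ↦
P^~` is fully faithful and reflects epimorphisms. -/
lemma finite_of_epi_tilde {R : CommRingCat.{0}} {P Q : ModuleCat.{0} R} [h : Module.Finite R P]
    (g : tilde P ⟶ tilde Q) (hg : Epi g) : Module.Finite R Q := by
  obtain ⟨g, rfl⟩ : ∃ g' : P ⟶ Q, tilde.map g' = g :=
    ⟨_, (tilde.functor R).map_preimage (X := P) (Y := Q) g⟩
  have h3 : Epi g := (tilde.functor R).epi_of_epi_map hg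
  rw [ModuleCat.epi_iff_surjective] at h3
  exact Module.Finite.of_surjective g.hom h3

lemma finite_of_generatingSections {R : CommRingCat.{0}} (N : (Spec R).Modules)
    (hN : IsIso N.fromTildeΓ) (σ : SheafOfModules.GeneratingSections N) [Finite σ.I] :
    Module.Finite R ((modulesSpecToSheaf.obj N).obj.obj (op ⊤)) := by
  let e := @asIso _ _ _ _ N.fromTildeΓ hN
  let Q : (Spec R).Modules := SheafOfModules.free (R := (Spec R).ringCatSheaf) σ.I
  let π : Q ⟶ N := σ.π
  have h1 : Epi π := σ.epi
  let a : tilde (ModuleCat.of R (σ.I →₀ R)) ≅ Q := tildeFinsupp σ.I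
  have h2 : Epi (a.hom ≫ π ≫ e.inv) := inferInstance
  exact finite_of_epi_tilde _ h2

lemma finite_Γ_of_restrict (hV : IsAffineOpen V)
    (h : Module.Finite Γ(X, V)
      ((modulesSpecToSheaf.obj (M.restrict hV.fromSpec)).obj.obj (op ⊤))) :
    Module.Finite Γ(X, V) Γ(M, V) := by
  have h1 : hV.fromSpec ''ᵁ ⊤ = V := by simp
  let l : ((modulesSpecToSheaf.obj (M.restrict hV.fromSpec)).obj.obj (op ⊤)) →ₗ[Γ(X, V)]
      Γ(M, V) :=
    { toFun := fun m ↦ resM M h1.ge m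
      map_add' := map_add (resM M h1.ge)
      map_smul' := fun b m ↦ by
        refine (congrArg (resM M h1.ge) (smul_restrict_fromSpec hV ⊤ b m)).trans ?_
        refine (resM_smul M h1.ge _ _).trans ?_
        rw [resO_resO, resO_self]
        rfl }
  refine Module.Finite.of_surjective l fun n ↦ ⟨resM M h1.le n, ?_⟩
  exact (resM_resM M h1.le h1.ge n).trans (resM_self M n)

/-- The sections of a coherent module over an affine open set are finitely generated. -/
theorem IsCoherent.finite (hM : IsCoherent M) (hV : IsAffineOpen V) :
    Module.Finite Γ(X, V) Γ(M, V) := by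
  obtain ⟨σ, hσ⟩ := hM.2.exists_localGeneratorsData
  have hcov := (Opens.coversTop_iff _ _).1 σ.coversTop
  -- near every point, finitely many sections that generate `M` locally generate its sections over a
  -- basic open set
  have key (x : X) (hx : x ∈ V) : ∃ f : Γ(X, V), x ∈ X.basicOpen f ∧
      Module.Finite Γ(X, X.basicOpen f) Γ(M, X.basicOpen f) := by
    obtain ⟨i, hi⟩ : ∃ i, x ∈ σ.X i := by
      have : x ∈ ⨆ i, σ.X i := by rw [hcov]; trivial
      exact Opens.mem_iSup.1 this
    obtain ⟨f, hf, hxf⟩ := hV.exists_basicOpen_le ⟨x, hi⟩ hx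
    refine ⟨f, hxf, ?_⟩
    have hD := hV.basicOpen f
    have : IsAffine (X.basicOpen f) := hD
    -- restriction from the slice site over `σ.X i` to `Spec Γ(X, D(f))` transports generating
    -- sections
    let F : SheafOfModules.{0} (X.ringCatSheaf.over (σ.X i)) ⥤ (Spec Γ(X, X.basicOpen f)).Modules :=
      (overEquiv (σ.X i)).functor ⋙ restrictFunctor (X.homOfLE hf) ⋙
        restrictFunctor hD.isoSpec.inv
    have h1 : Limits.PreservesColimitsOfSize.{0, 0} (restrictFunctor (X.homOfLE hf)) :=
      inferInstance
    have h2 : Limits.PreservesColimitsOfSize.{0, 0} (restrictFunctor hD.isoSpec.inv) :=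
      inferInstance
    have hF : Limits.PreservesColimitsOfSize.{0, 0} F := inferInstance
    let F' : SheafOfModules.{0} (X.ringCatSheaf.over (σ.X i)) ⥤
      SheafOfModules.{0} (Spec Γ(X, X.basicOpen f)).ringCatSheaf := F
    have : Limits.PreservesColimitsOfSize.{0, 0} F' := hF
    let η : F.obj (SheafOfModules.unit (X.ringCatSheaf.over (σ.X i))) ≅
        SheafOfModules.unit (Spec Γ(X, X.basicOpen f)).ringCatSheaf :=
      (restrictFunctor hD.isoSpec.inv).mapIso (restrictUnitIso (X.homOfLE hf)) ≪≫
        restrictUnitIso hD.isoSpec.inv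
    let e : F.obj (SheafOfModules.over M (σ.X i)) ≅ M.restrict hD.fromSpec :=
      (restrictFunctor hD.isoSpec.inv).mapIso ((restrictFunctor (X.homOfLE hf)).mapIso
        ((overFunctorEquiv (σ.X i)).app M) ≪≫ (restrictFunctorComp _ _).symm.app M ≪≫
        (restrictFunctorCongr (X.homOfLE_ι hf)).app M) ≪≫
      (restrictFunctorComp hD.isoSpec.inv (X.basicOpen f).ι).symm.app M
    let τ := (σ.generators i).map F' η.symm
    let e' : (SheafOfModules.GeneratingSections (F'.obj (SheafOfModules.over M (σ.X i)))) ≃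
      SheafOfModules.GeneratingSections (M.restrict hD.fromSpec) :=
        SheafOfModules.GeneratingSections.equivOfIso e
    have : Finite (e' τ).I := (hσ.isFiniteType i).finite
    have : IsIso (M.restrict hD.fromSpec).fromTildeΓ :=
      (localizesOn_iff_isIso_fromTildeΓ hD).1 (.of_isQuasicoherent hM.1 hD)
    exact finite_Γ_of_restrict hD (finite_of_generatingSections _ this (e' τ))
  have hloc := LocalizesOn.of_isQuasicoherent hM.1 hV
  let t : Set Γ(X, V) := {f | Module.Finite Γ(X, X.basicOpen f) Γ(M, X.basicOpen f)}
  have ht : Ideal.span t = ⊤ := by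
    rw [← hV.iSup_basicOpen_eq_self_iff]
    refine le_antisymm (iSup_le fun f ↦ X.basicOpen_le _) fun x hx ↦ ?_
    obtain ⟨f, hxf, hf⟩ := key x hx
    exact Opens.mem_iSup.2 ⟨⟨f, hf⟩, hxf⟩
  let (f : t) := moduleRes M (X.basicOpen_le f.1)
  let (f : t) : Algebra Γ(X, V) Γ(X, X.basicOpen f.1) := (resO X (X.basicOpen_le f.1)).toAlgebra
  have (f : t) : IsScalarTower Γ(X, V) Γ(X, X.basicOpen f.1) Γ(M, X.basicOpen f.1) :=
    .of_algebraMap_smul fun _ _ ↦ rfl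
  have (f : t) : IsLocalization.Away f.1 Γ(X, X.basicOpen f.1) := hV.isLocalization_basicOpen f.1
  have (f : t) := hloc.isLocalizedModule f.1
  exact Module.Finite.of_localizationSpan' t ht (fun f ↦ resL M (X.basicOpen_le f.1)) fun f ↦ f.2

end FiniteType

/-! ### Pullback to a closed subscheme: the affine case -/

section Pullback

open Opposite Scheme.Modules TensorProduct

/-- For `S = R / I`, the kernel of `P ⟶ S ⊗_R P` is `I P`. -/
lemma mem_ker_smul_of_one_tmul_eq_zero {R S P : Type*} [CommRing R] [CommRing S] [Algebra R S]
    [AddCommGroup P] [Module R P] (h : Function.Surjective (algebraMap R S)) (p : P)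
    (hp : (1 : S) ⊗ₜ[R] p = 0) : p ∈ RingHom.ker (algebraMap R S) • (⊤ : Submodule R P) := by
  let e : (R ⧸ RingHom.ker (algebraMap R S)) ≃ₗ[R] S :=
    (Ideal.quotientKerAlgEquivOfSurjective (f := Algebra.ofId R S) h).toLinearEquiv
  have h1 : (1 : R ⧸ RingHom.ker (algebraMap R S)) ⊗ₜ[R] p = 0 := by
    apply (TensorProduct.congr e (LinearEquiv.refl R P)).injective
    rw [map_zero, TensorProduct.congr_tmul]
    have : e 1 = 1 := map_one (Ideal.quotientKerAlgEquivOfSurjective (f := Algebra.ofId R S) h)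
    rw [this]
    exact hp
  have h2 := LinearMap.ker_tensorProductMk (R := R) (Q := P) (I := RingHom.ker (algebraMap R S))
  rw [← h2]
  exact h1

variable {R S : CommRingCat.{0}} (φ : R ⟶ S)

/-- Global sections of the direct image along `Spec S ⟶ Spec R`. -/
def pushforwardCompΓIso : pushforward (Spec.map φ) ⋙ moduleSpecΓFunctor (R := R) ≅
    moduleSpecΓFunctor (R := S) ⋙ ModuleCat.restrictScalars φ.hom :=
  Functor.isoWhiskerRight (pushforwardCompModulesSpecToSheafIso φ)
    (TopCat.Sheaf.forget _ _ ⋙ (evaluation _ _).obj (op ⊤))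

/-- The adjunction of `P ↦ (Spec φ)^* P^~` and global sections. -/
def pullbackTildeAdj : tilde.functor R ⋙ pullback (Spec.map φ) ⊣
    moduleSpecΓFunctor (R := S) ⋙ ModuleCat.restrictScalars φ.hom :=
  (tilde.adjunction.comp (pullbackPushforwardAdjunction (Spec.map φ))).ofNatIsoRight
    (pushforwardCompΓIso φ)

/-- The pullback of `P^~` is `(S ⊗_R P)^~`, since both are left adjoint to global sections. -/
def pullbackTildeIso : tilde.functor R ⋙ pullback (Spec.map φ) ≅
    ModuleCat.extendScalars φ.hom ⋙ tilde.functor S :=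
  (pullbackTildeAdj φ).leftAdjointUniq
    ((ModuleCat.extendRestrictScalarsAdj φ.hom).comp tilde.adjunction)

/-- The pullback of a quasi-coherent module along a morphism of affine schemes is quasi-coherent. -/
lemma isIso_fromTildeΓ_pullback (N : (Spec R).Modules) (hN : IsIso N.fromTildeΓ) :
    IsIso ((pullback (Spec.map φ)).obj N).fromTildeΓ := by
  rw [isIso_fromTildeΓ_iff] at hN ⊢
  obtain ⟨P, ⟨e⟩⟩ := hN
  exact ⟨_, ⟨((pullbackTildeIso φ).app P).symm ≪≫ (pullback (Spec.map φ)).mapIso e⟩⟩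

/-- The formal part of the computation of a unit by a transported adjunction. -/
lemma eq_comp_of_triangle {C : Type*} [Category* C] {P Q A₁ A₂ Q₁ Q₂ Q₃ : C} {η : P ⟶ Q}
    {v : Q ⟶ A₁} {c : A₁ ≅ Q₁} {d : Q₁ ≅ Q₂} {u : P ⟶ Q₃} {t : Q₃ ≅ Q₂} {f : Q ⟶ P} {w : P ⟶ A₂}
    {b : A₁ ≅ A₂} (h2 : (η ≫ v ≫ c.hom) ≫ d.hom = u ≫ t.hom) (h3 : f ≫ w = v ≫ b.hom)
    (h4 : η ≫ f = 𝟙 P) : w = u ≫ (t ≪≫ d.symm ≪≫ c.symm ≪≫ b).hom := by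
  have h5 : w = η ≫ v ≫ b.hom := by rw [← h3, reassoc_of% h4]
  have h6 : η ≫ v = u ≫ t.hom ≫ d.inv ≫ c.inv := by
    rw [← reassoc_of% h2]; simp
  rw [h5, reassoc_of% h6]
  simp

/-- The global sections of the pullback are `S ⊗_R P`. -/
lemma exists_unit_eq (N : (Spec R).Modules) (hN : IsIso N.fromTildeΓ) :
    ∃ e : (ModuleCat.restrictScalars φ.hom).obj
        ((ModuleCat.extendScalars φ.hom).obj (moduleSpecΓFunctor.obj N)) ≅
      moduleSpecΓFunctor.obj ((pushforward (Spec.map φ)).obj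
        ((pullback (Spec.map φ)).obj N)),
      moduleSpecΓFunctor.map ((pullbackPushforwardAdjunction (Spec.map φ)).unit.app N) =
        (ModuleCat.extendRestrictScalarsAdj φ.hom).unit.app _ ≫ e.hom := by
  let P : ModuleCat R := moduleSpecΓFunctor.obj N
  let res := ModuleCat.restrictScalars.{0} φ.hom
  let GS := moduleSpecΓFunctor (R := S)
  let GR := moduleSpecΓFunctor (R := R)
  let pp := pullbackPushforwardAdjunction (Spec.map φ)
  let f : tilde P ⟶ N := tilde.adjunction.counit.app N
  have hf : IsIso f := hN
  let a := (pullbackTildeIso φ).app P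
  let g := (pushforwardCompΓIso φ).app ((pullback (Spec.map φ)).obj (tilde P))
  let t := @asIso _ _ _ _ (tilde.adjunction.unit.app ((ModuleCat.extendScalars φ.hom).obj P))
    inferInstance
  have h2 : (tilde.adjunction.unit.app P ≫ GR.map (pp.unit.app (tilde P)) ≫ g.hom) ≫
      res.map (GS.map a.hom) =
      (ModuleCat.extendRestrictScalarsAdj φ.hom).unit.app P ≫ res.map t.hom := by
    have := (pullbackTildeAdj φ).unit_leftAdjointUniq_hom_app
      ((ModuleCat.extendRestrictScalarsAdj φ.hom).comp tilde.adjunction) P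
    rw [Adjunction.comp_unit_app] at this
    exact this
  have h3 : GR.map f ≫ GR.map (pp.unit.app N) = GR.map (pp.unit.app (tilde P)) ≫
      GR.map ((pushforward (Spec.map φ)).map ((pullback (Spec.map φ)).map f)) := by
    rw [← GR.map_comp, ← GR.map_comp]
    exact congrArg GR.map (pp.unit.naturality f)
  have h4 : tilde.adjunction.unit.app P ≫ GR.map f = 𝟙 P :=
    tilde.adjunction.right_triangle_components N
  let b := (GR.mapIso ((pushforward (Spec.map φ)).mapIso
    ((pullback (Spec.map φ)).mapIso (@asIso _ _ _ _ f hf))))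
  exact ⟨_, eq_comp_of_triangle (c := g) (d := res.mapIso (GS.mapIso a)) (t := res.mapIso t) (b := b)
    h2 h3 h4⟩

/-- The unit `M ⟶ f_* f^* M`, on sections. -/
def pbUnit {X Y : Scheme.{0}} (f : X ⟶ Y) (M : Y.Modules) (V : Y.Opens) :
    Γ(M, V) →+ Γ((pullback f).obj M, f ⁻¹ᵁ V) :=
  appM ((pullbackPushforwardAdjunction f).unit.app M) V

/-- For `S = R / I`, global sections of the restriction of `N` to `Spec S` are global sections of
`N` modulo `I`. -/
lemma pbUnit_SpecMap (h : Function.Surjective φ) (N : (Spec R).Modules)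
    (hN : IsIso N.fromTildeΓ) (V : (Spec R).Opens) (hV : V = ⊤) :
    Function.Surjective (pbUnit (Spec.map φ) N V) ∧
      ∀ n : Γ(N, V), pbUnit (Spec.map φ) N V n = 0 →
        n ∈ RingHom.ker φ.hom • (⊤ : Submodule R Γ(N, V)) := by
  subst hV
  obtain ⟨e, he⟩ := exists_unit_eq φ N hN
  let P : ModuleCat R := moduleSpecΓFunctor.obj N
  let := φ.hom.toAlgebra
  have hu (n : P) : pbUnit (Spec.map φ) N ⊤ n =
      e.hom.hom ((1 : S) ⊗ₜ[R] n : S ⊗[R] P) := congr(($he).hom n)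
  constructor
  · intro s
    obtain ⟨t, ht⟩ := (ConcreteCategory.bijective_of_isIso e.hom).2 s
    have : ∀ t : S ⊗[R] P, ∃ n : P, (1 : S) ⊗ₜ[R] n = t := by
      intro t
      induction t with
      | zero => exact ⟨0, TensorProduct.tmul_zero _ _⟩
      | add x y hx hy =>
        obtain ⟨n, hn⟩ := hx
        obtain ⟨m, hm⟩ := hy
        exact ⟨n + m, by rw [TensorProduct.tmul_add, hn, hm]⟩
      | tmul x y =>
        obtain ⟨r, rfl⟩ := h x
        refine ⟨r • y, ?_⟩
        rw [TensorProduct.tmul_smul, TensorProduct.smul_tmul', Algebra.smul_def, mul_one]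
        rfl
    obtain ⟨n, hn⟩ := this t
    refine ⟨n, (hu n).trans ?_⟩
    rw [hn]
    exact ht
  · intro n hn
    have h0 : ((1 : S) ⊗ₜ[R] (n : P) : S ⊗[R] P) = 0 := by
      apply (ConcreteCategory.bijective_of_isIso e.hom).1
      exact ((hu n).symm.trans hn).trans (map_zero e.hom.hom).symm
    exact mem_ker_smul_of_one_tmul_eq_zero (R := R) (S := S) (P := P) h _ h0

end Pullback

/-! ### Pullback to a closed subscheme -/

section Pullback

open Opposite Scheme.Modules TensorProduct

variable {X Y Z : Scheme.{0}}

lemma pbUnit_smul (f : X ⟶ Y) (M : Y.Modules) (V : Y.Opens) (b : Γ(Y, V)) (m : Γ(M, V)) :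
    pbUnit f M V (b • m) = f.app V b • pbUnit f M V m :=
  appM_smul _ b m

lemma appM_bijective {M N : X.Modules} (φ : M ⟶ N) (h : IsIso φ) (V : X.Opens) :
    Function.Bijective (appM φ V) :=
  ConcreteCategory.bijective_of_isIso (φ.app V)

/-- The unit of `f ≫ g` is, up to the isomorphism `(f ≫ g)^* ≅ f^* g^*`, the composite of the
units of `g` and `f`. -/
lemma pbUnit_comp (f : X ⟶ Y) (g : Y ⟶ Z) (M : Z.Modules) (V : Z.Opens) (m : Γ(M, V)) :
    pbUnit f ((pullback g).obj M) (g ⁻¹ᵁ V) (pbUnit g M V m) =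
      appM ((pullbackComp f g).inv.app M) (f ⁻¹ᵁ g ⁻¹ᵁ V) (pbUnit (f ≫ g) M V m) := by
  have h := unit_conjugateEquiv
    ((pullbackPushforwardAdjunction g).comp (pullbackPushforwardAdjunction f))
    (pullbackPushforwardAdjunction (f ≫ g)) (pullbackComp f g).inv M
  rw [conjugateEquiv_pullbackComp_inv] at h
  exact congr((($h).app V).hom m)

lemma pbUnit_bijective_of_isOpenImmersion (f : X ⟶ Y) [IsOpenImmersion f] (M : Y.Modules)
    (V : Y.Opens) (hV : V ≤ f.opensRange) : Function.Bijective (pbUnit f M V) := by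
  have h := (restrictAdjunction f).unit_leftAdjointUniq_hom_app (pullbackPushforwardAdjunction f) M
  have h' (m : Γ(M, V)) : pbUnit f M V m = appM ((restrictFunctorIsoPullback f).hom.app M)
      (f ⁻¹ᵁ V) (resM M (f.image_preimage_le V) m) := congr((($h).app V).hom m).symm
  have hV' : f ''ᵁ f ⁻¹ᵁ V = V := by
    rw [Scheme.Hom.image_preimage_eq_opensRange_inf]; exact inf_eq_right.2 hV
  have h1 : Function.Bijective (resM M (f.image_preimage_le V)) := by
    refine ⟨fun x y hxy ↦ ?_, fun x ↦ ⟨resM M hV'.ge x, by rw [resM_resM, resM_self]⟩⟩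
    have := congr(resM M hV'.ge $hxy)
    rwa [resM_resM, resM_resM, resM_self, resM_self] at this
  rw [show ⇑(pbUnit f M V) = appM ((restrictFunctorIsoPullback f).hom.app M)
      (f ⁻¹ᵁ V) ∘ (resM M (f.image_preimage_le V)) from funext h']
  exact (appM_bijective _ inferInstance _).comp h1

lemma ker_pbUnit_comp (f : X ⟶ Y) (g : Y ⟶ Z) (M : Z.Modules) (V : Z.Opens) (m : Γ(M, V)) :
    pbUnit (f ≫ g) M V m = 0 ↔ pbUnit f ((pullback g).obj M) (g ⁻¹ᵁ V) (pbUnit g M V m) = 0 := by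
  rw [pbUnit_comp]
  exact (map_eq_zero_iff _ (appM_bijective ((pullbackComp f g).inv.app M) inferInstance _).1).symm

lemma surjective_pbUnit_comp (f : X ⟶ Y) (g : Y ⟶ Z) (M : Z.Modules) (V : Z.Opens) :
    Function.Surjective (pbUnit (f ≫ g) M V) ↔ Function.Surjective
      (pbUnit f ((pullback g).obj M) (g ⁻¹ᵁ V) ∘ pbUnit g M V) := by
  rw [show pbUnit f ((pullback g).obj M) (g ⁻¹ᵁ V) ∘ pbUnit g M V =
    appM ((pullbackComp f g).inv.app M) (f ⁻¹ᵁ g ⁻¹ᵁ V) ∘ pbUnit (f ≫ g) M V from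
    funext (pbUnit_comp f g M V)]
  exact (Function.Surjective.of_comp_iff' (appM_bijective ((pullbackComp f g).inv.app M)
    inferInstance _) _).symm

variable (i : Z ⟶ X) {M : X.Modules} {V : X.Opens}

lemma fromSpec_comp_eq (hV : IsAffineOpen V) (hE : IsAffineOpen (i ⁻¹ᵁ V)) :
    Spec.map (i.app V) ≫ hV.fromSpec = hE.fromSpec ≫ i := by
  rw [← IsAffineOpen.SpecMap_appLE_fromSpec i hV hE le_rfl, Scheme.Hom.appLE]
  congr
  simp

lemma LocalizesOn.isIso_fromTildeΓ_fromSpec (hM : LocalizesOn M V) (hV : IsAffineOpen V) :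
    IsIso ((pullback hV.fromSpec).obj M).fromTildeΓ := by
  have h := (localizesOn_iff_isIso_fromTildeΓ hV).1 hM
  rw [isIso_fromTildeΓ_iff] at h ⊢
  obtain ⟨P, ⟨e⟩⟩ := h
  exact ⟨P, ⟨e ≪≫ (restrictFunctorIsoPullback hV.fromSpec).app M⟩⟩

/-- The pullback of a quasi-coherent module along an affine morphism localizes on affine open
sets. -/
lemma LocalizesOn.pullback (hM : LocalizesOn M V) (hV : IsAffineOpen V)
    (hE : IsAffineOpen (i ⁻¹ᵁ V)) : LocalizesOn ((pullback i).obj M) (i ⁻¹ᵁ V) := by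
  rw [localizesOn_iff_isIso_fromTildeΓ hE]
  have h1 := isIso_fromTildeΓ_pullback (i.app V) _ (hM.isIso_fromTildeΓ_fromSpec hV)
  rw [isIso_fromTildeΓ_iff] at h1 ⊢
  obtain ⟨P, ⟨e⟩⟩ := h1
  exact ⟨P, ⟨e ≪≫ (pullbackComp _ _).app M ≪≫ (pullbackCongr (fromSpec_comp_eq i hV hE)).app M ≪≫
    (pullbackComp hE.fromSpec i).symm.app M ≪≫
    (restrictFunctorIsoPullback hE.fromSpec).symm.app _⟩⟩

/-- Over an affine open set, the pullback along a closed immersion is the reduction modulo its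
ideal. -/
theorem LocalizesOn.pbUnit_surjective_and_ker (hM : LocalizesOn M V) (hV : IsAffineOpen V)
    (hE : IsAffineOpen (i ⁻¹ᵁ V)) (hi : Function.Surjective (i.app V)) :
    Function.Surjective (pbUnit i M V) ∧ ∀ m : Γ(M, V), pbUnit i M V m = 0 →
      m ∈ RingHom.ker (i.app V).hom • (⊤ : Submodule Γ(X, V) Γ(M, V)) := by
  -- both `Spec Γ(X, V) ⟶ X` and `Spec Γ(Z, i⁻¹ V) ⟶ Z` are open immersions, so that the square
  -- formed with `i` reduces the claim to affine schemes
  let N := (Scheme.Modules.pullback hV.fromSpec).obj M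
  have hv : V ≤ hV.fromSpec.opensRange := hV.opensRange_fromSpec.ge
  have hw : i ⁻¹ᵁ V ≤ hE.fromSpec.opensRange := hE.opensRange_fromSpec.ge
  have hvb := pbUnit_bijective_of_isOpenImmersion hV.fromSpec M V hv
  have hwb := pbUnit_bijective_of_isOpenImmersion hE.fromSpec ((Scheme.Modules.pullback i).obj M)
    (i ⁻¹ᵁ V) hw
  obtain ⟨h1, h2⟩ := pbUnit_SpecMap (i.app V) hi N (hM.isIso_fromTildeΓ_fromSpec hV)
    (hV.fromSpec ⁻¹ᵁ V) hV.fromSpec_preimage_self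
  have key := fromSpec_comp_eq i hV hE
  constructor
  · have h3 := (surjective_pbUnit_comp (Spec.map (i.app V)) hV.fromSpec M V).2
      (h1.comp hvb.2)
    rw [key, surjective_pbUnit_comp] at h3
    exact (Function.Surjective.of_comp_iff' hwb _).1 h3
  · intro m hm
    have h3 : pbUnit (hE.fromSpec ≫ i) M V m = 0 := by
      rw [ker_pbUnit_comp, hm, map_zero]
    rw [← key, ker_pbUnit_comp] at h3
    have h4 := h2 _ h3
    let e : Γ(M, V) ≃ₗ[Γ(X, V)] Γ(N, hV.fromSpec ⁻¹ᵁ V) := LinearEquiv.ofBijective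
      { toFun := pbUnit hV.fromSpec M V
        map_add' := map_add _
        map_smul' := fun b m ↦ by
          rw [pbUnit_smul, hV.fromSpec_app_self]
          rfl } hvb
    have h5 : e m ∈ RingHom.ker (i.app V).hom • (⊤ : Submodule Γ(X, V) _) := h4
    have h6 := Submodule.mem_map_of_mem (f := e.symm.toLinearMap) h5
    rw [Submodule.map_smul''] at h6
    have h7 : e.symm (e m) = m := e.symm_apply_apply m
    exact h7 ▸ Submodule.smul_mono le_rfl le_top h6

end Pullback

/-! ### Gluing of sections and flatness of stalks -/

section Glue

/-- Sections of the localizations at elements that generate the unit ideal glue. -/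
lemma exists_glue_of_span {R : Type*} [CommRing R] {ι : Type*} [Fintype ι] (f : ι → R)
    (hf : Ideal.span (Set.range f) = ⊤) {N : Type*} [AddCommGroup N] [Module R N]
    {N₁ : ι → Type*} [∀ i, AddCommGroup (N₁ i)] [∀ i, Module R (N₁ i)]
    {N₂ : ι → ι → Type*} [∀ i j, AddCommGroup (N₂ i j)] [∀ i j, Module R (N₂ i j)]
    (a : ∀ i, N →ₗ[R] N₁ i) (l : ∀ i j, N₁ i →ₗ[R] N₂ i j) (r : ∀ i j, N₁ j →ₗ[R] N₂ i j)
    (hal : ∀ i j n, l i j (a i n) = r i j (a j n))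
    (hloc : ∀ i, IsLocalizedModule.Away (f i) (a i))
    (inj₂ : ∀ i j (n : N), l i j (a i n) = 0 → ∃ m : ℕ, (f i * f j) ^ m • n = 0)
    (h : ∀ i, N₁ i) (hh : ∀ i j, l i j (h i) = r i j (h j)) : ∃ n, ∀ i, a i n = h i := by
  have h1 : ∃ K : ℕ, ∀ i, ∃ n, a i n = f i ^ K • h i := by
    refine exists_common_pow (fun i m n hmn hm ↦ ?_) fun i ↦ ?_
    · obtain ⟨x, hx⟩ := hm
      refine ⟨f i ^ (n - m) • x, ?_⟩
      rw [map_smul, hx, smul_smul, ← pow_add, Nat.sub_add_cancel hmn]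
    · obtain ⟨⟨n, ⟨_, k, rfl⟩⟩, hn⟩ := IsLocalizedModule.surj (.powers (f i)) (a i) (h i)
      exact ⟨k, n, hn.symm⟩
  obtain ⟨K, hK⟩ := h1
  choose n hn using hK
  have h2 : ∃ L : ℕ, ∀ p : ι × ι, (f p.1 * f p.2) ^ L • (f p.2 ^ K • n p.1 - f p.1 ^ K • n p.2) = 0 := by
    refine exists_common_pow (fun i m n hmn hm ↦ ?_) fun i ↦ ?_
    · rw [← Nat.sub_add_cancel hmn, pow_add, mul_smul, hm, smul_zero]
    · refine inj₂ i.1 i.2 _ ?_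
      rw [map_sub, map_sub, map_smul, map_smul, map_smul, map_smul, hal _ _ (n i.2), hn, hn,
        map_smul, map_smul, hh, smul_comm, sub_self]
  obtain ⟨L, hL⟩ := h2
  have hspan : Ideal.span (Set.range fun i ↦ f i ^ (K + L)) = ⊤ := by
    have := Ideal.span_pow_eq_top _ hf (K + L)
    rwa [← Set.range_comp] at this
  obtain ⟨e, he⟩ := (Ideal.mem_span_range_iff_exists_fun).1
    (show (1 : R) ∈ Ideal.span (Set.range fun i ↦ f i ^ (K + L)) by rw [hspan]; trivial)
  -- partition of unity: `n i` represents `f i ^ K • h i`, and `∑ e i * f i ^ (K + L) = 1`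
  refine ⟨∑ i, e i • f i ^ L • n i, fun j ↦ ?_⟩
  have hj : f j ^ (K + L) • ∑ i, e i • f i ^ L • n i = f j ^ L • n j := by
    have (i : ι) : f j ^ (K + L) • e i • f i ^ L • n i = (e i * f i ^ (K + L)) • f j ^ L • n j := by
      have := hL (i, j)
      rw [smul_sub, sub_eq_zero] at this
      have := congr(e i • $this)
      simp only [smul_smul] at this ⊢
      convert! this using 2 <;> ring
    rw [Finset.smul_sum, Finset.sum_congr rfl fun i _ ↦ this i, ← Finset.sum_smul, he, one_smul]
  have hu := IsLocalizedModule.map_units (S := .powers (f j)) (a j) ⟨f j ^ (K + L), K + L, rfl⟩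
  rw [Module.End.isUnit_iff] at hu
  refine hu.1 ?_
  change f j ^ (K + L) • a j _ = f j ^ (K + L) • h j
  rw [← map_smul, hj, map_smul, hn, smul_smul, ← pow_add, add_comm]

end Glue

section StalkTensor

open Opposite TensorProduct

variable {A : Type} [CommRing A] {Y : TopCat.{0}} (G : TopCat.Sheaf (ModuleCat.{0} A) Y)
  (M : Type) [AddCommGroup M] [Module A M]

/-- The germ of a section, as a linear map. -/
def germA (V : Opens Y) (x : Y) (hx : x ∈ V) :
    G.obj.obj (op V) →ₗ[A] TopCat.Presheaf.stalk (C := ModuleCat.{0} A) G.obj x :=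
  (TopCat.Presheaf.germ (C := ModuleCat.{0} A) G.obj V x hx).hom

/-- Tensor products commute with stalks. -/
lemma isColimit_stalk_tensor (x : Y) :
    Nonempty (Limits.IsColimit ((MonoidalCategory.tensorRight (ModuleCat.of A M)).mapCocone
      (Limits.colimit.cocone ((OpenNhds.inclusion x).op ⋙ G.obj)))) :=
  ⟨Limits.isColimitOfPreserves _ (Limits.colimit.isColimit _)⟩

lemma exists_germ_tensor (x : Y)
    (t : TopCat.Presheaf.stalk (C := ModuleCat.{0} A) G.obj x ⊗[A] M) :
    ∃ (V : Opens Y) (hx : x ∈ V) (u : G.obj.obj (op V) ⊗[A] M),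
      (germA G V x hx).rTensor M u = t := by
  obtain ⟨h⟩ := isColimit_stalk_tensor G M x
  obtain ⟨⟨V, hV⟩, u, hu⟩ := Limits.Concrete.isColimit_exists_rep _ h t
  exact ⟨V, hV, u, hu⟩

lemma exists_res_eq_zero_of_germ_tensor {V : Opens Y} (x : Y) (hx : x ∈ V)
    (u : G.obj.obj (op V) ⊗[A] M) (hu : (germA G V x hx).rTensor M u = 0) :
    ∃ (W : Opens Y) (h : W ≤ V), x ∈ W ∧ (resA G h).rTensor M u = 0 := by
  obtain ⟨h⟩ := isColimit_stalk_tensor G M x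
  obtain ⟨⟨W, hW⟩, i, i', h⟩ := Limits.Concrete.isColimit_exists_of_rep_eq _ h
    (i := op ⟨V, hx⟩) (j := op ⟨V, hx⟩) u (0 : G.obj.obj (op V) ⊗[A] M)
    (hu.trans (map_zero ((germA G V x hx).rTensor M)).symm)
  refine ⟨W, leOfHom i.unop, hW, h.trans ?_⟩
  exact map_zero ((resA G (leOfHom i'.unop)).rTensor M)

/-- A sheaf with flat sections on a basis is flat. -/
lemma isFlatSheaf_of_isBasis {B : Set (Opens Y)} (hB : Opens.IsBasis B)
    (h : ∀ V ∈ B, Module.Flat A (G.obj.obj (op V))) : IsFlatSheaf G := by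
  intro x
  rw [Module.Flat.iff_lTensor_injective']
  intro I
  have h1 : Function.Injective (I.subtype.lTensor
      (TopCat.Presheaf.stalk (C := ModuleCat.{0} A) G.obj x)) := by
    rw [← LinearMap.ker_eq_bot, LinearMap.ker_eq_bot']
    intro t ht
    obtain ⟨V, hV, u, rfl⟩ := exists_germ_tensor G I x t
    have comm {V : Opens Y} (hV : x ∈ V) (u) : I.subtype.lTensor _ ((germA G V x hV).rTensor I u) =
        (germA G V x hV).rTensor A (I.subtype.lTensor _ u) := by
      rw [← LinearMap.comp_apply, ← LinearMap.comp_apply, LinearMap.lTensor_comp_rTensor,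
        LinearMap.rTensor_comp_lTensor]
    rw [comm] at ht
    obtain ⟨W, hWV, hxW, hW⟩ := exists_res_eq_zero_of_germ_tensor G A x hV _ ht
    obtain ⟨D, hD, hxD, hDW⟩ := Opens.isBasis_iff_nbhd.1 hB hxW
    have := h D hD
    have h0 : (resA G (hDW.trans hWV)).rTensor I u = 0 := by
      refine Module.Flat.lTensor_preserves_injective_linearMap (M := G.obj.obj (op D)) I.subtype
        I.injective_subtype ?_
      rw [map_zero, ← LinearMap.comp_apply, LinearMap.lTensor_comp_rTensor,
        ← LinearMap.rTensor_comp_lTensor, LinearMap.comp_apply]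
      have := congr((resA G hDW).rTensor A $hW)
      rw [map_zero, ← LinearMap.comp_apply, ← LinearMap.rTensor_comp] at this
      convert this using 3
      ext s
      exact (resA_resA hWV hDW s).symm
    have hg : germA G V x hV = germA G D x hxD ∘ₗ resA G (hDW.trans hWV) := by
      ext s
      exact (TopCat.Presheaf.germ_res_apply (C := ModuleCat.{0} A) G.obj
        (homOfLE (hDW.trans hWV)) x hxD s).symm
    rw [hg, LinearMap.rTensor_comp, LinearMap.comp_apply, h0, map_zero]
  exact h1

end StalkTensor

/-! ### Tensor products of quasi-coherent modules over the base ring -/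

section SheafModule

open Opposite TensorProduct

variable {A : Type} [CommRing A] {Y : Scheme.{0}} (f : Y ⟶ Spec (.of A)) (F : Y.Modules)

/-- The action of the base ring on functions. -/
def algA (V : Y.Opens) : A →+* Γ(Y, V) :=
  (resO Y le_top).comp ((Scheme.ΓSpecIso (.of A)).inv ≫ f.appTop).hom

lemma resO_algA {V W : Y.Opens} (h : W ≤ V) (a : A) : resO Y h (algA f V a) = algA f W a :=
  resO_resO _ h _

/-- The action of the base ring on sections. -/
abbrev moduleA (V : Y.Opens) : Module A Γ(F, V) := Module.compHom _ (algA f V)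

/-- Multiplication by a function on the sections over an open set. -/
def mulA (V : Y.Opens) : Γ(Y, V) →+* Module.End A ((toSheafModule f F).obj.obj (op V)) :=
  letI := moduleA f F V
  letI : SMulCommClass Γ(Y, V) A Γ(F, V) := ⟨fun b a n ↦ smul_comm b (algA f V a) n⟩
  (Module.toModuleEnd A (S := Γ(Y, V)) Γ(F, V) :)

variable {F} (M : Type) [AddCommGroup M] [Module A M]

/-- Multiplication by `b` on the first factor is the scalar multiplication on the tensor product. -/
lemma rTensor_mulA (D : Y.Opens) (b : Γ(Y, D))
    (t : (toSheafModule f F).obj.obj (op D) ⊗[A] M) :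
    let := moduleA f F D
    let : Algebra A Γ(Y, D) := (algA f D).toAlgebra
    have : IsScalarTower A Γ(Y, D) Γ(F, D) := .of_algebraMap_smul fun _ _ ↦ rfl
    (mulA f F D b).rTensor M t = b • (show Γ(F, D) ⊗[A] M from t) := by
  intro _ _ _
  induction t with
  | zero => rw [map_zero]; exact (smul_zero (M := Γ(Y, D)) (A := Γ(F, D) ⊗[A] M) _).symm
  | add x y hx hy =>
    rw [map_add, hx, hy]
    exact (smul_add (M := Γ(Y, D)) (A := Γ(F, D) ⊗[A] M) _ _ _).symm
  | tmul x y => rfl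

/-- Tensoring with an `A`-module commutes with localization. -/
lemma exists_pow_of_resA_rTensor_eq_zero {D : Y.Opens} (hF : LocalizesOn F D) (g : Γ(Y, D)) :
    (∀ t : (toSheafModule f F).obj.obj (op D) ⊗[A] M,
      (resA (toSheafModule f F) (Y.basicOpen_le g)).rTensor M t = 0 →
      ∃ k : ℕ, (mulA f F D (g ^ k)).rTensor M t = 0) := by
  let := moduleA f F D
  let := moduleA f F (Y.basicOpen g)
  let := moduleRes F (Y.basicOpen_le g)
  let : Algebra A Γ(Y, D) := (algA f D).toAlgebra
  have : IsScalarTower A Γ(Y, D) Γ(F, D) := .of_algebraMap_smul fun _ _ ↦ rfl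
  have : IsScalarTower A Γ(Y, D) Γ(F, Y.basicOpen g) :=
    .of_algebraMap_smul fun a n ↦ congrArg (· • n) (resO_algA f (Y.basicOpen_le g) a)
  have := hF.isLocalizedModule g
  have h : IsLocalizedModule (.powers g)
    (AlgebraTensorModule.rTensor A M (resL F (Y.basicOpen_le g))) := inferInstance
  intro t ht
  obtain ⟨⟨_, k, rfl⟩, hk⟩ := (IsLocalizedModule.eq_zero_iff (.powers g)
    (AlgebraTensorModule.rTensor A M (resL F (Y.basicOpen_le g))) (m := t)).1 ht
  refine ⟨k, Eq.trans ?_ hk⟩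
  exact rTensor_mulA f M D (g ^ k) t

/-- Restriction of sections as a map of modules over the functions on a larger open set. -/
def resL₂ {X : Scheme.{0}} (M : X.Modules) {V W W' : X.Opens} (h : W ≤ V) (h' : W' ≤ W) :
    letI := moduleRes M h
    letI := moduleRes M (h'.trans h)
    Γ(M, W) →ₗ[Γ(X, V)] Γ(M, W') :=
  letI := moduleRes M h
  letI := moduleRes M (h'.trans h)
  { __ := resM M h'
    map_smul' := fun b m ↦ (resM_smul M h' _ m).trans (congrArg (· • _) (resO_resO h h' b)) }

lemma exists_cover_of_locally {D : Y.Opens} (hD : IsAffineOpen D) {P : Γ(Y, D) → Prop}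
    (h : ∀ x ∈ D, ∃ g : Γ(Y, D), x ∈ Y.basicOpen g ∧ P g) :
    ∃ (n : ℕ) (g : Fin n → Γ(Y, D)), (∀ i, P (g i)) ∧ Ideal.span (Set.range g) = ⊤ := by
  have h1 : Ideal.span {g | P g} = ⊤ := by
    rw [← hD.iSup_basicOpen_eq_self_iff]
    refine le_antisymm (iSup_le fun f ↦ Y.basicOpen_le _) fun x hx ↦ ?_
    obtain ⟨g, hxg, hg⟩ := h x hx
    exact Opens.mem_iSup.2 ⟨⟨g, hg⟩, hxg⟩
  obtain ⟨s, hs, hs'⟩ := (Ideal.span_eq_top_iff_finite _).1 h1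
  refine ⟨s.card, fun i ↦ (s.equivFin.symm i).1, fun i ↦ hs (s.equivFin.symm i).2, ?_⟩
  have : Set.range (fun i ↦ (s.equivFin.symm i).1) = s := by
    rw [Set.range_comp' Subtype.val s.equivFin.symm, s.equivFin.symm.range_eq_univ]
    simp
  rw [this, hs']

/-- A tensor that is locally killed by powers of functions that generate the unit ideal is zero. -/
lemma eq_zero_of_forall_pow {D : Y.Opens} (hD : IsAffineOpen D)
    (t : (toSheafModule f F).obj.obj (op D) ⊗[A] M)
    (h : ∀ x ∈ D, ∃ g : Γ(Y, D), x ∈ Y.basicOpen g ∧ ∃ k, (mulA f F D (g ^ k)).rTensor M t = 0) :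
    t = 0 := by
  let I : Ideal Γ(Y, D) :=
    { carrier := {b | (mulA f F D b).rTensor M t = 0}
      add_mem' := fun {b c} hb hc ↦ by
        simp only [Set.mem_ofPred_eq, map_add, LinearMap.rTensor_add, LinearMap.add_apply] at *
        rw [hb, hc, add_zero]
      zero_mem' := by simp
      smul_mem' := fun c b hb ↦ by
        simp only [Set.mem_ofPred_eq, smul_eq_mul, map_mul, Module.End.mul_eq_comp,
          LinearMap.rTensor_comp, LinearMap.comp_apply] at *
        rw [hb, map_zero] }
  obtain ⟨n, g, hg, hspan⟩ := exists_cover_of_locally hD h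
  choose k hk using hg
  -- the annihilator of `t` contains powers of functions that generate the unit ideal
  have : I = ⊤ := by
    rw [← Ideal.radical_eq_top, ← top_le_iff, ← hspan, Ideal.span_le]
    rintro _ ⟨i, rfl⟩
    exact ⟨k i, hk i⟩
  have h1 : (1 : Γ(Y, D)) ∈ I := by rw [this]; trivial
  change (mulA f F D 1).rTensor M t = 0 at h1
  rw [map_one] at h1
  have h2 : LinearMap.rTensor M (1 : Module.End A ((toSheafModule f F).obj.obj (op D))) =
    LinearMap.id := LinearMap.rTensor_id _ _
  rwa [h2] at h1

variable (hF : ∀ D : Y.Opens, IsAffineOpen D → LocalizesOn F D)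
include hF

lemma toTensor_injective_of_isAffineOpen {D : Y.Opens} (hD : IsAffineOpen D) :
    Function.Injective (toTensor (toSheafModule f F) M D) := by
  rw [← LinearMap.ker_eq_bot, LinearMap.ker_eq_bot']
  intro t ht
  refine eq_zero_of_forall_pow f M hD t fun x hx ↦ ?_
  obtain ⟨W, hWD, hxW, hW⟩ := locally_eq_zero_of_toTensor _ t ht x hx
  obtain ⟨g, hg, hxg⟩ := hD.exists_basicOpen_le ⟨x, hxW⟩ hx
  refine ⟨g, hxg, exists_pow_of_resA_rTensor_eq_zero f M (hF D hD) g t ?_⟩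
  have := congr((resA (toSheafModule f F) hg).rTensor M $hW)
  rw [map_zero, ← LinearMap.comp_apply, ← LinearMap.rTensor_comp] at this
  exact Eq.trans (congrArg (fun l ↦ LinearMap.rTensor M l t)
    (LinearMap.ext fun s ↦ (resA_resA hWD hg s).symm)) this

/-- A flat sheaf has flat sections over affine open sets. -/
lemma flat_of_isFlatSheaf (hflat : IsFlatSheaf (toSheafModule f F)) {D : Y.Opens}
    (hD : IsAffineOpen D) : Module.Flat A ((toSheafModule f F).obj.obj (op D)) := by
  let G := toSheafModule f F
  rw [Module.Flat.iff_lTensor_injective']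
  intro I
  rw [← LinearMap.ker_eq_bot, LinearMap.ker_eq_bot']
  intro t ht
  refine eq_zero_of_forall_pow f I hD t fun x hx ↦ ?_
  have h0 : (germA G D x hx).rTensor I t = 0 := by
    have := hflat x
    refine Module.Flat.lTensor_preserves_injective_linearMap
      (M := TopCat.Presheaf.stalk (C := ModuleCat.{0} A) G.obj x) I.subtype I.injective_subtype ?_
    rw [map_zero, ← LinearMap.comp_apply, LinearMap.lTensor_comp_rTensor,
      ← LinearMap.rTensor_comp_lTensor, LinearMap.comp_apply]
    exact (congrArg _ ht).trans (map_zero _)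
  obtain ⟨W, hWD, hxW, hW⟩ := exists_res_eq_zero_of_germ_tensor G I x hx t h0
  obtain ⟨g, hg, hxg⟩ := hD.exists_basicOpen_le ⟨x, hxW⟩ hx
  refine ⟨g, hxg, exists_pow_of_resA_rTensor_eq_zero f I (hF D hD) g t ?_⟩
  have := congr((resA (toSheafModule f F) hg).rTensor I $hW)
  rw [map_zero, ← LinearMap.comp_apply, ← LinearMap.rTensor_comp] at this
  exact Eq.trans (congrArg (fun l ↦ LinearMap.rTensor I l t)
    (LinearMap.ext fun s ↦ (resA_resA hWD hg s).symm)) this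

/-- Sections of the sheaf `F ⊗ M` over an affine open set `D` come from `F(D) ⊗ M`: they do so on
basic open sets, and the tensors found there glue by `exists_glue_of_span`. -/
lemma toTensor_surjective_of_isAffineOpen {D : Y.Opens} (hD : IsAffineOpen D) :
    Function.Surjective (toTensor (toSheafModule f F) M D) := by
  intro s
  have key : ∀ x ∈ D, ∃ g : Γ(Y, D), x ∈ Y.basicOpen g ∧
      ∃ t, toTensor (toSheafModule f F) M (Y.basicOpen g) t = resA _ (Y.basicOpen_le g) s := by
    intro x hx
    obtain ⟨W, hWD, hxW, t, ht⟩ := exists_locally_toTensor _ s x hx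
    obtain ⟨g, hg, hxg⟩ := hD.exists_basicOpen_le ⟨x, hxW⟩ hx
    refine ⟨g, hxg, (resA (toSheafModule f F) hg).rTensor M t, ?_⟩
    rw [← resA_toTensor, ht, resA_resA]
  obtain ⟨n, g, hg, hspan⟩ := exists_cover_of_locally hD key
  choose t ht using hg
  let mD := moduleA f F D
  let m1 (i : Fin n) := moduleA f F (Y.basicOpen (g i))
  let m2 (i j : Fin n) := moduleA f F (Y.basicOpen (g i) ⊓ Y.basicOpen (g j))
  have h2 (i j : Fin n) : Y.basicOpen (g i) ⊓ Y.basicOpen (g j) ≤ D :=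
    inf_le_left.trans (Y.basicOpen_le (g i))
  let r1 (i : Fin n) := moduleRes F (Y.basicOpen_le (g i))
  let r2 (i j : Fin n) := moduleRes F (h2 i j)
  let alg : Algebra A Γ(Y, D) := (algA f D).toAlgebra
  have tD : IsScalarTower A Γ(Y, D) Γ(F, D) := .of_algebraMap_smul fun _ _ ↦ rfl
  have t1 (i : Fin n) : IsScalarTower A Γ(Y, D) Γ(F, Y.basicOpen (g i)) :=
    .of_algebraMap_smul fun a n ↦ congrArg (· • n) (resO_algA f (Y.basicOpen_le (g i)) a)
  have t2 (i j : Fin n) : IsScalarTower A Γ(Y, D) Γ(F, Y.basicOpen (g i) ⊓ Y.basicOpen (g j)) :=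
    .of_algebraMap_smul fun a n ↦ congrArg (· • n) (resO_algA f (h2 i j) a)
  have hl (i : Fin n) := (hF D hD).isLocalizedModule (g i)
  obtain ⟨u, hu⟩ := exists_glue_of_span g hspan (N := Γ(F, D) ⊗[A] M)
    (N₁ := fun i ↦ Γ(F, Y.basicOpen (g i)) ⊗[A] M)
    (N₂ := fun i j ↦ Γ(F, Y.basicOpen (g i) ⊓ Y.basicOpen (g j)) ⊗[A] M)
    (fun i ↦ AlgebraTensorModule.rTensor A M (resL F (Y.basicOpen_le (g i))))
    (fun i j ↦ AlgebraTensorModule.rTensor A M (resL₂ F (Y.basicOpen_le (g i)) inf_le_left))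
    (fun i j ↦ AlgebraTensorModule.rTensor A M (resL₂ F (Y.basicOpen_le (g j)) inf_le_right))
    (fun i j t ↦ by
      induction t with
      | zero => simp only [map_zero]
      | add x y hx hy => simp only [map_add, hx, hy]
      | tmul x y =>
        exact congrArg (· ⊗ₜ[A] y) ((resM_resM F _ _ x).trans (resM_resM F _ _ x).symm))
    (fun i ↦ inferInstance) (fun i j t ht ↦ by
      have hij : Y.basicOpen (g i * g j) ≤ Y.basicOpen (g i) ⊓ Y.basicOpen (g j) :=
        (Y.basicOpen_mul _ _).le
      obtain ⟨m, hm⟩ := exists_pow_of_resA_rTensor_eq_zero f M (hF D hD) (g i * g j) t (by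
        have h3 := congr((resA (toSheafModule f F) hij).rTensor M $ht)
        refine Eq.trans ?_ (h3.trans (map_zero ((resA (toSheafModule f F) hij).rTensor M)))
        clear h3 ht
        induction t with
        | zero =>
          simp only [map_zero]
          exact (map_zero ((resA (toSheafModule f F) hij).rTensor M)).symm
        | add x y hx hy =>
          simp only [map_add]
          refine Eq.trans ?_ (map_add ((resA (toSheafModule f F) hij).rTensor M) _ _).symm
          rw [← hx, ← hy]
          exact map_add ((resA (toSheafModule f F) _).rTensor M) _ _
        | tmul x y =>
          exact congrArg (· ⊗ₜ[A] y) ((resM_resM F (h2 i j) hij x).symm.trans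
            (congrArg (resM F hij) (resM_resM F _ _ x).symm)))
      exact ⟨m, (rTensor_mulA f M D _ t).symm.trans hm⟩) t (fun i j ↦ by
      have haff : IsAffineOpen (Y.basicOpen (g i) ⊓ Y.basicOpen (g j)) := by
        rw [← Y.basicOpen_mul]
        exact hD.basicOpen _
      refine toTensor_injective_of_isAffineOpen f M hF haff ?_
      refine (resA_toTensor (toSheafModule f F) inf_le_left (t i)).symm.trans ?_
      refine Eq.trans ?_ (resA_toTensor (toSheafModule f F) inf_le_right (t j))
      rw [ht, ht, resA_resA, resA_resA])
  refine ⟨u, ?_⟩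
  refine eq_of_locally_eqA _ _ fun x hx ↦ ?_
  rw [← (hD.iSup_basicOpen_eq_self_iff (s := Set.range g)).2 hspan] at hx
  obtain ⟨⟨_, i, rfl⟩, hxi⟩ := Opens.mem_iSup.1 hx
  refine ⟨Y.basicOpen (g i), Y.basicOpen_le (g i), hxi, ?_⟩
  rw [← ht]
  refine (resA_toTensor (toSheafModule f F) (Y.basicOpen_le (g i)) u).trans ?_
  exact congrArg _ (hu i)

/-- Over the affine open sets, sections of a flat quasi-coherent sheaf commute with tensor
products. -/
lemma isTensorBasis_affineOpens (hflat : IsFlatSheaf (toSheafModule f F)) :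
    IsTensorBasis (toSheafModule f F) Y.affineOpens where
  isBasis := Y.isBasis_affineOpens
  bijective _ hV M _ _ _ := ⟨toTensor_injective_of_isAffineOpen f M hF hV,
    toTensor_surjective_of_isAffineOpen f M hF hV⟩
  flat _ hV := flat_of_isFlatSheaf f hF hflat hV

end SheafModule

/-! ### Vanishing of first cohomology outside a closed subset of depth three -/

section AffineCech

open Opposite

variable {X : Scheme.{0}} {M : X.Modules} {V : X.Opens}

/-- Every prime ideal of `Γ(X, V)` belongs to a point of `V`. -/
lemma IsAffineOpen.exists_primeIdealOf_eq (hV : IsAffineOpen V) (p : Ideal Γ(X, V))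
    (hp : p.IsPrime) : ∃ x : V, (hV.primeIdealOf x).asIdeal = p ∧
      ∀ f, f ∈ p ↔ x.1 ∉ X.basicOpen f := by
  let y : Spec Γ(X, V) := ⟨p, hp⟩
  have hy : hV.fromSpec y ∈ V := by
    rw [← SetLike.mem_coe, ← hV.range_fromSpec]
    exact ⟨y, rfl⟩
  refine ⟨⟨_, hy⟩, ?_, fun f ↦ ?_⟩
  · have : hV.primeIdealOf ⟨_, hy⟩ = y :=
      hV.fromSpec.isOpenEmbedding.injective (hV.fromSpec_primeIdealOf _)
    rw [this]
  · have : y ∈ hV.fromSpec ⁻¹ᵁ X.basicOpen f ↔ f ∉ p := by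
      rw [hV.fromSpec_preimage_basicOpen]; rfl
    exact not_not.symm.trans (not_congr this.symm)

/-- A property of the points of `V` outside an open set holds for the primes that contain the
elements of a cover of this open set by basic open sets. -/
lemma IsAffineOpen.forall_prime_of_cover (hV : IsAffineOpen V) (O : X.Opens)
    {P : Ideal Γ(X, V) → Prop} (hP : ∀ x : V, x.1 ∉ O → P (hV.primeIdealOf x).asIdeal)
    {ι : Type*} {f : ι → Γ(X, V)} (hf : V ⊓ O ≤ ⨆ i, X.basicOpen (f i)) (p : Ideal Γ(X, V))
    (hp : p.IsPrime) (hfp : ∀ i, f i ∈ p) : P p := by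
  obtain ⟨x, rfl, h⟩ := IsAffineOpen.exists_primeIdealOf_eq hV p hp
  refine hP x fun hx ↦ ?_
  obtain ⟨i, hi⟩ := Opens.mem_iSup.1 (hf ⟨x.2, hx⟩)
  exact (h _).1 (hfp i) hi

lemma IsAffineOpen.exists_finite_cover (hV : IsAffineOpen V) {O : X.Opens} (hOV : O ≤ V)
    (hO : IsCompact (O : Set X)) {P : Γ(X, V) → Prop}
    (h : ∀ x ∈ O, ∃ W : X.Opens, x ∈ W ∧ ∀ f : Γ(X, V), X.basicOpen f ≤ W → P f) :
    ∃ (n : ℕ) (f : Fin n → Γ(X, V)), (∀ i, P (f i)) ∧ (∀ i, X.basicOpen (f i) ≤ O) ∧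
      O ≤ ⨆ i, X.basicOpen (f i) := by
  have key (x : O) : ∃ f : Γ(X, V), P f ∧ X.basicOpen f ≤ O ∧ x.1 ∈ X.basicOpen f := by
    obtain ⟨W, hxW, hW⟩ := h x x.2
    obtain ⟨f, hf, hxf⟩ := hV.exists_basicOpen_le (V := O ⊓ W) ⟨x, x.2, hxW⟩ (hOV x.2)
    exact ⟨f, hW f (hf.trans inf_le_right), hf.trans inf_le_left, hxf⟩
  choose f hP hfO hxf using key
  obtain ⟨t, ht⟩ := hO.elim_finite_subcover (fun x : O ↦ (X.basicOpen (f x) : Set X))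
    (fun x ↦ (X.basicOpen (f x)).isOpen) (fun x hx' ↦ Set.mem_iUnion.2 ⟨⟨x, hx'⟩, hxf ⟨x, hx'⟩⟩)
  refine ⟨t.card, fun i ↦ f (t.equivFin.symm i).1, fun i ↦ hP _, fun i ↦ hfO _, fun x hx' ↦ ?_⟩
  obtain ⟨y, hy, hxy⟩ := Set.mem_iUnion₂.1 (ht hx')
  exact Opens.mem_iSup.2 ⟨t.equivFin ⟨y, hy⟩, by simpa using hxy⟩

/-- A section over `D(g) ∩ D(f)` extends to `D(g)` after multiplication by a power of `f`. -/
lemma LocalizesOn.ext_inf (hM : LocalizesOn M V) (g f : Γ(X, V)) {W W' : X.Opens}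
    (hW : W = X.basicOpen g) (hW' : W' = W ⊓ X.basicOpen f) (hV : W' ≤ V) (hWW : W' ≤ W)
    (s : Γ(M, W')) : ∃ (k : ℕ) (t : Γ(M, W)), resM M hWW t = resO X hV (f ^ k) • s := by
  subst hW
  rw [← X.basicOpen_mul] at hW'
  subst hW'
  simp only [map_pow]
  obtain ⟨k, n, hn⟩ := hM.ext (g * f) s
  obtain ⟨u, hu⟩ := (isUnit_resO g le_rfl).pow k
  refine ⟨k, (↑u⁻¹ : Γ(X, X.basicOpen g)) • resM M (X.basicOpen_le g) n, ?_⟩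
  have hu' : resO X hWW (↑u⁻¹ : Γ(X, X.basicOpen g)) * resO X hV g ^ k = 1 := by
    rw [← resO_resO (X.basicOpen_le g) hWW g, ← map_pow, ← hu, ← map_mul, Units.inv_mul, map_one]
  rw [resM_smul, resM_resM, hn, map_mul, mul_pow, smul_smul, ← mul_assoc, hu', one_mul]

/-- A section over `D(g)` that vanishes on `D(g) ∩ D(f)` is killed by a power of `f`. -/
lemma LocalizesOn.inj_inf (hM : LocalizesOn M V) (g f : Γ(X, V)) {W W' : X.Opens}
    (hW : W = X.basicOpen g) (hW' : W' = W ⊓ X.basicOpen f) (hV : W ≤ V) (hWW : W' ≤ W)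
    (n : Γ(M, W)) (hn : resM M hWW n = 0) : ∃ k : ℕ, resO X hV (f ^ k) • n = 0 := by
  subst hW
  rw [← X.basicOpen_mul] at hW'
  subst hW'
  simp only [map_pow]
  obtain ⟨k, n', hn'⟩ := hM.ext g n
  obtain ⟨m, hm⟩ := hM.inj (g * f) n' (by
    rw [← resM_resM M (X.basicOpen_le g) hWW, hn', resM_smul, hn, smul_zero])
  refine ⟨m, ?_⟩
  have hu := ((isUnit_resO g le_rfl).pow k).mul ((isUnit_resO g le_rfl).pow m)
  refine (hu.smul_eq_zero).1 ?_
  have := congr(resM M hV $hm)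
  rw [resM_smul, hn', map_zero, map_pow, map_mul, mul_pow] at this
  rw [← this, smul_smul, smul_smul]
  congr 1
  ring

/-- A sheaf with the same sections as `M` has no first cohomology over the part of an affine open
set `V` in `O`, if `M` has depth at least three at the points of `V` outside `O`. -/
theorem h1Vanishes_of_hasRegularTriple {A : Type} [CommRing A] {Y : TopCat.{0}}
    {H : TopCat.Sheaf (ModuleCat.{0} A) Y} {j : Y ⟶ (X : TopCat)}
    (hj : Topology.IsOpenEmbedding j)
    (θ : ∀ W : X.Opens, H.obj.obj (op ((Opens.map j).obj W)) ≃+ Γ(M, W))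
    (hθ : ∀ (W W' : X.Opens) (h : W' ≤ W) (s : H.obj.obj (op ((Opens.map j).obj W))),
      θ W' (resA H (fun _ hx ↦ h hx) s) = resM M h (θ W s))
    (hV : IsAffineOpen V) [IsNoetherianRing Γ(X, V)]
    (hc : ∀ O : X.Opens, O ≤ V → IsCompact (O : Set X)) (hM : LocalizesOn M V)
    (hreg : ∀ x : V, x.1 ∉ Set.range j →
      HasRegularTriple (hV.primeIdealOf x).asIdeal Γ(M, V)) :
    H1Vanishes ((Opens.map j).obj V) H := by
  intro I Q a b w hS s
  have := hS.epi_g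
  have hmono : Mono a := hS.mono_f
  -- local lifts `t i` of the section `s` over a finite cover of `V ∩ O` by basic open sets
  let O : X.Opens := V ⊓ ⟨Set.range j, hj.isOpen_range⟩
  let J (W : X.Opens) : Opens Y := (Opens.map j).obj W
  have hJ {W W' : X.Opens} (h : W ≤ W') : J W ≤ J W' := fun _ hx ↦ h hx
  obtain ⟨n, f, hf, hfO, hO⟩ := IsAffineOpen.exists_finite_cover hV (O := O) inf_le_left
    (hc _ inf_le_left) (P := fun f ↦ ∃ t, appA b (J (X.basicOpen f)) t =
      resA Q (hJ (X.basicOpen_le f)) s) (by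
    rintro _ ⟨hx, y, rfl⟩
    obtain ⟨W, hWV, hxW, t, ht⟩ := exists_locally_lift b s y hx
    refine ⟨⟨j '' W, hj.isOpenMap _ W.isOpen⟩, ⟨y, hxW, rfl⟩, fun f hf ↦ ?_⟩
    have hfW : J (X.basicOpen f) ≤ W := by
      intro z hz
      obtain ⟨z', hz', h⟩ := hf hz
      rwa [← hj.injective h]
    exact ⟨resA I hfW t, by rw [appA_resA, ht, resA_resA]⟩)
  choose t ht using hf
  let D (i : Fin n) := X.basicOpen (f i)
  have hD (i : Fin n) : D i ≤ V := X.basicOpen_le (f i)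
  have hJc : J V ≤ ⨆ i, J (D i) := by
    intro y hy
    obtain ⟨i, hi⟩ := Opens.mem_iSup.1 (hO ⟨hy, y, rfl⟩)
    exact Opens.mem_iSup.2 ⟨i, hi⟩
  have h2 (i k : Fin n) : D i ⊓ D k ≤ V := inf_le_left.trans (hD i)
  have h3 (i k l : Fin n) : D i ⊓ D k ⊓ D l ≤ V := inf_le_left.trans (h2 i k)
  -- the differences of the local lifts define a Čech cocycle `g` with values in `M`
  have ex (i k : Fin n) : ∃ g : Γ(M, D i ⊓ D k),
      appA a (J (D i ⊓ D k)) ((θ _).symm g) =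
        resA I (hJ inf_le_left) (t i) - resA I (hJ inf_le_right) (t k) := by
    obtain ⟨u, hu⟩ := exists_lift_of_exact w hS.exact (V := J (D i ⊓ D k))
      (resA I (hJ inf_le_left) (t i) - resA I (hJ inf_le_right) (t k)) (by
      rw [map_sub, appA_resA, appA_resA, ht, ht, resA_resA, resA_resA, sub_self])
    exact ⟨θ _ u, by rw [AddEquiv.symm_apply_apply, hu]⟩
  choose g hg using ex
  have hθ' {W W' : X.Opens} (h : W' ≤ W) (m : Γ(M, W)) :
      (θ W').symm (resM M h m) = resA H (hJ h) ((θ W).symm m) := by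
    rw [AddEquiv.symm_apply_eq]
    exact ((hθ _ _ h _).trans (congrArg _ ((θ W).apply_symm_apply m))).symm
  let r1 (i : Fin n) := moduleRes M (hD i)
  let r2 (i j : Fin n) := moduleRes M (h2 i j)
  let r3 (i j k : Fin n) := moduleRes M (h3 i j k)
  have hloc₂ (i k : Fin n) :
      IsLocalizedModule.Away (f i * f k) (resL₂ M (hD i) inf_le_left ∘ₗ resL M (hD i) :
        Γ(M, V) →ₗ[Γ(X, V)] Γ(M, D i ⊓ D k)) := by
    have h1 := hM.isLocalizedModule (f i * f k)
    have key : ∀ (W : X.Opens) (hW : W = X.basicOpen (f i * f k)) (hWV : W ≤ V),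
        letI := moduleRes M hWV
        IsLocalizedModule.Away (f i * f k) (resL M hWV) := by
      rintro _ rfl _
      exact h1
    convert! key (D i ⊓ D k) (X.basicOpen_mul _ _).symm (h2 i k) using 1
    ext m
    exact resM_resM M (hD i) inf_le_left m
  have inj (m : Γ(M, V)) (hm : ∀ i, resL M (hD i) m = 0) : m = 0 := by
    refine (θ V).symm.injective ?_
    rw [map_zero]
    refine eq_of_locally_eqA _ _ fun y hy ↦ ?_
    obtain ⟨i, hi⟩ := Opens.mem_iSup.1 (hJc hy)
    refine ⟨J (D i), hJ (hD i), hi, ?_⟩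
    rw [← hθ' (hD i), map_zero]
    exact (congrArg _ (hm i)).trans (map_zero _)
  have glue (h : ∀ i, Γ(M, D i)) (hh : ∀ i k, resM M inf_le_left (h i) =
      (resM M inf_le_right (h k) : Γ(M, D i ⊓ D k))) : ∃ m : Γ(M, V), ∀ i, resM M (hD i) m = h i := by
    obtain ⟨m, hm⟩ := exists_glueA (G := H) (fun i ↦ J (D i)) (fun i ↦ hJ (hD i)) hJc
      (fun i ↦ (θ _).symm (h i)) fun i k ↦ by
        have := congr((θ _).symm $(hh i k))
        rw [hθ', hθ'] at this
        exact this
    exact ⟨θ V m, fun i ↦ by rw [← hθ, hm, AddEquiv.apply_symm_apply]⟩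
  obtain ⟨h, hh⟩ := cech_coboundary f
    (a := fun i ↦ resL M (hD i)) (l := fun i k ↦ resL₂ M (hD i) (inf_le_left : D i ⊓ D k ≤ D i))
    (r := fun i k ↦ resL₂ M (hD k) (inf_le_right : D i ⊓ D k ≤ D k))
    (N₃ := fun i k l ↦ Γ(M, D i ⊓ D k ⊓ D l))
    (fun i k l ↦ resL₂ M (h2 i k) inf_le_left)
    (fun i k l ↦ resL₂ M (h2 i l) (le_inf (inf_le_left.trans inf_le_left) inf_le_right))
    (fun i k l ↦ resL₂ M (h2 k l) (le_inf (inf_le_left.trans inf_le_right) inf_le_right))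
    (fun i k m ↦ (resM_resM M _ _ m).trans (resM_resM M _ _ m).symm)
    (fun i k l m ↦ (resM_resM M _ _ m).trans (resM_resM M _ _ m).symm)
    (fun i k l m ↦ (resM_resM M _ _ m).trans (resM_resM M _ _ m).symm)
    inj glue (fun i ↦ hM.isLocalizedModule (f i)) hloc₂
    (fun i k m ↦ by
      obtain ⟨e, u, hu⟩ := hM.ext_inf (f i) (f k) rfl rfl (h2 i k) inf_le_left m
      exact ⟨e, u, hu.symm⟩)
    (fun i k l m hm ↦ hM.inj_inf (f i * f k) (f l) (X.basicOpen_mul _ _).symm rfl _ inf_le_left m hm)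
    (IsAffineOpen.forall_prime_of_cover hV ⟨Set.range j, hj.isOpen_range⟩
      (P := fun p ↦ HasRegularTriple p Γ(M, V)) (fun x hx ↦ hreg x hx) hO) g
    (fun i k l ↦ by
      have hle : D i ⊓ D k ⊓ D l ≤ D i ⊓ D l :=
        le_inf (inf_le_left.trans inf_le_left) inf_le_right
      have hle' : D i ⊓ D k ⊓ D l ≤ D k ⊓ D l :=
        le_inf (inf_le_left.trans inf_le_right) inf_le_right
      refine (θ _).symm.injective (appA_injective a _ ?_)
      change appA a _ ((θ _).symm (resM M hle (g i l))) = appA a _ ((θ _).symm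
        (resM M inf_le_left (g i k) + resM M hle' (g k l)))
      rw [map_add, map_add, hθ', hθ', hθ', appA_resA, appA_resA, appA_resA, hg, hg, hg, map_sub,
        map_sub, map_sub, resA_resA, resA_resA, resA_resA, resA_resA, resA_resA, resA_resA,
        sub_add_sub_cancel])
  -- the local lifts, corrected by the cochain `h` with coboundary `g`, glue
  obtain ⟨v, hv⟩ := exists_glueA (G := I) (fun i ↦ J (D i)) (fun i ↦ hJ (hD i)) hJc
    (fun i ↦ t i - appA a _ ((θ _).symm (h i))) fun i k ↦ by
      have h4 := hg i k
      rw [hh i k] at h4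
      change appA a _ ((θ _).symm (resM M inf_le_left (h i) - resM M inf_le_right (h k))) = _ at h4
      rw [map_sub, map_sub, hθ', hθ', appA_resA, appA_resA, sub_eq_sub_iff_add_eq_add] at h4
      rw [map_sub, map_sub]
      refine sub_eq_sub_iff_add_eq_add.2 (h4.symm.trans (add_comm _ _))
  refine ⟨v, eq_of_locally_eqA _ _ fun y hy ↦ ?_⟩
  obtain ⟨i, hi⟩ := Opens.mem_iSup.1 (hJc hy)
  refine ⟨J (D i), hJ (hD i), hi, ?_⟩
  rw [← appA_resA, hv, map_sub, ht, ← appA_comp, w]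
  exact sub_zero _

end AffineCech

/-! ### Depth of stalks -/

section Stalks

open Opposite

variable {X : Scheme.{0}} (M : X.Modules) {V : X.Opens}

/-- The stalk of a module as a module over the functions on an open neighbourhood. -/
abbrev moduleStalk {x : X} (hx : x ∈ V) : Module Γ(X, V) (M.presheaf.stalk x) :=
  Module.compHom _ (X.presheaf.germ V x hx).hom

/-- The germ of a section at a point. -/
def germM {x : X} (hx : x ∈ V) : Γ(M, V) →+ M.presheaf.stalk x := (M.presheaf.germ V x hx).hom

lemma germM_smul {x : X} (hx : x ∈ V) (r : Γ(X, V)) (m : Γ(M, V)) :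
    germM M hx (r • m) = X.presheaf.germ V x hx r • germM M hx m :=
  PresheafOfModules.germ_smul M.val x V hx r m

lemma germM_resM {x : X} {W : X.Opens} (h : W ≤ V) (hx : x ∈ W) (m : Γ(M, V)) :
    germM M hx (resM M h m) = germM M (h hx) m :=
  M.presheaf.germ_res_apply (homOfLE h) x hx m

lemma exists_germM_eq {x : X} (m : M.presheaf.stalk x) :
    ∃ (W : X.Opens) (hx : x ∈ W) (s : Γ(M, W)), germM M hx s = m :=
  M.presheaf.exists_germ_eq m

lemma exists_resM_eq_of_germM {x : X} {W : X.Opens} (hx : x ∈ V) (hx' : x ∈ W) (s : Γ(M, V))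
    (t : Γ(M, W)) (h : germM M hx s = germM M hx' t) :
    ∃ (W' : X.Opens) (h : W' ≤ V) (h' : W' ≤ W), x ∈ W' ∧ resM M h s = resM M h' t := by
  obtain ⟨W', hx, i, i', h⟩ := M.presheaf.germ_eq x hx hx' s t h
  exact ⟨W', leOfHom i, leOfHom i', hx, h⟩

variable {M}

/-- The stalk at a point of an affine open set `V` is the localization of the sections over `V`. -/
lemma LocalizesOn.isLocalizedModule_stalk (hM : LocalizesOn M V) (hV : IsAffineOpen V) (x : V) :
    letI := moduleStalk M x.2
    IsLocalizedModule (hV.primeIdealOf x).asIdeal.primeCompl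
      ({ germM M x.2 with map_smul' := germM_smul M x.2 } :
        Γ(M, V) →ₗ[Γ(X, V)] M.presheaf.stalk x.1) := by
  let := moduleStalk M x.2
  let := X.presheaf.algebra_section_stalk x
  have hloc := hV.isLocalization_stalk x
  have mem (f : Γ(X, V)) (hf : x.1 ∈ X.basicOpen f) :
      f ∈ (hV.primeIdealOf x).asIdeal.primeCompl := by
    refine (IsLocalization.AtPrime.isUnit_to_map_iff (X.presheaf.stalk x.1)
      (hV.primeIdealOf x).asIdeal f).1 ?_
    exact (X.mem_basicOpen f x.1 x.2).1 hf
  refine ⟨fun s ↦ ?_, fun m ↦ ?_, fun {a b} h ↦ ?_⟩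
  · have := IsLocalization.map_units (X.presheaf.stalk x.1) s
    rw [Module.End.isUnit_iff]
    have h := (Module.End.isUnit_iff _).1 (this.map (Module.toModuleEnd ℤ (M.presheaf.stalk x.1)))
    exact h
  · obtain ⟨W, hxW, s, rfl⟩ := exists_germM_eq M m
    obtain ⟨f, hf, hxf⟩ := hV.exists_basicOpen_le ⟨x.1, hxW⟩ x.2
    obtain ⟨k, n, hn⟩ := hM.ext f (resM M hf s)
    refine ⟨⟨n, ⟨f ^ k, pow_mem (mem f hxf) k⟩⟩, ?_⟩
    change X.presheaf.germ V x.1 x.2 (f ^ k) • germM M hxW s = germM M x.2 n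
    rw [← germM_resM M (X.basicOpen_le f) hxf, hn, germM_smul, germM_resM, ← map_pow]
    congr 1
    exact (X.presheaf.germ_res_apply (homOfLE (X.basicOpen_le f)) x.1 hxf (f ^ k)).symm
  · obtain ⟨W, h1, h2, hxW, hab⟩ := exists_resM_eq_of_germM M x.2 x.2 a b h
    obtain ⟨f, hf, hxf⟩ := hV.exists_basicOpen_le ⟨x.1, hxW⟩ x.2
    obtain ⟨k, hk⟩ := hM.inj f (a - b) (by
      have := congr(resM M hf $hab)
      rw [resM_resM, resM_resM] at this
      rw [map_sub, this, sub_self])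
    exact ⟨⟨f ^ k, pow_mem (mem f hxf) k⟩, by rwa [smul_sub, sub_eq_zero] at hk⟩

lemma LocalizesOn.hasRegularTriple (hM : LocalizesOn M V) (hV : IsAffineOpen V) (x : V)
    (h : 3 ≤ depth (X.presheaf.stalk x.1) (M.presheaf.stalk x.1)) :
    HasRegularTriple (hV.primeIdealOf x).asIdeal Γ(M, V) := by
  let := moduleStalk M x.2
  let := X.presheaf.algebra_section_stalk x
  have hloc := hV.isLocalization_stalk x
  have : IsScalarTower Γ(X, V) (X.presheaf.stalk x.1) (M.presheaf.stalk x.1) :=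
    .of_algebraMap_smul fun _ _ ↦ rfl
  have := hM.isLocalizedModule_stalk hV x
  exact hasRegularTriple_of_depth (hV.primeIdealOf x).asIdeal
    ({ germM M x.2 with map_smul' := germM_smul M x.2 } :
        Γ(M, V) →ₗ[Γ(X, V)] M.presheaf.stalk x.1) h

lemma hasRegularTriple_section (hV : IsAffineOpen V) (x : V)
    (h : 3 ≤ depth (X.presheaf.stalk x.1) (X.presheaf.stalk x.1)) :
    HasRegularTriple (hV.primeIdealOf x).asIdeal Γ(X, V) := by
  let := X.presheaf.algebra_section_stalk x
  have hloc := hV.isLocalization_stalk x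
  have : IsLocalizedModule (hV.primeIdealOf x).asIdeal.primeCompl
    (Algebra.linearMap Γ(X, V) (X.presheaf.stalk x.1)) := inferInstance
  exact hasRegularTriple_of_depth (hV.primeIdealOf x).asIdeal
    (Algebra.linearMap Γ(X, V) (X.presheaf.stalk x.1)) h

/-- Sections of a module extend uniquely over closed subsets along which the module has depth at
least two. -/
theorem resM_bijective_of_hasRegularPair (hV : IsAffineOpen V) [IsNoetherianRing Γ(X, V)]
    (hM : LocalizesOn M V) {O : X.Opens} (hO : O ≤ V) (hOc : IsCompact (O : Set X))
    (hreg : ∀ x : V, x.1 ∉ O → HasRegularPair (hV.primeIdealOf x).asIdeal Γ(M, V)) :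
    Function.Bijective (resM M hO) := by
  obtain ⟨n, f, -, hfO, hf⟩ := IsAffineOpen.exists_finite_cover hV hO hOc (P := fun _ ↦ True)
    fun x _ ↦ ⟨⊤, trivial, fun _ _ ↦ trivial⟩
  have hreg' := IsAffineOpen.forall_prime_of_cover hV O
      (P := fun p ↦ HasRegularPair p Γ(M, V)) (fun x hx ↦ hreg x hx) (inf_le_right.trans hf)
  let D (i : Fin n) := X.basicOpen (f i)
  have hD (i : Fin n) : D i ≤ V := X.basicOpen_le (f i)
  have h2 (i k : Fin n) : D i ⊓ D k ≤ V := inf_le_left.trans (hD i)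
  let r1 (i : Fin n) := moduleRes M (hD i)
  let r2 (i j : Fin n) := moduleRes M (h2 i j)
  constructor
  · rw [injective_iff_map_eq_zero]
    intro m hm
    refine eq_zero_of_localizations_of_regular f (a := fun i ↦ resL M (hD i))
      (fun i ↦ hM.isLocalizedModule (f i)) hreg' m fun i ↦ ?_
    change resM M (hD i) m = 0
    rw [← resM_resM M hO (hfO i), hm, map_zero]
  · intro s
    obtain ⟨m, hm⟩ := exists_glue_of_regular f
      (a := fun i ↦ resL M (hD i)) (l := fun i k ↦ resL₂ M (hD i) (inf_le_left : D i ⊓ D k ≤ D i))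
      (r := fun i k ↦ resL₂ M (hD k) (inf_le_right : D i ⊓ D k ≤ D k))
      (fun i k m ↦ (resM_resM M _ _ m).trans (resM_resM M _ _ m).symm)
      (fun i ↦ hM.isLocalizedModule (f i))
      (fun i k m hm ↦ hM.inj_inf (f i) (f k) rfl rfl _ inf_le_left m hm) hreg'
      (fun i ↦ resM M (hfO i) s) (fun i k ↦ (resM_resM M _ _ s).trans (resM_resM M _ _ s).symm)
    refine ⟨m, eq_of_coverM D hfO hf fun i ↦ ?_⟩
    rw [resM_resM]
    exact hm i

end Stalks

/-! ### Functions on a deformation -/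

section Fibre

open Opposite

lemma fromSpec_comp_eq_algA {A : Type} [CommRing A] {Y : Scheme.{0}} (f : Y ⟶ Spec (.of A))
    {V : Y.Opens} (hV : IsAffineOpen V) :
    hV.fromSpec ≫ f = Spec.map (CommRingCat.ofHom (algA f V)) := by
  have h := IsAffineOpen.SpecMap_appLE_fromSpec f (isAffineOpen_top (Spec (.of A))) hV le_top
  rw [← h, IsAffineOpen.fromSpec_top, Scheme.isoSpec_Spec_inv, ← Spec.map_comp]
  congr 1

lemma appLE_fromSpec {Y : Scheme.{0}} {V : Y.Opens} (hV : IsAffineOpen V) (h) :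
    hV.fromSpec.appLE V ⊤ h = (Scheme.ΓSpecIso Γ(Y, V)).inv := by
  rw [Scheme.Hom.appLE, hV.fromSpec_app_self, Category.assoc, ← Functor.map_comp]
  exact (congrArg _ (CategoryTheory.Functor.map_id _ _)).trans (Category.comp_id _)

variable {X : Scheme.{0}} {s : X ⟶ Spec (.of ℂ)}
  {A : Type} [CommRing A] [Algebra ℂ A] [ArtC A] (D : Deformation s A)

lemma Deformation.isClosedImmersion_incl : IsClosedImmersion D.incl :=
  MorphismProperty.of_isPullback D.isPullback.flip
    (IsClosedImmersion.spec_of_surjective _ (augmentation_surjective A))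

lemma Deformation.isAffineOpen_preimage {V : D.total.Opens} (hV : IsAffineOpen V) :
    IsAffineOpen (D.incl ⁻¹ᵁ V) :=
  have := D.isClosedImmersion_incl
  hV.preimage D.incl

lemma Deformation.app_surjective {V : D.total.Opens} (hV : IsAffineOpen V) :
    Function.Surjective (D.incl.app V) :=
  have := D.isClosedImmersion_incl
  D.incl.app_surjective V hV

lemma ker_augmentation : RingHom.ker (augmentation A) = IsLocalRing.maximalIdeal A := by
  refine (IsLocalRing.eq_maximalIdeal ?_)
  exact RingHom.ker_isMaximal_of_surjective _ (augmentation_surjective A)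

/-- The functions that vanish on the closed fibre are generated by the maximal ideal of `A`. -/
lemma Deformation.ker_app_le {V : D.total.Opens} (hV : IsAffineOpen V) :
    RingHom.ker (D.incl.app V).hom ≤ (IsLocalRing.maximalIdeal A).map (algA D.proj V) := by
  intro r hr
  let I := (IsLocalRing.maximalIdeal A).map (algA D.proj V)
  let Q := Γ(D.total, V) ⧸ I
  -- with `Q = Γ(V) / 𝔪 Γ(V)`, the morphism `Spec Q ⟶ V` factors through the closed fibre, by the
  -- universal property of the fibre product; so functions that vanish on the fibre vanish in `Q`
  let φ : ℂ →+* Q := RingHom.liftOfSurjective (augmentation A) (augmentation_surjective A)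
    ⟨(Ideal.Quotient.mk I).comp (algA D.proj V), fun a ha ↦ by
      rw [ker_augmentation] at ha
      exact Ideal.Quotient.eq_zero_iff_mem.2 (Ideal.mem_map_of_mem _ ha)⟩
  have hφ : φ.comp (augmentation A) = (Ideal.Quotient.mk I).comp (algA D.proj V) :=
    RingHom.liftOfRightInverse_comp _ _ _ _
  let m : Γ(D.total, V) ⟶ .of Q := CommRingCat.ofHom (Ideal.Quotient.mk I)
  let q : Spec (.of Q) ⟶ D.total := Spec.map m ≫ hV.fromSpec
  have hq : q ≫ D.proj = Spec.map (CommRingCat.ofHom φ) ≫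
      Spec.map (CommRingCat.ofHom (augmentation A)) := by
    rw [Category.assoc, fromSpec_comp_eq_algA, ← Spec.map_comp, ← Spec.map_comp]
    exact congrArg (fun g ↦ Spec.map (CommRingCat.ofHom g)) hφ.symm
  have hl : D.isPullback.lift q (Spec.map (CommRingCat.ofHom φ)) hq ≫ D.incl = q :=
    D.isPullback.lift_fst _ _ _
  have h0 : ((D.isPullback.lift q (Spec.map (CommRingCat.ofHom φ)) hq ≫ D.incl).app V) r = 0 := by
    rw [Scheme.Hom.comp_app]
    exact (congrArg ((D.isPullback.lift q (Spec.map (CommRingCat.ofHom φ)) hq).app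
      (D.incl ⁻¹ᵁ V)) hr).trans (map_zero _)
  rw [hl] at h0
  have htop : ⊤ ≤ hV.fromSpec ⁻¹ᵁ V := by rw [hV.fromSpec_preimage_self]
  have htop' : ⊤ ≤ q ⁻¹ᵁ V := fun x _ ↦ htop (Set.mem_univ (Spec.map m x))
  have h1 : q.appLE V ⊤ htop' r = 0 := by
    rw [Scheme.Hom.appLE, CommRingCat.comp_apply]
    exact (congrArg _ h0).trans (map_zero _)
  rw [← Scheme.Hom.appLE_comp_appLE (Spec.map m) hV.fromSpec V ⊤ ⊤ htop le_top,
    appLE_fromSpec hV] at h1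
  have h2 : (Scheme.ΓSpecIso Γ(D.total, V)).inv ≫ (Spec.map m).appLE ⊤ ⊤ le_top =
      m ≫ (Scheme.ΓSpecIso (.of Q)).inv := by
    rw [Scheme.ΓSpecIso_inv_naturality]
    congr 1
  rw [h2, CommRingCat.comp_apply] at h1
  have h3 : m r = 0 :=
    (ConcreteCategory.bijective_of_isIso (Scheme.ΓSpecIso (.of Q)).inv).1 (h1.trans (map_zero _).symm)
  exact Ideal.Quotient.eq_zero_iff_mem.1 h3

omit [Algebra ℂ A] [ArtC A] in
/-- Morphisms over `Spec A` are compatible with the action of `A` on functions. -/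
lemma app_algA_comp {Y Z : Scheme.{0}} (g : Z ⟶ Y) (f : Y ⟶ Spec (.of A)) (V : Y.Opens) (a : A) :
    g.app V (algA f V a) = algA (g ≫ f) (g ⁻¹ᵁ V) a := by
  have h := g.naturality (homOfLE (le_top : V ≤ ⊤)).op
  have h' := congr((CommRingCat.Hom.hom $h) ((Scheme.ΓSpecIso (.of A)).inv ≫ f.appTop |>.hom a))
  refine h'.trans ?_
  simp [algA, resO]
  rfl

lemma algA_augmentation_eq_zero {T : Scheme.{0}} (t : T ⟶ Spec (.of ℂ)) {a : A}
    (ha : a ∈ IsLocalRing.maximalIdeal A) (V : T.Opens) :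
    algA (t ≫ Spec.map (CommRingCat.ofHom (augmentation A))) V a = 0 := by
  have h1 : (Spec.map (CommRingCat.ofHom (augmentation A))).appTop
      ((Scheme.ΓSpecIso (.of A)).inv a) = 0 := by
    have h2 := Scheme.ΓSpecIso_inv_naturality (CommRingCat.ofHom (augmentation A))
    have h3 : augmentation A a = 0 := by
      rwa [← RingHom.mem_ker, ker_augmentation]
    have h4 := congr((CommRingCat.Hom.hom $h2) a)
    refine h4.symm.trans ?_
    change (Scheme.ΓSpecIso (.of ℂ)).inv (augmentation A a) = 0
    rw [h3, map_zero]
  have h5 : ((Scheme.ΓSpecIso (.of A)).inv ≫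
      (t ≫ Spec.map (CommRingCat.ofHom (augmentation A))).appTop) a = 0 := by
    rw [Scheme.Hom.comp_appTop]
    exact (congrArg t.appTop h1).trans (map_zero _)
  exact (congrArg (resO T le_top) h5).trans (map_zero _)

lemma Deformation.app_algA {a : A} (ha : a ∈ IsLocalRing.maximalIdeal A) (V : D.total.Opens) :
    D.incl.app V (algA D.proj V a) = 0 := by
  rw [app_algA_comp, D.isPullback.w]
  exact algA_augmentation_eq_zero s ha _

end Fibre

/-! ### Restriction to the closed fibre -/

section FibreModule

open Opposite TensorProduct

section Desc

variable {A : Type} [CommRing A] {Y : TopCat.{0}} (G H : TopCat.Sheaf (ModuleCat.{0} A) Y)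
  (M : Type) [AddCommGroup M] [Module A M]
  (t : ∀ V : Opens Y, G.obj.obj (op V) ⊗[A] M →ₗ[A] H.obj.obj (op V))
  (ht : ∀ {V W : Opens Y} (h : W ≤ V) (x : G.obj.obj (op V) ⊗[A] M),
    t W ((resA G h).rTensor M x) = resA H h (t V x))

/-- The morphism from the tensor product `G ⊗ M` given by maps on the sections of `G`. -/
def tensorDesc : tensor G (.of A M) ⟶ H :=
  ⟨sheafifyLift (Opens.grothendieckTopology Y)
    { app V := ModuleCat.ofHom (t V.unop)
      naturality V W h := by
        ext x
        exact ht (leOfHom h.unop) x } H.property⟩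

lemma appA_tensorDesc (V : Opens Y) (x) :
    appA (tensorDesc G H M t ht) V (toTensor G M V x) = t V x := by
  have := toSheafify_sheafifyLift (Opens.grothendieckTopology Y)
    (P := G.obj ⋙ MonoidalCategory.tensorRight (ModuleCat.of A M))
    { app V := ModuleCat.ofHom (t V.unop)
      naturality V W h := by
        ext x
        exact ht (leOfHom h.unop) x } H.property
  exact congr((($this).app (op V)).hom x)

variable {G H}

lemma isIso_of_bijective_on_basis (φ : G ⟶ H) {B : Set (Opens Y)} (hB : Opens.IsBasis B)
    (h : ∀ V ∈ B, Function.Bijective (appA φ V)) : IsIso φ := by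
  have h1 : Mono φ := by
    refine mono_of_appA_injective _ fun V ↦ ?_
    rw [← LinearMap.ker_eq_bot, LinearMap.ker_eq_bot']
    intro s hs
    refine eq_of_locally_eqA _ _ fun x hx ↦ ?_
    obtain ⟨W, hW, hxW, hWV⟩ := Opens.isBasis_iff_nbhd.1 hB hx
    refine ⟨W, hWV, hxW, (h W hW).1 ?_⟩
    rw [appA_resA, hs, map_zero, map_zero, map_zero]
  have h2 : Epi φ := by
    refine epi_of_locally_lift _ fun V s x hx ↦ ?_
    obtain ⟨W, hW, hxW, hWV⟩ := Opens.isBasis_iff_nbhd.1 hB hx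
    exact ⟨W, hWV, hxW, (h W hW).2 _⟩
  exact isIso_of_mono_of_epi _

end Desc

/-- The submodule of `Γ(F, V)` generated by the ideal `I Γ(Y, V)` is the one generated by `I`. -/
lemma mem_map_smul_top_iff {A : Type} [CommRing A] {Y : Scheme.{0}} (f : Y ⟶ Spec (.of A))
    (F : Y.Modules) (V : Y.Opens) (I : Ideal A) (n : Γ(F, V)) :
    n ∈ I.map (algA f V) • (⊤ : Submodule Γ(Y, V) Γ(F, V)) ↔
      (show (toSheafModule f F).obj.obj (op V) from n) ∈
        I • (⊤ : Submodule A ((toSheafModule f F).obj.obj (op V))) := by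
  constructor
  · intro h
    refine Submodule.smul_induction_on (p := fun n : Γ(F, V) ↦
      (show (toSheafModule f F).obj.obj (op V) from n) ∈
        I • (⊤ : Submodule A ((toSheafModule f F).obj.obj (op V)))) h ?_
      fun x y hx hy ↦ add_mem hx hy
    intro r hr m hm
    clear hm
    revert m
    refine Submodule.span_induction (p := fun r _ ↦ ∀ m : Γ(F, V),
      (show (toSheafModule f F).obj.obj (op V) from (r • m : Γ(F, V))) ∈
        I • (⊤ : Submodule A ((toSheafModule f F).obj.obj (op V)))) ?_ ?_ ?_ ?_ hr
    · rintro _ ⟨a, ha, rfl⟩ m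
      exact Submodule.smul_mem_smul (N := (⊤ : Submodule A ((toSheafModule f F).obj.obj (op V))))
        (n := m) ha trivial
    · intro m
      rw [zero_smul]
      exact zero_mem _
    · intro a b _ _ ha hb m
      rw [add_smul]
      exact add_mem (ha m) (hb m)
    · intro a b _ h m
      rw [smul_eq_mul, mul_comm, mul_smul]
      exact h _
  · intro h
    exact Submodule.smul_induction_on (p := fun n : (toSheafModule f F).obj.obj (op V) ↦
      (show Γ(F, V) from n) ∈ I.map (algA f V) • (⊤ : Submodule Γ(Y, V) Γ(F, V))) h
      (fun a ha m _ ↦ Submodule.smul_mem_smul (Ideal.mem_map_of_mem _ ha) trivial)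
      fun x y hx hy ↦ add_mem hx hy

/-- The structure sheaf as a module. -/
def structureModule (X : Scheme.{0}) : X.Modules := SheafOfModules.unit X.ringCatSheaf

/-- The comorphism of a morphism of schemes as a morphism of modules. -/
def structureModuleMap {X Y : Scheme.{0}} (i : X ⟶ Y) :
    structureModule Y ⟶ (Scheme.Modules.pushforward i).obj (structureModule X) :=
  SheafOfModules.unitToPushforwardObjUnit _

variable {X : Scheme.{0}} {s : X ⟶ Spec (.of ℂ)}
  {A : Type} [CommRing A] [Algebra ℂ A] [ArtC A] (D : Deformation s A)

/-- The data of a flat quasi-coherent module `F` on a deformation and of its restriction `G` to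
the closed fibre, expressed by the sections over affine open sets. -/
structure IsFibreRestriction {F : D.total.Modules} {G : X.Modules}
    (φ : F ⟶ (Scheme.Modules.pushforward D.incl).obj G) : Prop where
  localizesOn {V : D.total.Opens} (hV : IsAffineOpen V) : LocalizesOn F V
  flat : IsFlatSheaf (toSheafModule D.proj F)
  localizesOn_fibre {V : D.total.Opens} (hV : IsAffineOpen V) : LocalizesOn G (D.incl ⁻¹ᵁ V)
  surjective {V : D.total.Opens} (hV : IsAffineOpen V) : Function.Surjective (appM φ V)
  ker {V : D.total.Opens} (hV : IsAffineOpen V) (n : Γ(F, V)) (hn : appM φ V n = 0) :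
    n ∈ (IsLocalRing.maximalIdeal A).map (algA D.proj V) • (⊤ : Submodule Γ(D.total, V) Γ(F, V))

variable {D}

variable {F : D.total.Modules} {G : X.Modules} (φ : F ⟶ (Scheme.Modules.pushforward D.incl).obj G)

/-- A morphism to a module on the closed fibre on sections, as an `A`-linear map. -/
def appFibre (V : D.total.Opens) : (toSheafModule D.proj F).obj.obj (op V) →ₗ[A]
    (toSheafModule D.proj ((Scheme.Modules.pushforward D.incl).obj G)).obj.obj (op V) where
  toFun := appM φ V
  map_add' := map_add (appM φ V)
  map_smul' a n := appM_smul φ (algA D.proj V a) n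

lemma smul_fibre_eq_zero {a : A} (ha : a ∈ IsLocalRing.maximalIdeal A) (V : D.total.Opens)
    (n : Γ(G, D.incl ⁻¹ᵁ V)) : algA D.proj V a •
      (show Γ((Scheme.Modules.pushforward D.incl).obj G, V) from n) = 0 := by
  change D.incl.app V (algA D.proj V a) • n = 0
  rw [D.app_algA ha, zero_smul]

lemma smul_top_le_ker_appFibre (V : D.total.Opens) :
    IsLocalRing.maximalIdeal A • (⊤ : Submodule A ((toSheafModule D.proj F).obj.obj (op V))) ≤
      LinearMap.ker (appFibre φ V) := by
  rw [Submodule.smul_le]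
  intro a ha n _
  exact (map_smul (appFibre φ V) a n).trans (smul_fibre_eq_zero ha V (appM φ V n))

/-- The canonical morphism `F ⊗ A / 𝔪 ⟶ G` on sections, for a morphism from `F` to a module `G`
on the closed fibre. -/
def tensorToFibreApp (V : D.total.Opens) :
    (toSheafModule D.proj F).obj.obj (op V) ⊗[A] (A ⧸ IsLocalRing.maximalIdeal A) →ₗ[A]
    (toSheafModule D.proj ((Scheme.Modules.pushforward D.incl).obj G)).obj.obj (op V) :=
  Submodule.liftQ _ (appFibre φ V) (smul_top_le_ker_appFibre φ V) ∘ₗ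
    (tensorQuotEquivQuotSMul ((toSheafModule D.proj F).obj.obj (op V))
      (IsLocalRing.maximalIdeal A)).toLinearMap

lemma tensorToFibreApp_tmul (V : D.total.Opens) (n : (toSheafModule D.proj F).obj.obj (op V))
    (a : A) : tensorToFibreApp φ V (n ⊗ₜ Ideal.Quotient.mk _ a) = a • appFibre φ V n := by
  rw [tensorToFibreApp, LinearMap.comp_apply, LinearEquiv.coe_coe,
    tensorQuotEquivQuotSMul_tmul_mk, Submodule.liftQ_apply, map_smul]

lemma tensorToFibreApp_res {V W : D.total.Opens} (h : W ≤ V)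
    (t : (toSheafModule D.proj F).obj.obj (op V) ⊗[A] (A ⧸ IsLocalRing.maximalIdeal A)) :
    tensorToFibreApp φ W ((resA (toSheafModule D.proj F) h).rTensor _ t) =
      resA (toSheafModule D.proj ((Scheme.Modules.pushforward D.incl).obj G)) h
        (tensorToFibreApp φ V t) := by
  induction t with
  | zero => simp only [map_zero]
  | add x y hx hy => simp only [map_add, hx, hy]
  | tmul n a =>
    obtain ⟨a, rfl⟩ := Ideal.Quotient.mk_surjective a
    refine (tensorToFibreApp_tmul φ W _ a).trans ?_
    rw [tensorToFibreApp_tmul, map_smul]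
    exact congrArg _ (appM_resM φ h n)

/-- The canonical morphism `F ⊗ A / 𝔪 ⟶ G` for a morphism from `F` to a module `G` on the closed
fibre. -/
def tensorToFibre : tensor (toSheafModule D.proj F) (.of A (A ⧸ IsLocalRing.maximalIdeal A)) ⟶
    toSheafModule D.proj ((Scheme.Modules.pushforward D.incl).obj G) :=
  tensorDesc _ _ _ (tensorToFibreApp φ) fun h ↦ tensorToFibreApp_res φ h

lemma appA_tensorToFibre (V : D.total.Opens) (t) :
    appA (tensorToFibre φ) V (toTensor (toSheafModule D.proj F) _ V t) =
      tensorToFibreApp φ V t :=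
  appA_tensorDesc _ _ _ _ _ V t

lemma mem_smul_top_of_tmul_one_eq_zero {R N : Type*} [CommRing R] [AddCommGroup N] [Module R N]
    (I : Ideal R) (n : N) (h : n ⊗ₜ[R] (1 : R ⧸ I) = 0) : n ∈ I • (⊤ : Submodule R N) := by
  rw [← Submodule.Quotient.mk_eq_zero, ← (tensorQuotEquivQuotSMul N I).symm.map_eq_zero_iff]
  exact h

/-- The sheaf `F ⊗ A / 𝔪` is the restriction of `F` to the closed fibre, since this is so over
affine open sets. -/
lemma IsFibreRestriction.isIso_tensorToFibre {φ : F ⟶ (Scheme.Modules.pushforward D.incl).obj G}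
    (hφ : IsFibreRestriction D φ) : IsIso (tensorToFibre φ) := by
  have hB := isTensorBasis_affineOpens D.proj (fun _ hV ↦ hφ.localizesOn hV) hφ.flat
  refine isIso_of_bijective_on_basis _ hB.isBasis fun V hV ↦ ?_
  have h := hB.bijective V hV (A ⧸ IsLocalRing.maximalIdeal A)
  refine (Function.Bijective.of_comp_iff _ h).1 ?_
  have : appA (tensorToFibre φ) V ∘ toTensor (toSheafModule D.proj F)
      (A ⧸ IsLocalRing.maximalIdeal A) V = tensorToFibreApp φ V :=
    funext (appA_tensorToFibre φ V)
  rw [this]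
  refine Function.Bijective.comp 
    (g := Submodule.liftQ _ (appFibre φ V) (smul_top_le_ker_appFibre φ V)) ⟨?_, ?_⟩
    (LinearEquiv.bijective _)
  · rw [← LinearMap.ker_eq_bot]
    exact Submodule.ker_liftQ_eq_bot _ _ _ fun n hn ↦
      (mem_map_smul_top_iff D.proj F V _ n).1 (hφ.ker hV n hn)
  · intro m
    obtain ⟨n, hn⟩ := hφ.surjective hV m
    exact ⟨Submodule.Quotient.mk n, hn⟩

variable {φ} (hφ : IsFibreRestriction D φ) {W : D.total.Opens}
  (hW : H1Vanishes W (toSheafModule D.proj ((Scheme.Modules.pushforward D.incl).obj G)))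
include hφ hW

lemma IsFibreRestriction.h1Vanishes_tensor_residueField :
    H1Vanishes W (tensor (toSheafModule D.proj F)
      (.of A (A ⧸ IsLocalRing.maximalIdeal A))) :=
  have := hφ.isIso_tensorToFibre
  hW.of_iso (asIso (tensorToFibre φ)).symm

omit hW in
lemma IsFibreRestriction.isTensorBasis :
    IsTensorBasis (toSheafModule D.proj F) D.total.affineOpens :=
  isTensorBasis_affineOpens D.proj (fun _ hV ↦ hφ.localizesOn hV) hφ.flat

/-- If `G` has no first cohomology over `W`, then `F(W) ⊗ A / 𝔪 ⟶ G(W)` is an isomorphism. -/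
theorem IsFibreRestriction.surjective_and_ker : Function.Surjective (appM φ W) ∧
    ∀ n : Γ(F, W), appM φ W n = 0 → n ∈ (IsLocalRing.maximalIdeal A).map (algA D.proj W) •
      (⊤ : Submodule Γ(D.total, W) Γ(F, W)) := by
  have hT := hφ.h1Vanishes_tensor_residueField hW
  have hb := hφ.isTensorBasis.toTensor_bijective hT (M := A ⧸ IsLocalRing.maximalIdeal A)
  have := hφ.isIso_tensorToFibre
  have hiso : Function.Bijective (appA (tensorToFibre φ) W) := by
    have : IsIso ((tensorToFibre φ).hom.app (op W)) :=
      inferInstanceAs (IsIso (((TopCat.Sheaf.forget _ _).map (tensorToFibre φ)).app (op W)))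
    exact ConcreteCategory.bijective_of_isIso ((tensorToFibre φ).hom.app (op W))
  have hc := hiso.comp hb
  have h1 : appA (tensorToFibre φ) W ∘ toTensor (toSheafModule D.proj F)
      (A ⧸ IsLocalRing.maximalIdeal A) W = tensorToFibreApp φ W :=
    funext (appA_tensorToFibre φ W)
  rw [h1] at hc
  have h2 (n : (toSheafModule D.proj F).obj.obj (op W)) :
      tensorToFibreApp φ W (n ⊗ₜ 1) = appFibre φ W n :=
    (tensorToFibreApp_tmul φ W n 1).trans (one_smul _ _)
  refine ⟨fun m ↦ ?_, fun n hn ↦ ?_⟩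
  · obtain ⟨t, ht⟩ := hc.2 m
    obtain ⟨n, rfl⟩ : ∃ n, n ⊗ₜ 1 = t := by
      obtain ⟨n, hn⟩ := Submodule.Quotient.mk_surjective _ (tensorQuotEquivQuotSMul _ _ t)
      exact ⟨n, (tensorQuotEquivQuotSMul _ _).injective (by
        rw [← hn]; exact (tensorQuotEquivQuotSMul_tmul_mk _ n 1).trans (by rw [one_smul]))⟩
    exact ⟨n, (h2 n).symm.trans ht⟩
  · rw [mem_map_smul_top_iff]
    refine mem_smul_top_of_tmul_one_eq_zero _ _ (hc.1 ?_)
    rw [h2, map_zero]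
    exact hn

end FibreModule

/-! ### Examples of restrictions to the closed fibre; extension of functions -/

section FibreRestrictionExamples

open Opposite

lemma localizesOn_structureModule {X : Scheme.{0}} {V : X.Opens} (hV : IsAffineOpen V) :
    LocalizesOn (structureModule X) V := by
  refine ⟨fun f s ↦ ?_, fun f n hn ↦ ?_⟩
  · have := hV.isLocalization_basicOpen f
    obtain ⟨⟨n, ⟨_, k, rfl⟩⟩, hn⟩ := IsLocalization.surj (.powers f) (show Γ(X, X.basicOpen f) from s)
    refine ⟨k, n, hn.symm.trans ?_⟩
    rw [mul_comm]
    exact congrArg (· * (show Γ(X, X.basicOpen f) from s)) (map_pow (resO X _) f k)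
  · have := hV.isLocalization_basicOpen f
    have hn' : algebraMap Γ(X, V) Γ(X, X.basicOpen f) n = 0 := hn
    obtain ⟨⟨_, k, rfl⟩, hk⟩ := (IsLocalization.map_eq_zero_iff (.powers f)
      Γ(X, X.basicOpen f) (show Γ(X, V) from n)).1 hn'
    exact ⟨k, hk⟩

variable {X : Scheme.{0}} {s : X ⟶ Spec (.of ℂ)}
  {A : Type} [CommRing A] [Algebra ℂ A] [ArtC A] (D : Deformation s A)

/-- The restriction of a flat quasi-coherent module to the closed fibre. -/
lemma isFibreRestriction_unit {F : D.total.Modules} (hF : SheafOfModules.IsQuasicoherent F)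
    (hflat : IsFlatSheaf (toSheafModule D.proj F)) :
    IsFibreRestriction D ((Scheme.Modules.pullbackPushforwardAdjunction D.incl).unit.app F) where
  localizesOn hV := .of_isQuasicoherent hF hV
  flat := hflat
  localizesOn_fibre hV := LocalizesOn.pullback _ (.of_isQuasicoherent hF hV) hV
    (D.isAffineOpen_preimage hV)
  surjective hV := (LocalizesOn.pbUnit_surjective_and_ker _ (.of_isQuasicoherent hF hV) hV
    (D.isAffineOpen_preimage hV) (D.app_surjective hV)).1
  ker hV n hn := Submodule.smul_mono_left (D.ker_app_le hV)
    ((LocalizesOn.pbUnit_surjective_and_ker _ (.of_isQuasicoherent hF hV) hV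
    (D.isAffineOpen_preimage hV) (D.app_surjective hV)).2 n hn)

omit [Algebra ℂ A] [ArtC A] in
/-- Functions on an affine open subset of a flat `A`-scheme are flat over `A`. -/
lemma flat_section {Y : Scheme.{0}} (f : Y ⟶ Spec (.of A)) [Flat f] {V : Y.Opens}
    (hV : IsAffineOpen V) : (algA f V).Flat := by
  have h := Flat.flat_appLE f (isAffineOpen_top _) hV le_top
  have h2 := RingHom.Flat.comp (RingHom.Flat.of_bijective
    (ConcreteCategory.bijective_of_isIso (Scheme.ΓSpecIso (.of A)).inv)) h
  exact h2

/-- The restriction of the structure sheaf to the closed fibre. -/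
lemma isFibreRestriction_structureModule : IsFibreRestriction D (structureModuleMap D.incl) where
  localizesOn hV := localizesOn_structureModule hV
  flat := isFlatSheaf_of_isBasis _ D.total.isBasis_affineOpens fun V hV ↦
    have := D.flat
    flat_section D.proj hV
  localizesOn_fibre hV := localizesOn_structureModule (D.isAffineOpen_preimage hV)
  surjective hV := D.app_surjective hV
  ker hV n hn := by
    rw [← mul_one (show Γ(D.total, _) from n)]
    exact Submodule.smul_mem_smul (M := Γ(structureModule D.total, _)) (D.ker_app_le hV hn)
      (Submodule.mem_top (x := (show Γ(structureModule D.total, _) from (1 : Γ(D.total, _)))))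

end FibreRestrictionExamples

section OpenImmersion

open Opposite

variable {X U : Scheme.{0}} (ι : U ⟶ X) [IsOpenImmersion ι]

omit [IsOpenImmersion ι] in
/-- The direct image localizes on `V` if the module localizes on the preimage of `V`. -/
lemma LocalizesOn.pushforward {G : U.Modules} {V : X.Opens} (hG : LocalizesOn G (ι ⁻¹ᵁ V)) :
    LocalizesOn ((Scheme.Modules.pushforward ι).obj G) V := by
  refine ⟨fun f s ↦ ?_, fun f n hn ↦ ?_⟩
  · have h : U.basicOpen (ι.app V f) ≤ ι ⁻¹ᵁ X.basicOpen f := by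
      rw [Scheme.preimage_basicOpen]
    have h' : ι ⁻¹ᵁ X.basicOpen f ≤ U.basicOpen (ι.app V f) := by
      rw [Scheme.preimage_basicOpen]
    let s' : Γ(G, ι ⁻¹ᵁ X.basicOpen f) := s
    obtain ⟨k, n, hn⟩ := hG.ext (ι.app V f) (resM G h s')
    refine ⟨k, n, ?_⟩
    have := congr(resM G h' $hn)
    rw [resM_resM, resM_smul, resM_resM, resM_self, map_pow, resO_resO] at this
    refine this.trans ?_
    change _ = (ι.app (X.basicOpen f) (resO X (X.basicOpen_le f) f ^ k)) • s'
    rw [map_pow]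
    congr 2
    exact congr(($(ι.naturality (homOfLE (X.basicOpen_le f)).op)).hom f).symm
  · have h : U.basicOpen (ι.app V f) ≤ ι ⁻¹ᵁ X.basicOpen f := by
      rw [Scheme.preimage_basicOpen]
    obtain ⟨k, hk⟩ := hG.inj (ι.app V f) n (by
      exact ((resM_resM G _ h n).symm.trans (congrArg (resM G h) hn)).trans (map_zero (resM G h)))
    refine ⟨k, ?_⟩
    change ι.app V (f ^ k) • (show Γ(G, ι ⁻¹ᵁ V) from n) = 0
    rw [map_pow]
    exact hk

include ι in
lemma isCompact_of_noetherianSpace_opens (hX : ∀ W : X.Opens, IsCompact (W : Set X)) (W : U.Opens) :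
    IsCompact (W : Set U) := by
  rw [ι.isOpenEmbedding.isInducing.isCompact_iff]
  exact hX ⟨ι '' W, ι.isOpenEmbedding.isOpenMap _ W.isOpen⟩

/-- Regular functions on `ι ⁻¹ V` extend uniquely to `V` if `X` has depth at least two along the
complement of `U`. -/
lemma app_bijective_of_depth (hX : ∀ p : X, p ∉ Set.range ι →
      3 ≤ depth (X.presheaf.stalk p) (X.presheaf.stalk p)) {V : X.Opens}
    (hV : IsAffineOpen V) [IsNoetherianRing Γ(X, V)]
    (hc : ∀ W : X.Opens, IsCompact (W : Set X)) : Function.Bijective (ι.app V) := by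
  have h := resM_bijective_of_hasRegularPair hV (localizesOn_structureModule hV)
    (O := V ⊓ ι.opensRange) inf_le_left (hc _) fun x hx ↦
      (hasRegularTriple_section hV x (hX x.1 fun hx' ↦ hx ⟨x.2, hx'⟩)).pair
  have e : ι ⁻¹ᵁ V = ι ⁻¹ᵁ (V ⊓ ι.opensRange) := by
    ext x
    exact ⟨fun hx ↦ ⟨hx, x, rfl⟩, fun hx ↦ hx.1⟩
  have := ι.isIso_app (V ⊓ ι.opensRange) inf_le_right
  have h1 := ConcreteCategory.bijective_of_isIso (ι.app (V ⊓ ι.opensRange))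
  have h2 : ι.app V = X.presheaf.map (homOfLE (inf_le_left : V ⊓ ι.opensRange ≤ V)).op ≫
      ι.app (V ⊓ ι.opensRange) ≫ U.presheaf.map (eqToHom e).op := by
    rw [ι.naturality_assoc, ← Functor.map_comp]
    exact ((congrArg _ (CategoryTheory.Functor.map_id _ _)).trans (Category.comp_id _)).symm
  have h3 := ConcreteCategory.bijective_of_isIso (U.presheaf.map (eqToHom e).op)
  rw [h2]
  exact h3.comp (h1.comp h)

end OpenImmersion

/-! ### Deformations of an open subscheme -/

section Finiteness

/-- Nakayama's lemma for a nilpotent ideal, without finiteness conditions. -/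
lemma eq_top_of_sup_smul_top {R M : Type*} [CommRing R] [AddCommGroup M] [Module R M] {I : Ideal R}
    (hI : IsNilpotent I) {S : Submodule R M} (h : S ⊔ I • ⊤ = ⊤) : S = ⊤ := by
  obtain ⟨n, hn⟩ := hI
  have key (n : ℕ) : S ⊔ I ^ n • ⊤ = ⊤ := by
    induction n with
    | zero => simp
    | succ n ih =>
      refine top_le_iff.1 (ih.ge.trans (sup_le le_sup_left ?_))
      have h1 : I ^ n • (⊤ : Submodule R M) = I ^ n • S ⊔ I ^ (n + 1) • ⊤ := by
        rw [pow_succ, mul_smul, ← Submodule.smul_sup, h]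
      rw [h1]
      exact sup_le (Submodule.smul_le_right.trans le_sup_left) le_sup_right
  have := key n
  rwa [hn, Submodule.zero_eq_bot, Submodule.bot_smul, sup_bot_eq] at this

/-- If a localization of `N` is finitely generated, then some finitely generated submodule of `N`
has the same localization. -/
lemma exists_fg_of_finite_localization {R RS N NS : Type*} [CommRing R] [CommRing RS] [Algebra R RS]
    (S : Submonoid R) [IsLocalization S RS] [AddCommGroup N] [Module R N] [AddCommGroup NS]
    [Module R NS] [Module RS NS] [IsScalarTower R RS NS] (φ : N →ₗ[R] NS) [IsLocalizedModule S φ]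
    [Module.Finite RS NS] : ∃ N' : Submodule R N, N'.FG ∧ ∀ n, ∃ s ∈ S, s • n ∈ N' := by
  classical
  obtain ⟨T, hT⟩ := (Module.Finite.fg_top : (⊤ : Submodule RS NS).FG)
  choose g hg using IsLocalizedModule.surj S φ
  let N' : Submodule R N := Submodule.span R ((fun t ↦ (g t).1) '' (T : Set NS))
  have key (m : NS) : ∃ s ∈ S, ∃ n ∈ N', s • m = φ n := by
    have hm : m ∈ Submodule.span RS (T : Set NS) := hT ▸ Submodule.mem_top
    induction hm using Submodule.span_induction with
    | mem t ht => exact ⟨(g t).2, (g t).2.2, (g t).1, Submodule.subset_span ⟨t, ht, rfl⟩, hg t⟩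
    | zero => exact ⟨1, one_mem _, 0, zero_mem _, by simp⟩
    | add x y _ _ hx hy =>
      obtain ⟨s, hs, n, hn, h⟩ := hx
      obtain ⟨s', hs', n', hn', h'⟩ := hy
      refine ⟨s * s', mul_mem hs hs', s' • n + s • n',
        add_mem (N'.smul_mem _ hn) (N'.smul_mem _ hn'), ?_⟩
      rw [smul_add, map_add, map_smul, map_smul, ← h, ← h', mul_smul, mul_smul, smul_comm s s' x]
    | smul r x _ hx =>
      obtain ⟨s, hs, n, hn, h⟩ := hx
      obtain ⟨⟨a, u⟩, hu⟩ := IsLocalization.surj S r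
      refine ⟨s * u, mul_mem hs u.2, a • n, N'.smul_mem _ hn, ?_⟩
      rw [map_smul, ← h, mul_smul, ← algebraMap_smul RS (u : R) (r • x), smul_smul, mul_comm, hu,
        algebraMap_smul, smul_comm]
  refine ⟨N', ⟨T.image fun t ↦ (g t).1, by rw [Finset.coe_image]⟩, fun n ↦ ?_⟩
  obtain ⟨s, hs, n', hn', h⟩ := key (φ n)
  rw [← map_smul] at h
  obtain ⟨u, hu⟩ := (IsLocalizedModule.eq_iff_exists S φ).1 h
  refine ⟨u * s, mul_mem u.2 hs, ?_⟩
  rw [mul_smul]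
  exact (show (u : R) • s • n = (u : R) • n' from hu) ▸ N'.smul_mem _ hn'

end Finiteness

section Setup

open Opposite

variable {X U : Scheme.{0}} {s : X ⟶ Spec (.of ℂ)} (ι : U ⟶ X) [IsOpenImmersion ι]
  {A : Type} [CommRing A] [Algebra ℂ A] [ArtC A] (D : Deformation (ι ≫ s) A)

/-- The map from the space of a deformation of `U` to the space of `X`. -/
abbrev spaceMap : (D.total : TopCat) ⟶ (X : TopCat) := D.toFibre ≫ ι.base

omit [IsOpenImmersion ι] in
lemma spaceMap_incl (u : U) : spaceMap ι D (D.incl u) = ι u :=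
  congrArg ι (D.isHomeomorph_incl.homeomorph.symm_apply_apply u)

lemma isOpenEmbedding_spaceMap : Topology.IsOpenEmbedding (spaceMap ι D) :=
  ι.isOpenEmbedding.comp D.isHomeomorph_incl.homeomorph.symm.isOpenEmbedding

omit [IsOpenImmersion ι] in
lemma range_spaceMap : Set.range (spaceMap ι D) = Set.range ι := by
  refine (Set.range_comp ι D.isHomeomorph_incl.homeomorph.symm).trans ?_
  exact (congrArg _ D.isHomeomorph_incl.homeomorph.symm.surjective.range_eq).trans Set.image_univ

/-- The preimage of an open subset of `X` in the total space of a deformation of `U`. -/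
abbrev preimageTotal (V : X.Opens) : D.total.Opens := (Opens.map (spaceMap ι D)).obj V

omit [IsOpenImmersion ι] in
lemma incl_preimage (V : X.Opens) : D.incl ⁻¹ᵁ preimageTotal ι D V = ι ⁻¹ᵁ V := by
  ext u
  change spaceMap ι D (D.incl u) ∈ V ↔ _
  rw [spaceMap_incl]
  rfl

/-- Sections of a module on `U` over the preimage of an open subset `V` of `X`, seen on the
deformation of `U` and on `X`. -/
def sectionsEquiv (G : U.Modules) (V : X.Opens) :
    (toSheafModule D.proj ((Scheme.Modules.pushforward D.incl).obj G)).obj.obj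
      (op (preimageTotal ι D V)) ≃+ Γ((Scheme.Modules.pushforward ι).obj G, V) where
  toFun := resM G (incl_preimage ι D V).ge
  invFun := resM G (incl_preimage ι D V).le
  map_add' := map_add (resM G (incl_preimage ι D V).ge)
  left_inv n := (resM_resM G _ _ n).trans (resM_self G n)
  right_inv n := (resM_resM G _ _ n).trans (resM_self G n)

variable {ι D} {F : D.total.Modules} {G : U.Modules}
  {φ : F ⟶ (Scheme.Modules.pushforward D.incl).obj G} (hφ : IsFibreRestriction D φ)
  (hc : ∀ W : X.Opens, IsCompact (W : Set X))
include hφ hc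

/-- The direct image to `X` of the restriction to the closed fibre is quasi-coherent. -/
lemma IsFibreRestriction.localizesOn_pushforward (V : X.Opens) :
    LocalizesOn ((Scheme.Modules.pushforward ι).obj G) V := by
  refine LocalizesOn.pushforward ι ?_
  refine LocalizesOn.of_isBasis (B := {E | ∃ V, IsAffineOpen V ∧ E = D.incl ⁻¹ᵁ V}) ?_ ?_
    fun W _ ↦ isCompact_of_noetherianSpace_opens ι hc W
  · rw [Opens.isBasis_iff_nbhd]
    intro W x hx
    obtain ⟨W', hW', h⟩ := D.isHomeomorph_incl.isInducing.isOpen_iff.1 W.isOpen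
    obtain ⟨V, hV, hxV, hVW⟩ := Opens.isBasis_iff_nbhd.1 D.total.isBasis_affineOpens
      (U := ⟨W', hW'⟩) (x := D.incl x) (show x ∈ D.incl ⁻¹' W' from h ▸ hx)
    exact ⟨D.incl ⁻¹ᵁ V, ⟨V, hV, rfl⟩, hxV, fun y hy ↦ h.subset (hVW hy)⟩
  · rintro _ ⟨V, hV, rfl⟩
    exact hφ.localizesOn_fibre hV

/-- The restriction of `F` to the closed fibre has no first cohomology over the preimage of an
affine open subset `V` of `X`, if its direct image has depth at least three at the points of `V`
outside `U`. -/
lemma IsFibreRestriction.h1Vanishes {V : X.Opens} (hV : IsAffineOpen V)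
    [IsNoetherianRing Γ(X, V)] (hreg : ∀ x : V, x.1 ∉ Set.range ι → HasRegularTriple
      (hV.primeIdealOf x).asIdeal Γ((Scheme.Modules.pushforward ι).obj G, V)) :
    H1Vanishes (preimageTotal ι D V)
      (toSheafModule D.proj ((Scheme.Modules.pushforward D.incl).obj G)) :=
  h1Vanishes_of_hasRegularTriple (M := (Scheme.Modules.pushforward ι).obj G)
    (isOpenEmbedding_spaceMap ι D) (sectionsEquiv ι D G)
    (fun _ _ _ m ↦ (resM_resM G _ _ m).trans (resM_resM G _ _ m).symm) hV (fun O _ ↦ hc O)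
    (hφ.localizesOn_pushforward hc V) (by rw [range_spaceMap]; exact hreg)

end Setup

/-! ### Finiteness of sections on the closed fibre -/

section SectionsFinite

open Opposite

variable {X U : Scheme.{0}} (ι : U ⟶ X) [IsOpenImmersion ι]

/-- The direct image of `𝒪_U` has depth at least three where `𝒪_X` does, since the two have the
same sections over affine open sets. -/
lemma hasRegularTriple_pushforward_structureModule (hX : ∀ p : X, p ∉ Set.range ι →
      3 ≤ depth (X.presheaf.stalk p) (X.presheaf.stalk p)) {V : X.Opens}
    (hV : IsAffineOpen V) [IsNoetherianRing Γ(X, V)]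
    (hc : ∀ W : X.Opens, IsCompact (W : Set X)) (x : V) (hx : x.1 ∉ Set.range ι) :
    HasRegularTriple (hV.primeIdealOf x).asIdeal
      Γ((Scheme.Modules.pushforward ι).obj (structureModule U), V) := by
  let e : Γ(X, V) →ₗ[Γ(X, V)] Γ((Scheme.Modules.pushforward ι).obj (structureModule U), V) :=
    { toFun := ι.app V
      map_add' := map_add (ι.app V).hom
      map_smul' := map_mul (ι.app V).hom }
  exact hasRegularTriple_congr (LinearEquiv.ofBijective e (app_bijective_of_depth ι hX hV hc))
    (hasRegularTriple_section hV x (hX x.1 hx))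

/-- Generators of the sections over `V` generate the sections over `W`, if `W` is a basic open
subset of `V`. -/
lemma finite_of_localizesOn {M : X.Modules} {V W : X.Opens} (hM : LocalizesOn M V) (f : Γ(X, V))
    (hW : W = X.basicOpen f) [Module.Finite Γ(X, V) Γ(M, V)] : Module.Finite Γ(X, W) Γ(M, W) := by
  subst hW
  obtain ⟨T, hT⟩ := (Module.Finite.fg_top : (⊤ : Submodule Γ(X, V) Γ(M, V)).FG)
  classical
  refine ⟨T.image (resM M (X.basicOpen_le f)), top_le_iff.1 fun m _ ↦ ?_⟩
  obtain ⟨k, n, hn⟩ := hM.ext f m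
  have hn' : resM M (X.basicOpen_le f) n ∈
      Submodule.span Γ(X, X.basicOpen f) (T.image (resM M (X.basicOpen_le f)) : Set _) := by
    have h : n ∈ Submodule.span Γ(X, V) (T : Set Γ(M, V)) := hT ▸ Submodule.mem_top
    clear hn
    induction h using Submodule.span_induction with
    | mem t ht => exact Submodule.subset_span (Finset.mem_coe.2 (Finset.mem_image_of_mem _ ht))
    | zero => rw [map_zero]; exact zero_mem _
    | add x y _ _ hx hy => rw [map_add]; exact add_mem hx hy
    | smul r x _ hx => rw [resM_smul]; exact Submodule.smul_mem _ _ hx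
  have hu := (isUnit_resO (X := X) f le_rfl).pow k
  rw [hn] at hn'
  exact (Submodule.smul_mem_iff_of_isUnit _ hu).1 hn'

omit [IsOpenImmersion ι] in
lemma finite_pushforward_of_surjective (G : U.Modules) (W : X.Opens)
    (h : Function.Surjective (ι.app W)) [Module.Finite Γ(U, ι ⁻¹ᵁ W) Γ(G, ι ⁻¹ᵁ W)] :
    Module.Finite Γ(X, W) Γ((Scheme.Modules.pushforward ι).obj G, W) := by
  obtain ⟨T, hT⟩ := (Module.Finite.fg_top : (⊤ : Submodule Γ(U, ι ⁻¹ᵁ W) Γ(G, ι ⁻¹ᵁ W)).FG)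
  let S : Submodule Γ(X, W) Γ((Scheme.Modules.pushforward ι).obj G, W) :=
    Submodule.span _ (T : Set Γ(G, ι ⁻¹ᵁ W))
  have key (m : Γ(G, ι ⁻¹ᵁ W))
      (h' : m ∈ Submodule.span Γ(U, ι ⁻¹ᵁ W) (T : Set Γ(G, ι ⁻¹ᵁ W))) :
      (show Γ((Scheme.Modules.pushforward ι).obj G, W) from m) ∈ S := by
    induction h' using Submodule.span_induction with
    | mem t ht => exact Submodule.subset_span ht
    | zero => exact zero_mem S
    | add x y _ _ hx hy => exact add_mem (S := Submodule _ _) hx hy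
    | smul r x _ hx =>
      obtain ⟨r, rfl⟩ := h r
      exact S.smul_mem r hx
  exact ⟨T, top_le_iff.1 fun m _ ↦ key m (hT ▸ Submodule.mem_top)⟩

variable {ι} {s : X ⟶ Spec (.of ℂ)}
  {A : Type} [CommRing A] [Algebra ℂ A] [ArtC A] {D : Deformation (ι ≫ s) A}
  {F : D.total.Modules} {G : U.Modules}
  {φ : F ⟶ (Scheme.Modules.pushforward D.incl).obj G} (hφ : IsFibreRestriction D φ)
  (hc : ∀ W : X.Opens, IsCompact (W : Set X))
include hφ hc

/-- A module that is coherent on `U` and whose direct image to `X` has finite stalks outside `U` has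
finite modules of sections over affine open sets, if its sections extend along the complement
of `U`. -/
theorem IsFibreRestriction.finite_pushforward
    (hfin : ∀ {V : D.total.Opens}, IsAffineOpen V →
      Module.Finite Γ(U, D.incl ⁻¹ᵁ V) Γ(G, D.incl ⁻¹ᵁ V))
    (hstalk : ∀ p : X, p ∉ Set.range ι → Module.Finite (X.presheaf.stalk p)
      (((Scheme.Modules.pushforward ι).obj G).presheaf.stalk p))
    {V : X.Opens} (hV : IsAffineOpen V) [IsNoetherianRing Γ(X, V)] :
    Module.Finite Γ(X, V) Γ((Scheme.Modules.pushforward ι).obj G, V) := by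
  let M := (Scheme.Modules.pushforward ι).obj G
  have hM : LocalizesOn M V := hφ.localizesOn_pushforward hc V
  -- a finite cover of `V ∩ U` by basic open subsets of `V` with finitely generated sections
  obtain ⟨n, f, hfP, hfO, hf⟩ := IsAffineOpen.exists_finite_cover hV (O := V ⊓ ι.opensRange)
    inf_le_left (hc _) (P := fun f ↦ Module.Finite Γ(X, X.basicOpen f) Γ(M, X.basicOpen f)) (by
    rintro _ ⟨hx, u, rfl⟩
    obtain ⟨E, hE, huE, hEV⟩ := Opens.isBasis_iff_nbhd.1 D.total.isBasis_affineOpens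
      (U := preimageTotal ι D V) (x := D.incl u) (by
        change spaceMap ι D (D.incl u) ∈ V
        rwa [spaceMap_incl])
    have hEV' : D.incl ⁻¹ᵁ E ≤ ι ⁻¹ᵁ V := by
      rw [← incl_preimage ι D]
      exact fun x hx ↦ hEV hx
    refine ⟨ι ''ᵁ (D.incl ⁻¹ᵁ E), ⟨u, huE, rfl⟩, fun f hf ↦ ?_⟩
    have hfr : X.basicOpen f ≤ ι.opensRange := hf.trans (Set.image_subset_range _ _)
    have hW : ι ⁻¹ᵁ X.basicOpen f = U.basicOpen (resO U hEV' (ι.app V f)) := by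
      rw [basicOpen_resO, Scheme.preimage_basicOpen]
      refine (inf_eq_right.2 ?_).symm
      rw [← Scheme.preimage_basicOpen]
      intro y hy
      obtain ⟨z, hz, h⟩ := hf hy
      rwa [← ι.isOpenEmbedding.injective h]
    have := hfin hE
    have h1 := finite_of_localizesOn (hφ.localizesOn_fibre hE) _ hW
    have := ι.isIso_app _ hfr
    exact finite_pushforward_of_surjective ι G _
      (ConcreteCategory.bijective_of_isIso (ι.app (X.basicOpen f))).2)
  -- the conditions are: no sections supported on the complement of `U`, finiteness on `U`, and
  -- finiteness of the stalks outside `U`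
  refine finite_of_finite_at_primes f ?_ ?_ ?_
  · intro m hm
    refine eq_of_coverM (M := G) (fun i ↦ ι ⁻¹ᵁ X.basicOpen (f i))
      (fun i ↦ ι.preimage_mono (X.basicOpen_le (f i))) ?_ fun i ↦ ?_
    · intro u hu
      obtain ⟨i, hi⟩ := Opens.mem_iSup.1 (hf ⟨hu, u, rfl⟩)
      exact Opens.mem_iSup.2 ⟨i, hi⟩
    · obtain ⟨k, hk⟩ := hm i
      have h1 := congr(resM M (X.basicOpen_le (f i)) $hk)
      rw [map_zero, resM_smul, map_pow] at h1
      have h2 := (((isUnit_resO (X := X) (f i) le_rfl).pow k).smul_eq_zero).1 h1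
      exact h2.trans (map_zero (resM G (ι.preimage_mono (X.basicOpen_le (f i))))).symm
  · have (i : Fin n) : ∃ N' : Submodule Γ(X, V) Γ(M, V), N'.FG ∧ ∀ n, ∃ k : ℕ, f i ^ k • n ∈ N' := by
      let := moduleRes M (X.basicOpen_le (f i))
      have := hM.isLocalizedModule (f i)
      have := hV.isLocalization_basicOpen (f i)
      have := hfP i
      have : IsScalarTower Γ(X, V) Γ(X, X.basicOpen (f i)) Γ(M, X.basicOpen (f i)) :=
        .of_algebraMap_smul fun _ _ ↦ rfl
      obtain ⟨N', hN', h⟩ := exists_fg_of_finite_localization (.powers (f i))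
        (RS := Γ(X, X.basicOpen (f i))) (resL M (X.basicOpen_le (f i)))
      refine ⟨N', hN', fun n ↦ ?_⟩
      obtain ⟨_, ⟨k, rfl⟩, hk⟩ := h n
      exact ⟨k, hk⟩
    choose N' hN' h using this
    refine ⟨⨆ i, N' i, Submodule.fg_iSup _ hN', fun i n ↦ ?_⟩
    obtain ⟨k, hk⟩ := h i n
    exact ⟨k, le_iSup N' i hk⟩
  · refine IsAffineOpen.forall_prime_of_cover hV ι.opensRange (P := fun p ↦
      ∃ N' : Submodule Γ(X, V) Γ(M, V), N'.FG ∧ ∀ n, ∃ s ∉ p, s • n ∈ N') (fun x hx ↦ ?_) hf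
    let := moduleStalk M x.2
    let := X.presheaf.algebra_section_stalk x
    have hloc := hV.isLocalization_stalk x
    have : IsScalarTower Γ(X, V) (X.presheaf.stalk x.1) (M.presheaf.stalk x.1) :=
      .of_algebraMap_smul fun _ _ ↦ rfl
    have := hM.isLocalizedModule_stalk hV x
    have := hstalk x.1 hx
    exact exists_fg_of_finite_localization (hV.primeIdealOf x).asIdeal.primeCompl
      (RS := X.presheaf.stalk x.1) ({ germM M x.2 with map_smul' := germM_smul M x.2 } :
        Γ(M, V) →ₗ[Γ(X, V)] M.presheaf.stalk x.1)

end SectionsFinite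

/-! ### Finiteness of sections on the deformation -/

section TotalFinite

open Opposite

variable {X U : Scheme.{0}} {ι : U ⟶ X} [IsOpenImmersion ι] {s : X ⟶ Spec (.of ℂ)}
  {A : Type} [CommRing A] [Algebra ℂ A] [ArtC A] {D : Deformation (ι ≫ s) A}

omit [Algebra ℂ A] in
lemma isNilpotent_map_maximalIdeal [IsLocalRing A] [IsArtinianRing A] {R : Type*} [CommRing R]
    (f : A →+* R) : IsNilpotent ((IsLocalRing.maximalIdeal A).map f) := by
  obtain ⟨n, hn⟩ := (isArtinianRing_iff_isNilpotent_maximalIdeal A).1 inferInstance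
  exact ⟨n, by rw [← Ideal.map_pow, hn]; exact Ideal.map_bot⟩

omit [IsOpenImmersion ι] in
/-- Sections of `F` over the preimage of `V` form a finite module if those of its restriction to
the closed fibre do. -/
theorem finite_preimageTotal {F : D.total.Modules} {G : U.Modules}
    (φ : F ⟶ (Scheme.Modules.pushforward D.incl).obj G) {V : X.Opens}
    (hfin : Module.Finite Γ(X, V) Γ((Scheme.Modules.pushforward ι).obj G, V))
    (hO : Function.Surjective (D.incl.app (preimageTotal ι D V)))
    (hs : Function.Surjective (appM φ (preimageTotal ι D V)))
    (hk : ∀ n : Γ(F, preimageTotal ι D V), appM φ _ n = 0 →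
      n ∈ (IsLocalRing.maximalIdeal A).map (algA D.proj (preimageTotal ι D V)) •
      (⊤ : Submodule Γ(D.total, preimageTotal ι D V) Γ(F, preimageTotal ι D V))) :
    Module.Finite Γ(D.total, preimageTotal ι D V) Γ(F, preimageTotal ι D V) := by
  have h1 : Module.Finite Γ(U, ι ⁻¹ᵁ V) Γ(G, ι ⁻¹ᵁ V) := by
    obtain ⟨T, hT⟩ := (Module.Finite.fg_top :
      (⊤ : Submodule Γ(X, V) Γ((Scheme.Modules.pushforward ι).obj G, V)).FG)
    let T' : Finset Γ(G, ι ⁻¹ᵁ V) := T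
    let S : Submodule Γ(U, ι ⁻¹ᵁ V) Γ(G, ι ⁻¹ᵁ V) := Submodule.span _ (T' : Set Γ(G, ι ⁻¹ᵁ V))
    have key (m : Γ((Scheme.Modules.pushforward ι).obj G, V))
        (h' : m ∈ Submodule.span Γ(X, V) (T : Set Γ((Scheme.Modules.pushforward ι).obj G, V))) :
        (show Γ(G, ι ⁻¹ᵁ V) from m) ∈ S := by
      induction h' using Submodule.span_induction with
      | mem t ht => exact Submodule.subset_span ht
      | zero => exact zero_mem S
      | add x y _ _ hx hy => exact add_mem (S := Submodule _ _) hx hy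
      | smul r x _ hx => exact S.smul_mem (ι.app V r) hx
    exact ⟨T', top_le_iff.1 fun m _ ↦ key m (hT ▸ Submodule.mem_top)⟩
  rw [← incl_preimage ι D] at h1
  obtain ⟨T, hT⟩ := (finite_pushforward_of_surjective D.incl G (preimageTotal ι D V) hO).fg_top
  choose g hg using hs
  classical
  -- lifts of generators on the closed fibre generate modulo the nilpotent ideal `𝔪 Γ`
  refine ⟨T.image g, eq_top_of_sup_smul_top (isNilpotent_map_maximalIdeal
    (algA D.proj (preimageTotal ι D V))) (top_le_iff.1 fun n _ ↦ ?_)⟩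
  let S := Submodule.span Γ(D.total, preimageTotal ι D V) (T.image g : Set Γ(F, preimageTotal ι D V))
  have key (m : Γ((Scheme.Modules.pushforward D.incl).obj G, preimageTotal ι D V))
      (h' : m ∈ Submodule.span Γ(D.total, preimageTotal ι D V)
        (T : Set Γ((Scheme.Modules.pushforward D.incl).obj G, preimageTotal ι D V))) :
      ∃ n ∈ S, appM φ _ n = m := by
    induction h' using Submodule.span_induction with
    | mem t ht => exact ⟨g t, Submodule.subset_span
        (Finset.mem_coe.2 (Finset.mem_image_of_mem _ ht)), hg t⟩
    | zero => exact ⟨0, zero_mem _, map_zero _⟩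
    | add x y _ _ hx hy =>
      obtain ⟨a, ha, rfl⟩ := hx
      obtain ⟨b, hb, rfl⟩ := hy
      exact ⟨a + b, add_mem ha hb, map_add _ _ _⟩
    | smul r x _ hx =>
      obtain ⟨a, ha, rfl⟩ := hx
      exact ⟨r • a, S.smul_mem _ ha, appM_smul φ r a⟩
  obtain ⟨n', hn', h⟩ := key (appM φ _ n) (hT ▸ Submodule.mem_top)
  rw [← add_sub_cancel n' n]
  exact Submodule.add_mem_sup hn' (hk _ (by rw [map_sub, h, sub_self]))

end TotalFinite

/-! ### Spectra of functions on preimages -/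

section Chart

open Opposite

/-- On a compact quasi-separated scheme, functions on open subsets of the spectrum of the ring of
functions are functions on the preimages. -/
lemma isIso_toSpecΓ_app (Z : Scheme.{0}) [CompactSpace Z] [QuasiSeparatedSpace Z]
    (S : (Spec Γ(Z, ⊤)).Opens) : IsIso (Z.toSpecΓ.app S) := by
  let φ : (Spec Γ(Z, ⊤)).sheaf ⟶ (TopCat.Sheaf.pushforward _ Z.toSpecΓ.base).obj Z.sheaf :=
    ⟨Z.toSpecΓ.c⟩
  have hφ : IsIso φ :=
    TopCat.Sheaf.isIso_iff_isIso_basis (φ := φ) PrimeSpectrum.isBasis_basic_opens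
      fun r ↦ isIso_ΓSpec_adjunction_unit_app_basicOpen r
  exact inferInstanceAs (IsIso (((TopCat.Sheaf.forget _ _).map φ).app (op S)))

/-- The preimage of an open subset of `X` under a continuous map, as an open subset of the
scheme `Y`. -/
abbrev preim {X Y : Scheme.{0}} (j : (Y : TopCat) ⟶ (X : TopCat)) (V : X.Opens) : Y.Opens :=
  (Opens.map j).obj V

variable {X Y : Scheme.{0}} (j : (Y : TopCat) ⟶ (X : TopCat)) {V : X.Opens} (hV : IsAffineOpen V)
  (ρ : Γ(Y, preim j V) →+* Γ(X, V)) (hρ : Function.Surjective ρ)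
  (hker : ∀ f, ρ f = 0 → IsNilpotent f)
  (hρj : ∀ (f) (y : Y), j y ∈ V → (y ∈ Y.basicOpen f ↔ j y ∈ X.basicOpen (ρ f)))

lemma IsAffineOpen.mem_primeIdealOf (x : V) (f : Γ(X, V)) :
    f ∈ (hV.primeIdealOf x).asIdeal ↔ x.1 ∉ X.basicOpen f := by
  have : hV.primeIdealOf x ∈ hV.fromSpec ⁻¹ᵁ X.basicOpen f ↔ x.1 ∈ X.basicOpen f := by
    conv_rhs => rw [← hV.fromSpec_primeIdealOf x]
    rfl
  rw [← this, hV.fromSpec_preimage_basicOpen]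
  exact not_not.symm

include hρ hker in
lemma isHomeomorph_comap : IsHomeomorph (PrimeSpectrum.comap ρ) := by
  refine PrimeSpectrum.isHomeomorph_comap _ (fun x ↦ ⟨1, one_pos, ?_⟩) fun f hf ↦
    mem_nilradical.2 (hker f hf)
  rw [pow_one]
  exact hρ x

/-- The open embedding of the spectrum of the functions on the preimage of `V` whose image is
`V`. -/
def chartBase : (Spec Γ(Y, preim j V) : TopCat) ⟶ (X : TopCat) :=
  TopCat.ofHom ⟨fun x ↦ hV.fromSpec ((isHomeomorph_comap j ρ hρ hker).homeomorph.symm x),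
    hV.fromSpec.continuous.comp (isHomeomorph_comap j ρ hρ hker).homeomorph.symm.continuous⟩

lemma isOpenEmbedding_chartBase : Topology.IsOpenEmbedding (chartBase j hV ρ hρ hker) :=
  hV.fromSpec.isOpenEmbedding.comp
    (isHomeomorph_comap j ρ hρ hker).homeomorph.symm.isOpenEmbedding

lemma range_chartBase : Set.range (chartBase j hV ρ hρ hker) = V := by
  exact ((isHomeomorph_comap j ρ hρ hker).homeomorph.symm.surjective.range_comp
    hV.fromSpec).trans hV.range_fromSpec

include hρj in
lemma chartBase_toSpecΓ (w : preim j V) :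
    chartBase j hV ρ hρ hker ((preim j V).toSpecΓ w) = j w.1 := by
  let W : Y.Opens := preim j V
  let x : V := ⟨j w.1, w.2⟩
  -- both primes consist of the functions `f` such that `w` is not in the basic open set of `f`, by
  -- `hρj`
  have h : W.toSpecΓ w = PrimeSpectrum.comap ρ (hV.primeIdealOf x) := by
    refine PrimeSpectrum.ext (Ideal.ext fun f ↦ ?_)
    rw [PrimeSpectrum.comap_asIdeal, Ideal.mem_comap, IsAffineOpen.mem_primeIdealOf, ← hρj f _ w.2]
    have h1 : w ∈ W.toSpecΓ ⁻¹ᵁ PrimeSpectrum.basicOpen f ↔ w.1 ∈ Y.basicOpen f := by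
      rw [Scheme.Opens.toSpecΓ_preimage_basicOpen]
      rfl
    rw [← h1]
    exact not_not.symm
  rw [h]
  exact (congrArg hV.fromSpec ((isHomeomorph_comap j ρ hρ hker).homeomorph.symm_apply_apply
    (hV.primeIdealOf x))).trans (hV.fromSpec_primeIdealOf x)

end Chart

/-! ### Charts of the ringed space of a direct image -/

section Chart

open Opposite

/-- For morphisms `f : Z ⟶ Y` and `g : Z ⟶ T`, the map from the functions on an open subset `P` of
`Y` to the functions on an open subset `S` of `T` with the same preimage, provided that `g` induces
isomorphisms on functions. -/
def spanMap {Y Z T : Scheme.{0}} (f : Z ⟶ Y) (g : Z ⟶ T) (hg : ∀ S, IsIso (g.app S))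
    {P : Y.Opens} {S : T.Opens} (h : f ⁻¹ᵁ P = g ⁻¹ᵁ S) : Γ(Y, P) ⟶ Γ(T, S) :=
  f.appLE P (g ⁻¹ᵁ S) h.ge ≫ @inv _ _ _ _ (g.app S) (hg S)

lemma spanMap_naturality {Y Z T : Scheme.{0}} (f : Z ⟶ Y) (g : Z ⟶ T) (hg : ∀ S, IsIso (g.app S))
    {P P' : Y.Opens} {S S' : T.Opens} (h : f ⁻¹ᵁ P = g ⁻¹ᵁ S) (h' : f ⁻¹ᵁ P' = g ⁻¹ᵁ S')
    (i : op P ⟶ op P') (i' : op S ⟶ op S') :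
    Y.presheaf.map i ≫ spanMap f g hg h' = spanMap f g hg h ≫ T.presheaf.map i' := by
  unfold spanMap
  rw [← Category.assoc, IsIso.comp_inv_eq, Scheme.Hom.map_appLE, Category.assoc, Category.assoc,
    Scheme.Hom.naturality, IsIso.inv_hom_id_assoc, Scheme.Hom.appLE_map]

/-- The map is an isomorphism if `P` lies in the image of the open immersion `f`. -/
lemma isIso_spanMap {Y Z T : Scheme.{0}} (f : Z ⟶ Y) [IsOpenImmersion f] (g : Z ⟶ T)
    (hg : ∀ S, IsIso (g.app S)) {P : Y.Opens} {S : T.Opens} (h : f ⁻¹ᵁ P = g ⁻¹ᵁ S)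
    (hP : P ≤ f.opensRange) : IsIso (spanMap f g hg h) := by
  have h1 : IsIso (f.app P) := f.isIso_app P hP
  have h2 : IsIso (f.appLE P (g ⁻¹ᵁ S) h.ge) := by
    rw [Scheme.Hom.appLE]
    have : homOfLE h.ge = eqToHom h.symm := rfl
    rw [this]
    infer_instance
  exact IsIso.comp_isIso' h2 inferInstance

variable {X Y : Scheme.{0}} (j : (Y : TopCat) ⟶ (X : TopCat)) {V : X.Opens} (hV : IsAffineOpen V)
  (ρ : Γ(Y, preim j V) →+* Γ(X, V)) (hρ : Function.Surjective ρ)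
  (hker : ∀ f, ρ f = 0 → IsNilpotent f)
  (hρj : ∀ (f) (y : Y), j y ∈ V → (y ∈ Y.basicOpen f ↔ j y ∈ X.basicOpen (ρ f)))

lemma isIso_opens_toSpecΓ_app (W : Y.Opens) [CompactSpace W] [QuasiSeparatedSpace W]
    (S : (Spec Γ(Y, W)).Opens) : IsIso (W.toSpecΓ.app S) := by
  have h1 := isIso_toSpecΓ_app W.toScheme ((Spec.map W.topIso.inv) ⁻¹ᵁ S)
  have h2 : W.toSpecΓ.app S =
    (Spec.map W.topIso.inv).app S ≫ W.toScheme.toSpecΓ.app ((Spec.map W.topIso.inv) ⁻¹ᵁ S) := by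
    exact Scheme.Hom.comp_app _ _ _
  rw [h2]
  exact IsIso.comp_isIso' inferInstance h1

include hρj in
/-- The chart is compatible with the canonical morphism from the preimage of `V` to its
affinization. -/
lemma preimage_chartBase (V' : X.Opens) :
    (preim j V).ι ⁻¹ᵁ preim j V' =
      (preim j V).toSpecΓ ⁻¹ᵁ ((Opens.map (chartBase j hV ρ hρ hker)).obj V') := by
  refine Opens.ext (Set.ext fun w ↦ ?_)
  change j w.1 ∈ V' ↔ chartBase j hV ρ hρ hker ((preim j V).toSpecΓ w) ∈ V'
  exact iff_of_eq (congrArg (· ∈ V') (chartBase_toSpecΓ j hV ρ hρ hker hρj w)).symm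

lemma isIso_preim_toSpecΓ_app [NoetherianSpace Y] (V : X.Opens)
    (S : (Spec Γ(Y, preim j V)).Opens) : IsIso ((preim j V).toSpecΓ.app S) := by
  have : NoetherianSpace (preim j V).toScheme :=
    (preim j V).ι.isOpenEmbedding.isInducing.noetherianSpace
  exact isIso_opens_toSpecΓ_app _ S

/-- The chart of the ringed space `(X, j_* 𝒪_Y)` given by the functions on the preimage of an affine
open subset of `X`. -/
def chart [NoetherianSpace Y] :
    (Spec Γ(Y, preim j V)).toPresheafedSpace ⟶
      (pushforwardSpace Y j).toPresheafedSpace :=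
  { base := chartBase j hV ρ hρ hker
    c :=
      { app V' := spanMap (preim j V).ι (preim j V).toSpecΓ (isIso_preim_toSpecΓ_app j V)
          (preimage_chartBase j hV ρ hρ hker hρj V'.unop)
        naturality _ _ _ := spanMap_naturality _ _ _ _ _ _ _ } }

lemma chart_isOpenImmersion [NoetherianSpace Y] :
    PresheafedSpace.IsOpenImmersion (chart j hV ρ hρ hker hρj) where
  base_open := isOpenEmbedding_chartBase j hV ρ hρ hker
  c_iso S := by
    refine isIso_spanMap (preim j V).ι (preim j V).toSpecΓ (isIso_preim_toSpecΓ_app j V)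
      (preimage_chartBase j hV ρ hρ hker hρj _) ?_
    rw [Scheme.Opens.opensRange_ι]
    rintro y ⟨z, -, hz⟩
    have h1 : j y ∈ Set.range (chartBase j hV ρ hρ hker) := ⟨z, hz⟩
    rw [range_chartBase] at h1
    exact h1

end Chart

/-! ### Thickening spans -/

section Thickening

open Opposite

variable {U X Y : Scheme.{0}} {ι : U ⟶ X} {u : U ⟶ Y} {j : (Y : TopCat) ⟶ (X : TopCat)}

/-- Conditions on a span of schemes `X ← U → Y` under which the ringed space `(X, j_* 𝒪_Y)` is a
nilpotent thickening of the scheme `X`. -/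
structure IsThickeningSpan (ι : U ⟶ X) (u : U ⟶ Y) (j : (Y : TopCat) ⟶ (X : TopCat)) : Prop where
  comp_eq : ∀ z, j (u z) = ι z
  surj : Function.Surjective u
  isIso_app : ∀ V, IsIso (ι.app V)
  app_surjective : ∀ V : X.Opens, IsAffineOpen V → Function.Surjective (u.app (preim j V))
  isNilpotent : ∀ V : X.Opens, IsAffineOpen V → ∀ f, u.app (preim j V) f = 0 → IsNilpotent f
  noetherianSpace : NoetherianSpace Y

namespace IsThickeningSpan

variable (T : IsThickeningSpan ι u j)
include T

lemma preimage_eq (V : X.Opens) : u ⁻¹ᵁ preim j V = ι ⁻¹ᵁ V :=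
  Opens.ext (Set.ext fun z ↦ iff_of_eq (congrArg (· ∈ V) (T.comp_eq z)))

/-- The map from functions on the preimage of `V` to functions on `V`. -/
def res (V : X.Opens) : Γ(Y, preim j V) ⟶ Γ(X, V) := spanMap u ι T.isIso_app (T.preimage_eq V)

lemma res_app (V : X.Opens) : T.res V ≫ ι.app V = u.appLE (preim j V) (ι ⁻¹ᵁ V)
    (T.preimage_eq V).ge := by
  have := T.isIso_app V
  rw [res, spanMap, Category.assoc, IsIso.inv_hom_id, Category.comp_id]

/-- A function on `Y` and its restriction to `X` have the same nonvanishing locus. -/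
lemma basicOpen_iff {V : X.Opens} (f : Γ(Y, preim j V)) (y : Y) :
    y ∈ Y.basicOpen f ↔ j y ∈ X.basicOpen (T.res V f) := by
  obtain ⟨z, rfl⟩ := T.surj y
  rw [T.comp_eq]
  have h1 : z ∈ u ⁻¹ᵁ Y.basicOpen f ↔ z ∈ ι ⁻¹ᵁ X.basicOpen (T.res V f) := by
    rw [Scheme.preimage_basicOpen, Scheme.preimage_basicOpen]
    have h2 := congr(($(T.res_app V)).hom f)
    rw [show ι.app V (T.res V f) = u.appLE (preim j V) (ι ⁻¹ᵁ V) (T.preimage_eq V).ge f from h2,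
      Scheme.Hom.appLE]
    rw [show homOfLE (T.preimage_eq V).ge = eqToHom (T.preimage_eq V).symm from rfl]
    exact iff_of_eq (congrArg (z ∈ ·) (U.basicOpen_res_eq _ _).symm)
  exact h1

lemma res_eq_zero {V : X.Opens} {f : Γ(Y, preim j V)} (hf : T.res V f = 0) :
    u.app (preim j V) f = 0 := by
  have h1 : u.appLE (preim j V) (ι ⁻¹ᵁ V) (T.preimage_eq V).ge f = 0 := by
    have h2 := congr(($(T.res_app V)).hom f)
    refine h2.symm.trans ?_
    exact (congrArg (ι.app V) hf).trans (map_zero _)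
  rw [Scheme.Hom.appLE, show homOfLE (T.preimage_eq V).ge = eqToHom (T.preimage_eq V).symm from rfl]
    at h1
  exact (injective_iff_map_eq_zero' _).1 (ConcreteCategory.bijective_of_isIso
    (U.presheaf.map (eqToHom (T.preimage_eq V).symm).op)).1 _ |>.1 h1

lemma res_surjective {V : X.Opens} (hV : IsAffineOpen V) : Function.Surjective (T.res V) := by
  have := T.isIso_app V
  have h := T.app_surjective V hV
  rw [res, spanMap, Scheme.Hom.appLE,
    show homOfLE (T.preimage_eq V).ge = eqToHom (T.preimage_eq V).symm from rfl]
  exact (ConcreteCategory.bijective_of_isIso (inv (ι.app V))).2.comp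
    ((ConcreteCategory.bijective_of_isIso
      (U.presheaf.map (eqToHom (T.preimage_eq V).symm).op)).2.comp h)

/-- The chart at an affine open subset. -/
def chart {V : X.Opens} (hV : IsAffineOpen V) :
    (Spec Γ(Y, preim j V)).toPresheafedSpace ⟶ (pushforwardSpace Y j).toPresheafedSpace :=
  have := T.noetherianSpace
  S3Flat.chart j hV (T.res V).hom (T.res_surjective hV)
    (fun f hf ↦ T.isNilpotent V hV f (T.res_eq_zero hf)) fun f y _ ↦ T.basicOpen_iff f y

lemma chart_isOpenImmersion {V : X.Opens} (hV : IsAffineOpen V) :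
    PresheafedSpace.IsOpenImmersion (T.chart hV) :=
  have := T.noetherianSpace
  S3Flat.chart_isOpenImmersion j hV (T.res V).hom (T.res_surjective hV)
    (fun f hf ↦ T.isNilpotent V hV f (T.res_eq_zero hf)) fun f y _ ↦ T.basicOpen_iff f y

lemma mem_range_chart {V : X.Opens} (hV : IsAffineOpen V) (x : X) :
    x ∈ Set.range (T.chart hV).base ↔ x ∈ V :=
  iff_of_eq (congrArg (x ∈ ·) (range_chartBase j hV (T.res V).hom (T.res_surjective hV)
    fun f hf ↦ T.isNilpotent V hV f (T.res_eq_zero hf)))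

lemma isLocalRing_stalk (x : X) : IsLocalRing ((pushforwardSpace Y j).presheaf.stalk x) := by
  obtain ⟨V, hV, hx, -⟩ := exists_isAffineOpen_mem_and_subset (x := x) (U := ⊤) trivial
  obtain ⟨z, rfl⟩ : x ∈ Set.range (T.chart hV).base := (T.mem_range_chart hV x).2 hx
  have := T.chart_isOpenImmersion hV
  have : IsLocalRing ((Spec Γ(Y, preim j V)).presheaf.stalk z) := inferInstance
  exact (asIso ((T.chart hV).stalkMap z)).symm.commRingCatIsoToRingEquiv.isLocalRing

end IsThickeningSpan

end Thickening

/-! ### The scheme of a thickening span -/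

section Thickening

open Opposite

variable {U X Y : Scheme.{0}} {ι : U ⟶ X} {u : U ⟶ Y} {j : (Y : TopCat) ⟶ (X : TopCat)}

namespace IsThickeningSpan

variable (T : IsThickeningSpan ι u j)
include T

/-- The locally ringed space `(X, j_* 𝒪_Y)`. -/
def space : LocallyRingedSpace where
  toSheafedSpace := pushforwardSpace Y j
  isLocalRing := T.isLocalRing_stalk

/-- The chart at an affine open subset, as a morphism of locally ringed spaces. -/
def chartLRS {V : X.Opens} (hV : IsAffineOpen V) :
    (Spec Γ(Y, preim j V)).toLocallyRingedSpace ⟶ T.space where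
  toHom := T.chart hV
  prop x := by
    have := T.chart_isOpenImmersion hV
    have h : IsIso ((T.chart hV).stalkMap x) := inferInstance
    exact isLocalHom_of_isIso ((T.chart hV).stalkMap x)

/-- The scheme `(X, j_* 𝒪_Y)`. -/
def scheme : Scheme.{0} :=
  LocallyRingedSpace.IsOpenImmersion.scheme T.space fun x ↦ by
    obtain ⟨V, hV, hx, -⟩ := exists_isAffineOpen_mem_and_subset (X := X) (x := x) (U := ⊤) trivial
    exact ⟨_, T.chartLRS hV, (T.mem_range_chart hV x).2 hx, T.chart_isOpenImmersion hV⟩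

/-- A function on the thickening that is invertible on `X` at a point is invertible at this point,
since the kernel of the restriction to `X` is nil. -/
lemma isUnit_germ_of_mem_basicOpen {V : X.Opens} (f : Γ(Y, preim j V)) {x : X}
    (hx : x ∈ X.basicOpen (T.res V f)) :
    IsUnit ((pushforwardSpace Y j).presheaf.germ V x (X.basicOpen_le _ hx) f) := by
  obtain ⟨W, hW, hxW, hle⟩ := exists_isAffineOpen_mem_and_subset hx
  have hWV : W ≤ V := le_trans hle (X.basicOpen_le _)
  let i : W ⟶ V := homOfLE hWV
  let f' : Γ(Y, preim j W) := Y.presheaf.map ((Opens.map j).map i).op f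
  have h1 : T.res W f' = X.presheaf.map i.op (T.res V f) :=
    congr(($(spanMap_naturality u ι T.isIso_app (T.preimage_eq V) (T.preimage_eq W) _ i.op)).hom f)
  have h2 : IsUnit (T.res W f') := by
    rw [h1]
    have h := (X.toRingedSpace.isUnit_res_basicOpen (T.res V f)).map
      (X.presheaf.map (homOfLE hle).op).hom
    have e : X.presheaf.map i.op (T.res V f) = X.presheaf.map (homOfLE hle).op
        (X.presheaf.map (homOfLE (X.basicOpen_le (T.res V f))).op (T.res V f)) :=
      congr(($(X.presheaf.map_comp (homOfLE (X.basicOpen_le (T.res V f))).op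
        (homOfLE hle).op)).hom (T.res V f))
    rw [e]
    exact h
  have h3 : IsUnit f' := by
    obtain ⟨v, hv⟩ := h2
    obtain ⟨g, hg⟩ := T.res_surjective hW (↑v⁻¹ : Γ(X, W))
    have h4 : IsNilpotent (f' * g - 1) := by
      refine T.isNilpotent W hW _ (T.res_eq_zero ?_)
      rw [map_sub, map_mul, map_one, hg, ← hv, Units.mul_inv, sub_self]
    have h5 : IsUnit (f' * g) := by
      have := h4.isUnit_one_add
      rwa [add_sub_cancel] at this
    exact isUnit_of_mul_isUnit_left h5
  have h6 : (pushforwardSpace Y j).presheaf.germ W x hxW f' =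
      (pushforwardSpace Y j).presheaf.germ V x (X.basicOpen_le _ hx) f :=
    (pushforwardSpace Y j).presheaf.germ_res_apply i x hxW f
  rw [← h6]
  exact h3.map ((pushforwardSpace Y j).presheaf.germ W x hxW).hom

/-- The morphism of ringed spaces from `X` to `(X, j_* 𝒪_Y)`. -/
def inclHom : X.toPresheafedSpace ⟶ (pushforwardSpace Y j).toPresheafedSpace where
  base := 𝟙 (X : TopCat)
  c :=
    { app V := T.res V.unop
      naturality _ _ _ := spanMap_naturality _ _ _ _ _ _ _ }

/-- The closed immersion of `X` into the scheme `(X, j_* 𝒪_Y)`. -/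
def incl : X ⟶ T.scheme where
  toLRSHom' :=
    { toHom := T.inclHom
      prop x := by
        refine ⟨fun a ha ↦ ?_⟩
        obtain ⟨V, hx, f, rfl⟩ := TopCat.Presheaf.exists_germ_eq _ a
        refine T.isUnit_germ_of_mem_basicOpen f ((X.mem_basicOpen _ x hx).2 ?_)
        exact (PresheafedSpace.stalkMap_germ_apply T.inclHom V x hx f) ▸ ha }

/-- The morphism from `Y` to the scheme `(X, j_* 𝒪_Y)`. -/
def map : Y ⟶ T.scheme where
  toLRSHom' :=
    { toHom := (toPushforwardSpace Y j).hom
      prop y := by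
        refine ⟨fun a ha ↦ ?_⟩
        obtain ⟨V, hx, f, rfl⟩ := TopCat.Presheaf.exists_germ_eq _ a
        refine T.isUnit_germ_of_mem_basicOpen f
          ((T.basicOpen_iff f y).1 ((Y.mem_basicOpen _ y hx).2 ?_))
        exact (PresheafedSpace.stalkMap_germ_apply (toPushforwardSpace Y j).hom V y hx f) ▸ ha }

lemma isIso_map_app (E : T.scheme.Opens) : IsIso (T.map.app E) :=
  inferInstanceAs (IsIso (𝟙 (Y.presheaf.obj (op ((Opens.map j).obj E)))))

lemma comp_map : u ≫ T.map = ι ≫ T.incl := by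
  refine Scheme.Hom.ext (TopCat.ext fun z ↦ T.comp_eq z) fun V ↦ ?_
  refine Eq.trans ?_ (T.res_app V).symm
  exact congrArg (· ≫ U.presheaf.map (eqToHom (T.preimage_eq V).symm).op)
    (Category.id_comp (u.app (preim j V)))

/-- The inclusion of `X` is the identity on spaces, and surjective on stalks because functions on
affine open subsets of `X` lift. -/
lemma isClosedImmersion_incl : IsClosedImmersion T.incl := by
  have h : SurjectiveOnStalks T.incl := by
    refine ⟨fun x a ↦ ?_⟩
    obtain ⟨V, hx, f, rfl⟩ := TopCat.Presheaf.exists_germ_eq _ a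
    obtain ⟨W, hW, hxW, hle⟩ := exists_isAffineOpen_mem_and_subset hx
    obtain ⟨g, hg⟩ := T.res_surjective hW (X.presheaf.map (homOfLE hle).op f)
    refine ⟨(pushforwardSpace Y j).presheaf.germ W x hxW g,
      (PresheafedSpace.stalkMap_germ_apply T.inclHom W x hxW g).trans ?_⟩
    refine (congrArg (X.presheaf.germ W x hxW) hg).trans ?_
    exact X.presheaf.germ_res_apply (homOfLE hle) x hxW f
  exact ⟨Topology.IsClosedEmbedding.id⟩

end IsThickeningSpan

/-- The ringed space `(X, j_* 𝒪_Y)` of a thickening span is a scheme, with a closed immersion of `X`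
that is the identity on the spaces. -/
theorem IsThickeningSpan.exists_scheme (T : IsThickeningSpan ι u j) :
    ∃ (Z : Scheme.{0}) (e : Z.toSheafedSpace ≅ pushforwardSpace Y j) (k : Y ⟶ Z) (i : X ⟶ Z),
      k.toLRSHom.toShHom ≫ e.hom = toPushforwardSpace Y j ∧
      i.base ≫ e.hom.hom.base = 𝟙 (X : TopCat) ∧
      u ≫ k = ι ≫ i ∧ IsClosedImmersion i ∧ Function.Bijective i ∧
      (∀ y, k y = i (j y)) ∧ ∀ E, IsIso (k.app E) := by
  refine ⟨T.scheme, Iso.refl _, T.map, T.incl, ?_, ?_, T.comp_map, T.isClosedImmersion_incl,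
    Function.bijective_id, fun _ ↦ rfl, T.isIso_map_app⟩
  · exact Category.comp_id _
  · exact Category.comp_id _

end Thickening

/-! ### The thickening span of a deformation -/

section ThickeningOfFibre

open Opposite

variable {X U : Scheme.{0}} {ι : U ⟶ X} [IsOpenImmersion ι] {s : X ⟶ Spec (.of ℂ)}
  {A : Type} [CommRing A] [Algebra ℂ A] [ArtC A] {D : Deformation (ι ≫ s) A}

omit [IsOpenImmersion ι] in
lemma isNoetherianRing_section [LocallyOfFiniteType s] {V : X.Opens} (hV : IsAffineOpen V) :
    IsNoetherianRing Γ(X, V) := by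
  have := LocallyOfFiniteType.isLocallyNoetherian s
  exact IsLocallyNoetherian.component_noetherian ⟨V, hV⟩

lemma isCompact_opens (s : X ⟶ Spec (.of ℂ)) [LocallyOfFiniteType s] [QuasiCompact s]
    (W : X.Opens) : IsCompact (W : Set X) := by
  have := LocallyOfFiniteType.isLocallyNoetherian s
  have : CompactSpace X := QuasiCompact.compactSpace_of_compactSpace s
  have : IsNoetherian X := {}
  exact NoetherianSpace.isCompact _

/-- `Γ(X, V) ⟶ Γ(U, ι ⁻¹ V)` is bijective for every open subset `V`. -/
lemma isIso_app_of_depth [LocallyOfFiniteType s] [QuasiCompact s] (hX : ∀ p : X, p ∉ Set.range ι →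
      3 ≤ depth (X.presheaf.stalk p) (X.presheaf.stalk p)) (V : X.Opens) : IsIso (ι.app V) := by
  let φ : X.sheaf ⟶ (TopCat.Sheaf.pushforward _ ι.base).obj U.sheaf := ⟨ι.c⟩
  have hφ : IsIso φ :=
    TopCat.Sheaf.isIso_iff_isIso_basis (φ := φ) (B := fun V : X.affineOpens ↦ V.1)
      (by rw [Subtype.range_coe]; exact X.isBasis_affineOpens) fun V ↦ by
        have := isNoetherianRing_section (s := s) V.2
        exact (ConcreteCategory.isIso_iff_bijective (ι.app V.1)).2
          (app_bijective_of_depth ι hX V.2 (isCompact_opens s))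
  exact inferInstanceAs (IsIso (((TopCat.Sheaf.forget _ _).map φ).app (op V)))

/-- The functions on a deformation of `U` over the preimage of an affine open subset `V` of `X` are
flat over `A`, and reduce to the functions on `V ∩ U` modulo the maximal ideal of `A`: as
`Γ(U, V ∩ U) = Γ(X, V)` has depth at least three outside `U`, there is no first cohomology. -/
lemma surjective_and_ker_structureModule [LocallyOfFiniteType s] [QuasiCompact s]
    (hX : ∀ p : X, p ∉ Set.range ι → 3 ≤ depth (X.presheaf.stalk p) (X.presheaf.stalk p))
    {V : X.Opens} (hV : IsAffineOpen V) :
    Function.Surjective (D.incl.app (preimageTotal ι D V)) ∧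
    (∀ f : Γ(D.total, preimageTotal ι D V), D.incl.app _ f = 0 →
      f ∈ (IsLocalRing.maximalIdeal A).map (algA D.proj (preimageTotal ι D V))) ∧
    (algA D.proj (preimageTotal ι D V)).Flat := by
  have hφ := isFibreRestriction_structureModule D
  have := isNoetherianRing_section (s := s) hV
  have hW := hφ.h1Vanishes (isCompact_opens s) hV
    (hasRegularTriple_pushforward_structureModule ι hX hV (isCompact_opens s))
  have h := hφ.surjective_and_ker hW
  refine ⟨h.1, fun f hf ↦ ?_, ?_⟩
  · have h2 := h.2 f hf
    have h3 : (IsLocalRing.maximalIdeal A).map (algA D.proj (preimageTotal ι D V)) •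
        (⊤ : Ideal Γ(D.total, preimageTotal ι D V)) =
        (IsLocalRing.maximalIdeal A).map (algA D.proj (preimageTotal ι D V)) := by
      rw [smul_eq_mul, Ideal.mul_top]
    rw [← h3]
    exact h2
  · exact hφ.isTensorBasis.flat_sections (hφ.h1Vanishes_tensor_residueField hW)

lemma isThickeningSpan [LocallyOfFiniteType s] [QuasiCompact s]
    (hX : ∀ p : X, p ∉ Set.range ι → 3 ≤ depth (X.presheaf.stalk p) (X.presheaf.stalk p)) :
    IsThickeningSpan ι D.incl (spaceMap ι D) where
  comp_eq := spaceMap_incl ι D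
  surj := D.isHomeomorph_incl.surjective
  isIso_app := isIso_app_of_depth (s := s) hX
  app_surjective V hV := (surjective_and_ker_structureModule hX hV).1
  isNilpotent V hV f hf := by
    obtain ⟨n, hn⟩ := isNilpotent_map_maximalIdeal (algA D.proj (preimageTotal ι D V))
    have h := Ideal.pow_mem_pow ((surjective_and_ker_structureModule hX hV).2.1 f hf) n
    rw [hn] at h
    exact ⟨n, h⟩
  noetherianSpace := (noetherianSpace_iff_opens _).2
    fun W ↦ by
      rw [(isOpenEmbedding_spaceMap ι D).isInducing.isCompact_iff]
      exact isCompact_opens s ⟨_, (isOpenEmbedding_spaceMap ι D).isOpenMap _ W.isOpen⟩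

end ThickeningOfFibre

/-! ### The extended deformation: the pullback square -/

section Extension

open Opposite

variable {X U Z : Scheme.{0}} {ι : U ⟶ X} {s : X ⟶ Spec (.of ℂ)}
  {A : Type} [CommRing A] [Algebra ℂ A] [ArtC A] {D : Deformation (ι ≫ s) A}

/-- A scheme `Z` with maps from a deformation of `U` and from `X` that identify it with the space `X`
equipped with the direct image of the structure sheaf of the deformation. -/
structure IsExtension (k : D.total ⟶ Z) (i : X ⟶ Z) : Prop where
  comm : D.incl ≫ k = ι ≫ i
  isClosedImmersion : IsClosedImmersion i
  bijective : Function.Bijective i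
  apply_eq (y : D.total) : k y = i (spaceMap ι D y)
  isIso_app (E : Z.Opens) : IsIso (k.app E)

/-- A morphism to an affine scheme is given by a map on global functions. -/
lemma exists_appTop_eq {S : Scheme.{0}} [IsAffine S] (φ : Γ(S, ⊤) ⟶ Γ(Z, ⊤)) :
    ∃ f : Z ⟶ S, f.appTop = φ := by
  refine ⟨Z.toSpecΓ ≫ Spec.map φ ≫ inv S.toSpecΓ, ?_⟩
  have h : S.toSpecΓ.appTop = (Scheme.ΓSpecIso Γ(S, ⊤)).hom := Scheme.toSpecΓ_appTop S
  have h2 : (inv S.toSpecΓ).appTop ≫ (Scheme.ΓSpecIso Γ(S, ⊤)).hom = 𝟙 _ := by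
    rw [← h, ← Scheme.Hom.comp_appTop, IsIso.hom_inv_id, Scheme.Hom.id_appTop]
  rw [Scheme.Hom.comp_appTop, Scheme.Hom.comp_appTop, Scheme.toSpecΓ_appTop,
    Category.assoc, Scheme.ΓSpecIso_naturality, ← Category.assoc, h2, Category.id_comp]

namespace IsExtension

variable {k : D.total ⟶ Z} {i : X ⟶ Z} (h : IsExtension k i)
include h

lemma exists_proj : ∃ p : Z ⟶ Spec (.of A), k ≫ p = D.proj := by
  -- the ring `A` acts on the functions of `Z`, which are those of the deformation of `U`
  have : IsIso k.appTop := h.isIso_app ⊤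
  obtain ⟨p, hp⟩ := exists_appTop_eq (Z := Z) (D.proj.appTop ≫ inv k.appTop)
  refine ⟨p, ext_of_isAffine ?_⟩
  rw [Scheme.Hom.comp_appTop, hp, Category.assoc, IsIso.inv_hom_id, Category.comp_id]

lemma preimage_eq (E : Z.Opens) : k ⁻¹ᵁ E = preimageTotal ι D (i ⁻¹ᵁ E) :=
  Opens.ext (Set.ext fun y ↦ iff_of_eq (congrArg (· ∈ E) (h.apply_eq y)))

lemma isAffineOpen_preimage {E : Z.Opens} (hE : IsAffineOpen E) : IsAffineOpen (i ⁻¹ᵁ E) :=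
  have := h.isClosedImmersion
  hE.preimage i

lemma incl_app_eq_zero {E : Z.Opens} {f : Γ(Z, E)} (hf : i.app E f = 0) :
    D.incl.app (k ⁻¹ᵁ E) (k.app E f) = 0 := by
  have h1 : D.incl.app (k ⁻¹ᵁ E) (k.app E f) = (D.incl ≫ k).app E f :=
    congr(($(Scheme.Hom.comp_app D.incl k E)).hom f).symm
  have h2 : (ι ≫ i).app E f = 0 := by
    rw [Scheme.Hom.comp_app]
    exact (congrArg (ι.app (i ⁻¹ᵁ E)) hf).trans (map_zero _)
  rw [h1]
  have h3 := Scheme.Hom.congr_app h.comm E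
  have h4 := congr(($h3).hom f)
  refine h4.trans ?_
  exact (congrArg _ h2).trans (map_zero (U.presheaf.map _).hom)

variable {p : Z ⟶ Spec (.of A)} (hp : k ≫ p = D.proj)
include hp

omit h in
lemma app_algA (E : Z.Opens) (a : A) : k.app E (algA p E a) = algA D.proj (k ⁻¹ᵁ E) a := by
  rw [app_algA_comp, hp]

lemma flat_algA {E : Z.Opens} (hW : (algA D.proj (k ⁻¹ᵁ E)).Flat) : (algA p E).Flat := by
  have := h.isIso_app E
  have h1 : algA p E = (inv (k.app E)).hom.comp (algA D.proj (k ⁻¹ᵁ E)) := by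
    ext a
    rw [RingHom.comp_apply, ← app_algA hp]
    exact congr(($(IsIso.hom_inv_id (k.app E))).hom (algA p E a)).symm
  rw [h1]
  exact hW.comp (.of_bijective (ConcreteCategory.bijective_of_isIso (inv (k.app E))))

lemma mem_map_of_app {E : Z.Opens} {I : Ideal A} {f : Γ(Z, E)}
    (hf : k.app E f ∈ I.map (algA D.proj (k ⁻¹ᵁ E))) : f ∈ I.map (algA p E) := by
  have := h.isIso_app E
  have h1 := Ideal.mem_map_of_mem (inv (k.app E)).hom hf
  rw [Ideal.map_map] at h1
  have h2 : (inv (k.app E)).hom.comp (algA D.proj (k ⁻¹ᵁ E)) = algA p E := by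
    ext a
    rw [RingHom.comp_apply, ← app_algA hp]
    exact congr(($(IsIso.hom_inv_id (k.app E))).hom (algA p E a))
  rw [h2] at h1
  have h3 : (inv (k.app E)).hom (k.app E f) = f :=
    congr(($(IsIso.hom_inv_id (k.app E))).hom f)
  rwa [h3] at h1

variable [IsOpenImmersion ι] [LocallyOfFiniteType s] [QuasiCompact s]
    (hX : ∀ p : X, p ∉ Set.range ι → 3 ≤ depth (X.presheaf.stalk p) (X.presheaf.stalk p))
include hX

/-- The structure morphisms agree on `X` because they agree on `U` and functions on `X` are
functions on `U`. -/
lemma incl_comp_proj : i ≫ p = s ≫ Spec.map (CommRingCat.ofHom (augmentation A)) := by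
  have h1 : IsIso ι.appTop := isIso_app_of_depth (s := s) hX ⊤
  have h2 : ι ≫ i ≫ p = ι ≫ s ≫ Spec.map (CommRingCat.ofHom (augmentation A)) := by
    rw [← Category.assoc, ← h.comm, Category.assoc, hp, D.isPullback.w, Category.assoc]
  refine ext_of_isAffine ?_
  rw [← cancel_mono ι.appTop, ← Scheme.Hom.comp_appTop, ← Scheme.Hom.comp_appTop, h2]

/-- Functions on affine open subsets of `Z` that vanish on `X` are generated by the maximal ideal of
`A`. -/
lemma ker_incl_le {E : Z.Opens} (hE : IsAffineOpen E) :
    RingHom.ker (i.app E).hom ≤ (IsLocalRing.maximalIdeal A).map (algA p E) := by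
  intro f hf
  refine h.mem_map_of_app hp ?_
  have h1 := h.incl_app_eq_zero hf
  revert h1
  generalize k.app E f = g
  revert g
  rw [h.preimage_eq E]
  exact (surjective_and_ker_structureModule hX (h.isAffineOpen_preimage hE)).2.1

lemma flat_section {E : Z.Opens} (hE : IsAffineOpen E) : (algA p E).Flat := by
  refine h.flat_algA hp ?_
  rw [h.preimage_eq E]
  exact (surjective_and_ker_structureModule hX (h.isAffineOpen_preimage hE)).2.2

/-- A morphism to `Z` that lies over the closed point of `Spec A` kills the ideal of `X`. -/
lemma ker_incl_le_ker {T : Scheme.{0}} {a : T ⟶ Z} (b : T ⟶ Spec (.of ℂ))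
    (hab : a ≫ p = b ≫ Spec.map (CommRingCat.ofHom (augmentation A))) : i.ker ≤ a.ker := by
  refine Scheme.IdealSheafData.le_ofIdeals_iff.2 fun E ↦ (i.ideal_ker_le E).trans
    ((h.ker_incl_le hp hX E.2).trans (Ideal.map_le_iff_le_comap.2 fun x hx ↦ ?_))
  rw [Ideal.mem_comap, RingHom.mem_ker]
  refine (app_algA_comp a p E.1 x).trans ?_
  rw [hab]
  exact algA_augmentation_eq_zero b hx _

/-- The closed subscheme `X` is the closed fibre of `Z`: a morphism to `Z` over the closed point of
`Spec A` factors through `X`, as the ideal of `X` is generated by the maximal ideal of `A`. -/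
lemma isPullback : IsPullback i s p (Spec.map (CommRingCat.ofHom (augmentation A))) := by
  have h1 : IsClosedImmersion (Spec.map (CommRingCat.ofHom (augmentation A))) :=
    IsClosedImmersion.spec_of_surjective _ (augmentation_surjective A)
  have h2 := h.isClosedImmersion
  refine ⟨⟨h.incl_comp_proj hp hX⟩, ⟨Limits.PullbackCone.IsLimit.mk _ (fun c ↦
    IsClosedImmersion.lift i c.fst (h.ker_incl_le_ker hp hX c.snd c.condition)) (fun c ↦ ?_)
    (fun c ↦ ?_) fun c m hm _ ↦ ?_⟩⟩
  · exact IsClosedImmersion.lift_fac _ _ _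
  · rw [← cancel_mono (Spec.map (CommRingCat.ofHom (augmentation A))), Category.assoc,
      ← h.incl_comp_proj hp hX, IsClosedImmersion.lift_fac_assoc, c.condition]
  · rw [← cancel_mono i, IsClosedImmersion.lift_fac, hm]

end IsExtension

end Extension

/-! ### The extended deformation: flatness, finiteness and separatedness -/

/-- Generators of an algebra modulo a nilpotent ideal of the base ring can be lifted. -/
lemma finiteType_of_surjective_of_nilpotent {A R S : Type*} [CommRing A] [CommRing R] [CommRing S]
    {f : A →+* R} {g : R →+* S} (hg : Function.Surjective g) {I : Ideal A} (hI : IsNilpotent I)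
    (hker : RingHom.ker g ≤ I.map f) (h : (g.comp f).FiniteType) : f.FiniteType := by
  classical
  let := f.toAlgebra
  let := (g.comp f).toAlgebra
  let g' : R →ₐ[A] S := { g with commutes' := fun _ ↦ rfl }
  obtain ⟨T, hT⟩ := (show Algebra.FiniteType A S from h).out
  choose r hr using hg
  refine (show Algebra.FiniteType A R from ⟨⟨T.image r, ?_⟩⟩)
  rw [← Algebra.toSubmodule_eq_top]
  refine eq_top_of_sup_smul_top hI (top_le_iff.1 fun x _ ↦ ?_)
  have h1 : Subalgebra.map g' (Algebra.adjoin A (T.image r : Set R)) = ⊤ := by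
    rw [AlgHom.map_adjoin, Finset.coe_image, ← Set.image_comp, ← hT]
    congr 1
    exact (Set.image_congr fun t _ ↦ hr t).trans (Set.image_id _)
  obtain ⟨y, hy, hxy⟩ : g x ∈ Subalgebra.map g' (Algebra.adjoin A (T.image r : Set R)) :=
    h1 ▸ trivial
  rw [← add_sub_cancel y x]
  refine Submodule.add_mem_sup hy ?_
  rw [Ideal.smul_top_eq_map]
  refine hker ?_
  rw [RingHom.mem_ker, map_sub, sub_eq_zero]
  exact hxy.symm

/-- A morphism is separated if it is so on a closed subscheme with the same underlying space: the
diagonal has the same image. -/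
lemma IsSeparated.of_comp_closedImmersion {X Z S : Scheme.{0}} (i : X ⟶ Z) [IsClosedImmersion i]
    (hi : Function.Surjective i) (p : Z ⟶ S) (h : IsSeparated (i ≫ p)) : IsSeparated p := by
  let m := Limits.pullback.map (i ≫ p) (i ≫ p) p p i i (𝟙 _) (by simp) (by simp)
  have hm : UniversallyClosed m := by
    exact MorphismProperty.pullbackMap (P := @UniversallyClosed) (i₁ := i) (i₂ := i) (f := i ≫ p)
      (f' := p) (g := i ≫ p) (g' := p) inferInstance inferInstance rfl rfl
  have hd : Limits.pullback.diagonal (i ≫ p) ≫ m = i ≫ Limits.pullback.diagonal p := by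
    apply Limits.pullback.hom_ext
    · rw [Category.assoc, show m ≫ Limits.pullback.fst p p = Limits.pullback.fst _ _ ≫ i from
        Limits.pullback.lift_fst _ _ _, Limits.pullback.diagonal_fst_assoc, Category.assoc,
        Limits.pullback.diagonal_fst, Category.comp_id]
    · rw [Category.assoc, show m ≫ Limits.pullback.snd p p = Limits.pullback.snd _ _ ≫ i from
        Limits.pullback.lift_snd _ _ _, Limits.pullback.diagonal_snd_assoc, Category.assoc,
        Limits.pullback.diagonal_snd, Category.comp_id]
  refine ⟨IsClosedImmersion.of_isPreimmersion _ ?_⟩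
  -- the map `X ×_S X ⟶ Z ×_S Z` is closed and takes the diagonal of `X` onto that of `Z`
  have h1 : IsClosed (m '' Set.range (Limits.pullback.diagonal (i ≫ p))) :=
    m.isClosedMap _ (Limits.pullback.diagonal (i ≫ p)).isClosedEmbedding.isClosed_range
  have h2 : m '' Set.range (Limits.pullback.diagonal (i ≫ p)) =
      Set.range (Limits.pullback.diagonal p) := by
    ext z
    constructor
    · rintro ⟨_, ⟨x, rfl⟩, rfl⟩
      exact ⟨i x, congr(($hd).base x).symm⟩
    · rintro ⟨y, rfl⟩
      obtain ⟨x, rfl⟩ := hi y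
      exact ⟨_, ⟨x, rfl⟩, congr(($hd).base x)⟩
  rwa [h2] at h1

section Extension

variable {X U Z : Scheme.{0}} {ι : U ⟶ X} {s : X ⟶ Spec (.of ℂ)}
  {A : Type} [CommRing A] [Algebra ℂ A] [ArtC A] {D : Deformation (ι ≫ s) A}

lemma appLE_eq_algA {A : Type} [CommRing A] {Y : Scheme.{0}} (f : Y ⟶ Spec (.of A))
    (V : Y.Opens) : (f.appLE ⊤ V le_top).hom =
      (algA f V).comp (Scheme.ΓSpecIso (.of A)).hom.hom := by
  ext a
  exact congr((f.appLE ⊤ V le_top).hom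
    ($((Scheme.ΓSpecIso (.of A)).hom_inv_id.symm).hom a))

namespace IsExtension

variable {k : D.total ⟶ Z} {i : X ⟶ Z} (h : IsExtension k i)
  {p : Z ⟶ Spec (.of A)} (hp : k ≫ p = D.proj)
  [IsOpenImmersion ι] [LocallyOfFiniteType s] [QuasiCompact s]
    (hX : ∀ p : X, p ∉ Set.range ι → 3 ≤ depth (X.presheaf.stalk p) (X.presheaf.stalk p))
include h hp hX

lemma flat_proj : Flat p := by
  refine HasRingHomProperty.of_iSup_eq_top (P := @Flat) (fun V : Z.affineOpens ↦ V)
    (iSup_affineOpens_eq_top _) fun V ↦ ?_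
  rw [appLE_eq_algA]
  exact RingHom.Flat.comp (.of_bijective (ConcreteCategory.bijective_of_isIso
    (Scheme.ΓSpecIso (.of A)).hom)) (h.flat_section hp hX V.2)

lemma locallyOfFiniteType_proj : LocallyOfFiniteType p := by
  have := h.isClosedImmersion
  refine HasRingHomProperty.of_iSup_eq_top (P := @LocallyOfFiniteType) (fun V : Z.affineOpens ↦ V)
    (iSup_affineOpens_eq_top _) fun V ↦ ?_
  rw [appLE_eq_algA]
  refine RingHom.FiniteType.comp ?_ (.of_surjective _ (ConcreteCategory.bijective_of_isIso
    (Scheme.ΓSpecIso (.of A)).hom).2)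
  refine finiteType_of_surjective_of_nilpotent (g := (i.app V.1).hom) ?_
    ((isArtinianRing_iff_isNilpotent_maximalIdeal A).1 inferInstance) (h.ker_incl_le hp hX V.2) ?_
  · exact i.app_surjective V.1 V.2
  · have h1 : (i.app V.1).hom.comp (algA p V.1) = algA (i ≫ p) (i ⁻¹ᵁ V.1) :=
      RingHom.ext (app_algA_comp i p V.1)
    rw [h1, h.incl_comp_proj hp hX]
    have h2 : LocallyOfFiniteType (Spec.map (CommRingCat.ofHom (augmentation A))) :=
      HasRingHomProperty.Spec_iff.2 (.of_surjective _ (augmentation_surjective A))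
    have h3 := (s ≫ Spec.map (CommRingCat.ofHom (augmentation A))).finiteType_appLE
      (isAffineOpen_top _) (h.isAffineOpen_preimage V.2) le_top
    have h4 := RingHom.FiniteType.comp h3 (.of_surjective _ (ConcreteCategory.bijective_of_isIso
      (Scheme.ΓSpecIso (.of A)).inv).2)
    exact h4

omit hX [IsOpenImmersion ι] [LocallyOfFiniteType s] hp in
lemma quasiCompact_proj : QuasiCompact p := by
  have : CompactSpace X := QuasiCompact.compactSpace_of_compactSpace s
  have : CompactSpace Z := ⟨by
    rw [← h.bijective.2.range_eq]
    exact isCompact_range i.continuous⟩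
  exact (quasiCompact_iff_compactSpace p).2 inferInstance

lemma isSeparated_proj (hs : IsSeparated s) : IsSeparated p := by
  have := h.isClosedImmersion
  refine IsSeparated.of_comp_closedImmersion i h.bijective.2 p ?_
  rw [h.incl_comp_proj hp hX]
  infer_instance

/-- The extension of a deformation of `U` to a deformation of `X`. -/
def deformation : Deformation s A where
  total := Z
  proj := p
  incl := i
  flat := h.flat_proj hp hX
  isPullback := h.isPullback hp hX

end IsExtension

end Extension

/-! ### Coherence of the direct image -/

section Restriction

open Opposite

variable {X U : Scheme.{0}} {ι : U ⟶ X} [IsOpenImmersion ι] {s : X ⟶ Spec (.of ℂ)}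
  [LocallyOfFiniteType s] [QuasiCompact s]
  {A : Type} [CommRing A] [Algebra ℂ A] [ArtC A] {D : Deformation (ι ≫ s) A}
  {F : D.total.Modules} (hF : IsCoherent F) (hFflat : IsFlatSheaf (toSheafModule D.proj F))
  (hFdepth : ∀ p : X, p ∉ Set.range ι →
      Module.Finite (X.presheaf.stalk p)
        (((Scheme.Modules.pushforward ι).obj
          ((Scheme.Modules.pullback D.incl).obj F)).presheaf.stalk p) ∧
      3 ≤ depth (X.presheaf.stalk p)
        (((Scheme.Modules.pushforward ι).obj
          ((Scheme.Modules.pullback D.incl).obj F)).presheaf.stalk p))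
include hF hFflat hFdepth

/-- The restriction of `F` to the closed fibre has no first cohomology over the preimage of an affine
open subset of `X`. -/
lemma h1Vanishes_preimageTotal {V : X.Opens} (hV : IsAffineOpen V) :
    H1Vanishes (preimageTotal ι D V) (toSheafModule D.proj ((Scheme.Modules.pushforward D.incl).obj
      ((Scheme.Modules.pullback D.incl).obj F))) := by
  have hφ := isFibreRestriction_unit D hF.1 hFflat
  have := isNoetherianRing_section (s := s) hV
  exact hφ.h1Vanishes (isCompact_opens s) hV fun x hx ↦
    (hφ.localizesOn_pushforward (isCompact_opens s) V).hasRegularTriple hV x (hFdepth x.1 hx).2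

lemma h1Vanishes_tensor_preimageTotal {V : X.Opens} (hV : IsAffineOpen V) :
    H1Vanishes (preimageTotal ι D V) (tensor (toSheafModule D.proj F)
      (.of A (A ⧸ IsLocalRing.maximalIdeal A))) :=
  (isFibreRestriction_unit D hF.1 hFflat).h1Vanishes_tensor_residueField
    (h1Vanishes_preimageTotal (s := s) hF hFflat hFdepth hV)

omit hFdepth hFflat [IsOpenImmersion ι] [LocallyOfFiniteType s] [QuasiCompact s] in
/-- The restriction of a coherent module to the closed fibre has finitely generated sections. -/
lemma finite_pullback {V : D.total.Opens} (hV : IsAffineOpen V) :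
    Module.Finite Γ(U, D.incl ⁻¹ᵁ V)
      Γ((Scheme.Modules.pullback D.incl).obj F, D.incl ⁻¹ᵁ V) := by
  have h := (LocalizesOn.pbUnit_surjective_and_ker D.incl (.of_isQuasicoherent hF.1 hV) hV
    (D.isAffineOpen_preimage hV) (D.app_surjective hV)).1
  obtain ⟨T, hT⟩ := (hF.finite hV).fg_top
  classical
  refine ⟨T.image (pbUnit D.incl F V), top_le_iff.1 fun m _ ↦ ?_⟩
  obtain ⟨n, rfl⟩ := h m
  have hn : n ∈ Submodule.span Γ(D.total, V) (T : Set Γ(F, V)) := hT ▸ Submodule.mem_top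
  induction hn using Submodule.span_induction with
  | mem t ht => exact Submodule.subset_span (Finset.mem_coe.2 (Finset.mem_image_of_mem _ ht))
  | zero => rw [map_zero]; exact zero_mem _
  | add x y _ _ hx hy => rw [map_add]; exact add_mem (hx trivial) (hy trivial)
  | smul r x _ hx => rw [pbUnit_smul]; exact Submodule.smul_mem _ _ (hx trivial)

lemma pbUnit_surjective_and_ker_preimageTotal {V : X.Opens} (hV : IsAffineOpen V) :
    Function.Surjective (pbUnit D.incl F (preimageTotal ι D V)) ∧
    ∀ n : Γ(F, preimageTotal ι D V), pbUnit D.incl F (preimageTotal ι D V) n = 0 →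
      n ∈ (IsLocalRing.maximalIdeal A).map (algA D.proj (preimageTotal ι D V)) •
      (⊤ : Submodule Γ(D.total, preimageTotal ι D V) Γ(F, preimageTotal ι D V)) :=
  (isFibreRestriction_unit D hF.1 hFflat).surjective_and_ker
    (h1Vanishes_preimageTotal (s := s) hF hFflat hFdepth hV)

/-- The sections of `F` over the preimage of an affine open subset of `X` form a finite module. -/
lemma finite_section_preimageTotal
    (hX : ∀ p : X, p ∉ Set.range ι → 3 ≤ depth (X.presheaf.stalk p) (X.presheaf.stalk p))
    {V : X.Opens} (hV : IsAffineOpen V) :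
    Module.Finite Γ(D.total, preimageTotal ι D V) Γ(F, preimageTotal ι D V) := by
  have hφ := isFibreRestriction_unit D hF.1 hFflat
  have := isNoetherianRing_section (s := s) hV
  have h := pbUnit_surjective_and_ker_preimageTotal (s := s) hF hFflat hFdepth hV
  exact finite_preimageTotal _ (hφ.finite_pushforward (isCompact_opens s)
    (fun hE ↦ finite_pullback hF hE) (fun p hp ↦ (hFdepth p hp).1) hV)
    (surjective_and_ker_structureModule hX hV).1 h.1 h.2

namespace IsExtension

variable {Z : Scheme.{0}} {k : D.total ⟶ Z} {i : X ⟶ Z} (h : IsExtension k i)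
include h

omit h [IsOpenImmersion ι] [LocallyOfFiniteType s] [QuasiCompact s] hFflat hFdepth in
lemma localizesOn_pushforward (hc : ∀ W : D.total.Opens, IsCompact (W : Set D.total)) (E : Z.Opens) :
    LocalizesOn ((Scheme.Modules.pushforward k).obj F) E :=
  LocalizesOn.pushforward k (LocalizesOn.of_isBasis D.total.isBasis_affineOpens
    (fun _ hV ↦ .of_isQuasicoherent hF.1 hV) fun W _ ↦ hc W)

lemma isCoherent_pushforward
    (hX : ∀ p : X, p ∉ Set.range ι → 3 ≤ depth (X.presheaf.stalk p) (X.presheaf.stalk p)) :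
    IsCoherent ((Scheme.Modules.pushforward k).obj F) := by
  have := (isThickeningSpan (D := D) hX).noetherianSpace
  refine isCoherent_of_localizesOn (fun E : Z.affineOpens ↦ E.1) (iSup_affineOpens_eq_top _)
    (fun E ↦ E.2) (fun E ↦ localizesOn_pushforward hF (fun W ↦ NoetherianSpace.isCompact _) E.1)
    fun E ↦ ?_
  have h1 : Module.Finite Γ(D.total, k ⁻¹ᵁ E.1) Γ(F, k ⁻¹ᵁ E.1) := by
    rw [h.preimage_eq]
    exact finite_section_preimageTotal (s := s) hF hFflat hFdepth hX (h.isAffineOpen_preimage E.2)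
  have := h.isIso_app E.1
  exact finite_pushforward_of_surjective k F E.1
    (ConcreteCategory.bijective_of_isIso (k.app E.1)).2

end IsExtension

end Restriction

/-! ### Base change to the closed fibre -/

section BaseChange

open Opposite

lemma isIso_of_bijective_appM {X : Scheme.{0}} {M N : X.Modules} (φ : M ⟶ N) {B : Set X.Opens}
    (hB : Opens.IsBasis B) (h : ∀ V ∈ B, Function.Bijective (appM φ V)) : IsIso φ := by
  let F : TopCat.Sheaf Ab.{0} X := ⟨M.presheaf, M.isSheaf⟩
  let G : TopCat.Sheaf Ab.{0} X := ⟨N.presheaf, N.isSheaf⟩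
  let ψ : F ⟶ G := ⟨φ.mapPresheaf⟩
  have hψ : IsIso ψ := TopCat.Sheaf.isIso_iff_isIso_basis (φ := ψ) (B := fun V : B ↦ V.1)
    (by rwa [Subtype.range_coe]) fun V ↦
      (ConcreteCategory.isIso_iff_bijective (φ.app V.1)).2 (h V.1 V.2)
  exact Scheme.Modules.Hom.isIso_iff_isIso_app.2 fun V ↦
    inferInstanceAs (IsIso (((TopCat.Sheaf.forget _ _).map ψ).app (op V)))

/-- The base change morphism on the sections that come from sections of `k_* F`. -/
lemma appM_baseChange_pbUnit {U V X W : Scheme.{0}} {a : U ⟶ V} {k : V ⟶ W} {b : U ⟶ X}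
    {c : X ⟶ W} (h : a ≫ k = b ≫ c) (F : V.Modules) (E : W.Opens) (n : Γ(F, k ⁻¹ᵁ E)) :
    appM (baseChange h F) (c ⁻¹ᵁ E) (pbUnit c ((Scheme.Modules.pushforward k).obj F) E n) =
      resM ((Scheme.Modules.pullback a).obj F)
        (show b ⁻¹ᵁ c ⁻¹ᵁ E ≤ a ⁻¹ᵁ k ⁻¹ᵁ E by
          rw [← Scheme.Hom.comp_preimage, ← Scheme.Hom.comp_preimage, h])
        (pbUnit a F (k ⁻¹ᵁ E) n) := by
  have h1 := Adjunction.homEquiv_unit (Scheme.Modules.pullbackPushforwardAdjunction c) _ _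
    (baseChange h F)
  rw [baseChange, Equiv.apply_symm_apply] at h1
  have h2 := congr(appM $h1 E n)
  exact h2.symm

variable {X U : Scheme.{0}} {ι : U ⟶ X} [IsOpenImmersion ι] {s : X ⟶ Spec (.of ℂ)}
  [LocallyOfFiniteType s] [QuasiCompact s]
  {A : Type} [CommRing A] [Algebra ℂ A] [ArtC A] {D : Deformation (ι ≫ s) A}
  {F : D.total.Modules} (hF : IsCoherent F) (hFflat : IsFlatSheaf (toSheafModule D.proj F))
  (hFdepth : ∀ p : X, p ∉ Set.range ι →
      Module.Finite (X.presheaf.stalk p)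
        (((Scheme.Modules.pushforward ι).obj
          ((Scheme.Modules.pullback D.incl).obj F)).presheaf.stalk p) ∧
      3 ≤ depth (X.presheaf.stalk p)
        (((Scheme.Modules.pushforward ι).obj
          ((Scheme.Modules.pullback D.incl).obj F)).presheaf.stalk p))

omit [LocallyOfFiniteType s] [QuasiCompact s] in
/-- The sections of `F` over the preimage of an affine open subset that vanish on the closed fibre
vanish in the restriction of `k_* F` to `X`. -/
lemma pbUnit_eq_zero_of_mem {Z V : Scheme.{0}} {k : V ⟶ Z} {i : X ⟶ Z} {p : Z ⟶ Spec (.of A)}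
    (hip : i ≫ p = s ≫ Spec.map (CommRingCat.ofHom (augmentation A))) {F : V.Modules}
    (E : Z.Opens) (n : Γ(F, k ⁻¹ᵁ E)) (hn : n ∈ (IsLocalRing.maximalIdeal A).map
      (algA (k ≫ p) (k ⁻¹ᵁ E)) • (⊤ : Submodule Γ(V, k ⁻¹ᵁ E) Γ(F, k ⁻¹ᵁ E))) :
    pbUnit i ((Scheme.Modules.pushforward k).obj F) E n = 0 := by
  rw [mem_map_smul_top_iff] at hn
  refine Submodule.smul_induction_on
    (p := fun n : (toSheafModule (k ≫ p) F).obj.obj (op (k ⁻¹ᵁ E)) ↦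
      pbUnit i ((Scheme.Modules.pushforward k).obj F) E n = 0) hn
    (fun a ha m _ ↦ ?_) fun x y hx hy ↦ ?_
  · have h1 : (a • m : (toSheafModule (k ≫ p) F).obj.obj (op (k ⁻¹ᵁ E))) =
        (show Γ((Scheme.Modules.pushforward k).obj F, E) from
          algA p E a • (show Γ((Scheme.Modules.pushforward k).obj F, E) from m)) :=
      congrArg (· • (show Γ(F, k ⁻¹ᵁ E) from m)) (app_algA_comp k p E a).symm
    refine (congrArg _ h1).trans ((pbUnit_smul _ _ _ _ _).trans ?_)
    rw [app_algA_comp, hip, algA_augmentation_eq_zero s ha, zero_smul]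
  · refine (map_add (pbUnit i ((Scheme.Modules.pushforward k).obj F) E) x y).trans ?_
    exact (congrArg₂ (· + ·) hx hy).trans (add_zero _)

namespace IsExtension

variable {Z : Scheme.{0}} {k : D.total ⟶ Z} {i : X ⟶ Z} (h : IsExtension k i)
  {p : Z ⟶ Spec (.of A)} (hp : k ≫ p = D.proj)
  (hX : ∀ p : X, p ∉ Set.range ι → 3 ≤ depth (X.presheaf.stalk p) (X.presheaf.stalk p))
include h hp hX hF hFflat hFdepth

/-- The restriction of `k_* F` to `X` is `ι_* (F|_U)`: over an affine open set `E` both have the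
sections of `F` over `k⁻¹ E` modulo the maximal ideal of `A`. -/
lemma isIso_baseChange : IsIso (baseChange h.comm F) := by
  have := h.isClosedImmersion
  have := (isThickeningSpan (D := D) hX).noetherianSpace
  refine isIso_of_bijective_appM _ (B := {V | ∃ E, IsAffineOpen E ∧ V = i ⁻¹ᵁ E}) ?_ ?_
  · rw [Opens.isBasis_iff_nbhd]
    intro W x hx
    obtain ⟨W', hW', h⟩ := i.isClosedEmbedding.isInducing.isOpen_iff.1 W.isOpen
    obtain ⟨V, hV, hxV, hVW⟩ := Opens.isBasis_iff_nbhd.1 Z.isBasis_affineOpens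
      (U := ⟨W', hW'⟩) (x := i x) (show x ∈ i ⁻¹' W' from h ▸ hx)
    exact ⟨_, ⟨V, hV, rfl⟩, hxV, fun y hy ↦
      (show y ∈ (W : Set X) from h ▸ (show y ∈ i ⁻¹' W' from hVW hy))⟩
  · rintro _ ⟨E, hE, rfl⟩
    have hb := appM_baseChange_pbUnit h.comm F E
    have h1 := (localizesOn_pushforward (k := k) hF (fun W ↦ NoetherianSpace.isCompact _)
      E).pbUnit_surjective_and_ker i hE (h.isAffineOpen_preimage hE) (i.app_surjective E hE)
    have h2 := pbUnit_surjective_and_ker_preimageTotal (s := s) hF hFflat hFdepth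
      (h.isAffineOpen_preimage hE)
    rw [← h.preimage_eq] at h2
    have e1 : ι ⁻¹ᵁ i ⁻¹ᵁ E = D.incl ⁻¹ᵁ k ⁻¹ᵁ E := by
      rw [← Scheme.Hom.comp_preimage, ← Scheme.Hom.comp_preimage, h.comm]
    constructor
    · refine (injective_iff_map_eq_zero _).2 fun x hx ↦ ?_
      obtain ⟨n, rfl⟩ := h1.1 x
      refine pbUnit_eq_zero_of_mem (h.incl_comp_proj hp hX) E n ?_
      rw [hp]
      refine h2.2 n ?_
      have h3 := (hb n).symm.trans hx
      have h4 := congr(resM ((Scheme.Modules.pullback D.incl).obj F) e1.ge $h3)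
      exact ((resM_self _ _).symm.trans (resM_resM _ _ _ _).symm).trans
        (h4.trans (map_zero (resM ((Scheme.Modules.pullback D.incl).obj F) e1.ge)))
    · intro y
      obtain ⟨n, hn⟩ := h2.1 (resM ((Scheme.Modules.pullback D.incl).obj F) e1.ge y)
      refine ⟨_, (hb n).trans ?_⟩
      rw [hn]
      exact (resM_resM _ _ _ _).trans (resM_self _ _)

end IsExtension

end BaseChange

end S3Flat

end

theorem mainTheorem8
    -- an algebraic `ℂ`-scheme `X` and an open immersion `ι : U ⟶ X`
    (X U : Scheme.{0}) (s : X ⟶ Spec (.of ℂ)) [LocallyOfFiniteType s] [QuasiCompact s]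
    (ι : U ⟶ X) [IsOpenImmersion ι]
    (hX : ∀ p : X, p ∉ Set.range ι →
      3 ≤ S3Flat.depth (X.presheaf.stalk p) (X.presheaf.stalk p))
    -- a deformation `U_A` of `U` over `A`
    (A : Type) [CommRing A] [Algebra ℂ A] [S3Flat.ArtC A]
    (UA : S3Flat.Deformation (ι ≫ s) A)
    -- an `A`-flat coherent sheaf `F` on `U_A`
    (F : UA.total.Modules) (hF : S3Flat.IsCoherent F)
    (hFflat : S3Flat.IsFlatSheaf (S3Flat.toSheafModule UA.proj F))
    -- the stalks of `ι_* (F|_U)` at points outside `U` are finite and have depth at least `3`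
    (hFdepth : ∀ p : X, p ∉ Set.range ι →
      Module.Finite (X.presheaf.stalk p)
        (((Scheme.Modules.pushforward ι).obj
          ((Scheme.Modules.pullback UA.incl).obj F)).presheaf.stalk p) ∧
      3 ≤ S3Flat.depth (X.presheaf.stalk p)
        (((Scheme.Modules.pushforward ι).obj
          ((Scheme.Modules.pullback UA.incl).obj F)).presheaf.stalk p)) :
    -- `j` is `ι` regarded as a map from the space of `U_A`
    let j : (UA.total : TopCat) ⟶ (X : TopCat) := UA.toFibre ≫ ι.base
    let FU : TopCat.Sheaf (ModuleCat A) UA.total := S3Flat.toSheafModule UA.proj F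
    -- (i)
    (∀ (M : Type) [AddCommGroup M] [Module A M] [Module.Finite A M],
      Limits.IsZero (S3Flat.higherDirectImage j 1 (S3Flat.tensor FU (ModuleCat.of A M)))) ∧
    -- (ii)
    (∀ (M : Type) [AddCommGroup M] [Module A M] [Module.Finite A M],
      IsIso (S3Flat.tensorPushforward j FU (ModuleCat.of A M))) ∧
    -- (iii) the sheaf `ι_* F` is flat over `A`
    S3Flat.IsFlatSheaf ((TopCat.Sheaf.pushforward (ModuleCat A) j).obj FU) ∧
    -- (iii) the ringed space `(X, ι_* 𝒪_{U_A})` is (via `e`) a deformation `X_A` of `X`,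
    -- compatibly with `U_A`
    ∃ (XA : S3Flat.Deformation s A)
      (e : XA.total.toSheafedSpace ≅ S3Flat.pushforwardSpace UA.total j)
      (k : UA.total ⟶ XA.total)
      (hk : UA.incl ≫ k = ι ≫ XA.incl),
      k.toLRSHom.toShHom ≫ e.hom = S3Flat.toPushforwardSpace UA.total j ∧
      k ≫ XA.proj = UA.proj ∧
      XA.incl.base ≫ e.hom.hom.base = 𝟙 (X : TopCat) ∧
      LocallyOfFiniteType XA.proj ∧ QuasiCompact XA.proj ∧
      (IsSeparated s → IsSeparated XA.proj) ∧
      -- `ι_* F`, as a module on `X_A`, is coherent and restricts to `ι_* (F|_U)` on `X`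
      S3Flat.IsCoherent ((Scheme.Modules.pushforward k).obj F) ∧
      IsIso (S3Flat.baseChange hk F) := by

  intro j FU
  have hφ := S3Flat.isFibreRestriction_unit UA hF.1 hFflat
  have hW {V : X.Opens} (hV : IsAffineOpen V) :=
    S3Flat.h1Vanishes_tensor_preimageTotal (s := s) hF hFflat hFdepth hV
  obtain ⟨Z, e, k, i, hke, hie, hk, hi, hbij, hki, hiso⟩ :=
    (S3Flat.isThickeningSpan (D := UA) hX).exists_scheme
  have h : S3Flat.IsExtension k i := ⟨hk, hi, hbij, hki, hiso⟩
  obtain ⟨p, hp⟩ := h.exists_proj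
  refine ⟨fun M _ _ _ ↦ ?_, fun M _ _ _ ↦ ?_, ?_, h.deformation hp hX, e, k, hk, hke, hp, hie,
    h.locallyOfFiniteType_proj hp hX, h.quasiCompact_proj, h.isSeparated_proj hp hX,
    h.isCoherent_pushforward (s := s) hF hFflat hFdepth hX,
    h.isIso_baseChange hF hFflat hFdepth hp hX⟩
  · exact S3Flat.isZero_higherDirectImage j _ X.isBasis_affineOpens fun V hV ↦
      hφ.isTensorBasis.H1Vanishes_tensor (hW hV)
  · exact S3Flat.isIso_tensorPushforward j X.isBasis_affineOpens fun V hV ↦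
      hφ.isTensorBasis.toTensor_bijective (hW hV)
  · exact S3Flat.isFlatSheaf_of_isBasis _ X.isBasis_affineOpens fun V hV ↦
      hφ.isTensorBasis.flat_sections (hW hV)
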